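/- Let $\mathbb F=\mathbb Z/2\mathbb Z$. A (toroidal) grid diagram $\mathbb G$ with grid number $n$ is an $n\times n$ grid of squares on the torus in which every row and every column contains exactly one $O$-marking and exactly one $X$-marking, no square containing both. Let $O_1,\dots,O_n$ be its $O$-markings. A grid state is a set $\mathbf x$ of $n$ lattice points with exactly one point on each horizontal and on each vertical circle; $\mathbf S(\mathbb G)$ is the set of grid states. A rectangle from $\mathbf x$ to $\mathbf y$ is an embedded rectangle $r$ in the torus, with edges on the grid circles, whose south-west and north-east corners belong to $\mathbf x$ and whose other two corners belong to $\mathbf y$, such that $\mathbf x$ and $\mathbf y$ agree away from the corners of $r$; $\operatorname{Rect}(\mathbf x,\mathbf y)$ is the set of these. Let $O_i(r)\in\{0,1\}$ be the number of times $r$ contains $O_i$, and $m(r)=\#(\operatorname{Int}(r)\cap\mathbf x)$. Let $GC^\bullet(\mathbb G)$ be the free $\mathbb F[V_1,\dots,V_n,v]$-module with basis $\mathbf S(\mathbb G)$, with the $\mathbb F[V_1,\dots,V_n,v]$-linear endomorphism $$\partial^\bullet(\mathbf x)=\sum_{\mathbf y\in\mathbf S(\mathbb G)}\ \sum_{\substack{r\in\operatorname{Rect}(\mathbf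 x,\mathbf y)\\ r\text{ contains no }X\text{-marking}}}V_1^{O_1(r)}\cdots V_n^{O_n(r)}\,v^{m(r)}\cdot\mathbf y .$$ Bigradings: place $\mathbb G$ in a fundamental domain $[0,n)\times[0,n)$, with lattice points at integer points and markings at centres of unit squares. For finite sets $P,Q$ in the plane let $\mathcal I(P,Q)$ be the number of pairs $(p,q)\in P\times Q$ with $q$ strictly north-east of $p$, let $\mathcal J(P,Q)=\frac12(\mathcal I(P,Q)+\mathcal I(Q,P))$, extended bilinearly to formal sums, let $M_{\mathbb O}(\mathbf x)=\mathcal J(\mathbf x-\mathbb O,\mathbf x-\mathbb O)+1$, and define $M_{\mathbb X}$ likewise. For a diagram of a knot put $M=M_{\mathbb O}$ and $A=\frac12(M_{\mathbb O}-M_{\mathbb X})-\frac{n-1}2$, and let $V_1^{k_1}\cdots V_n^{k_n}v^m\mathbf x$ have bidegree $(M(\mathbf x)-2\sum_i k_i+2m,\ A(\mathbf x)-\sum_i k_i)$. The double-point enhanced grid homology is $GH^\bullet(\mathbb G)=\ker\partial^\bullet/\operatorname{im}\partial^\bullet$; its piece of bidegree $(d,s)$ consists of the classes of homogeneous cycles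 of bidegree $(d,s)$. It is a module over $\mathbb F[U,v]$, where $U$ acts by multiplication by any $V_i$. A stabilization of $\mathbb G$ is a diagram $\mathbb G'$ with grid number $n+1$ obtained as follows. Choose a marked square, erase its marking and the other marking in its row and the other marking in its column, split this row and this column in two, and put new markings in the two new rows and the two new columns so that a grid diagram results in which exactly three of the four squares of the new $2\times2$ block are marked, the two diagonally opposite ones of these three carrying the type of marking of the chosen square and the third one the other type. (There are eight types, $X$ or $O$ for the chosen marking combined with $NW$, $NE$, $SW$, $SE$ for the position of the empty square of the block.) **Theorem.** Let $\mathbb G$ be a grid diagram representing a knot, and let $\mathbb G'$ be obtained from $\mathbb G$ by a stabilization of any of the eight types. Then $\partial^\bullet\circ\partial^\bullet=0$ for $\mathbb G$ and for $\mathbb G'$, and there is an isomorphism $$GH^\bullet(\mathbb G)\cong GH^\bullet(\mathbb G')$$ of bigraded $\mathbb F[U,v]$-modules, that is, an additive bijection which carries the piece of bidegree $(d,s)$ exactly onto the piece of bidegree $(d,s)$ for all $d,s$, commutes with $v$, and intertwines multiplication by $V_i$ on $GH^\bullet(\mathbb G)$ with multiplication by $V_j$ on $GH^\bullet(\mathbb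 G')$ for every $i\in\{1,\dots,n\}$ and every $j\in\{1,\dots,n+1\}$ (so that it does not matter which variables define the actions of $U$). -/

import Mathlib

/-- A toroidal grid diagram with grid number `n`, given by a fundamental domain.  Columns are numbered
from west to east and rows from south to north by `Fin n`.  Column `c` carries its `O`-marking in row
`O c` and its `X`-marking in row `X c`; no square carries both.  The lattice point `(c, r)` is the
south-west corner of the square in column `c` and row `r`. -/
structure GridDiagram (n : ℕ) where
  O : Equiv.Perm (Fin n)
  X : Equiv.Perm (Fin n)
  disjoint : ∀ c, O c ≠ X c

/-- The coefficient ring `𝔽₂[V_1, …, V_n, v]`: the variable `some i` is `V_i`, where the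
`O`-marking `O_i` is the one in column `i`, and the variable `none` is `v`. -/
abbrev GridRing (n : ℕ) : Type := MvPolynomial (Option (Fin n)) (ZMod 2)

/-- A grid state, as the permutation sending a vertical circle `c` to the horizontal circle `x c`
for which the point `(c, x c)` belongs to the state. -/
abbrev GridState (n : ℕ) : Type := Equiv.Perm (Fin n)

/-- The free module over `𝔽₂[V_1, …, V_n, v]` on the (finitely many) grid states: a chain `z` has
the coefficient `z x` at the state `x`. -/
abbrev GC (n : ℕ) : Type := GridState n → GridRing n

/-- `c` lies in the half-open cyclic interval `[i, j)` of `Fin n` (subtraction is modulo `n`). -/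
def InCyc {n : ℕ} (i j c : Fin n) : Prop := c - i < j - i

instance {n : ℕ} (i j c : Fin n) : Decidable (InCyc i j c) :=
  inferInstanceAs (Decidable (c - i < j - i))

/-- The rectangles on the torus from `x` to `y`.  The pair `(l, r)` stands for the embedded rectangle
going east from the vertical circle `l` to the vertical circle `r ≠ l` and north from the
horizontal circle `x l` to the horizontal circle `x r`.  Its south-west corner `(l, x l)` and
north-east corner `(r, x r)` belong to `x`, its other two corners `(l, x r)`, `(r, x l)` belong
to `y`, and `x` and `y` agree at all other vertical circles. -/
def rects {n : ℕ} (x y : GridState n) : Finset (Fin n × Fin n) :=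
  Finset.univ.filter fun p => p.1 ≠ p.2 ∧ y p.1 = x p.2 ∧ y p.2 = x p.1 ∧
    ∀ c, c ≠ p.1 → c ≠ p.2 → y c = x c

/-- The rectangle `p` starting at `x` contains the square in column `c` and row `r`. -/
def HasSquare {n : ℕ} (x : GridState n) (p : Fin n × Fin n) (c r : Fin n) : Prop :=
  InCyc p.1 p.2 c ∧ InCyc (x p.1) (x p.2) r

instance {n : ℕ} (x : GridState n) (p : Fin n × Fin n) (c r : Fin n) :
    Decidable (HasSquare x p c r) :=
  inferInstanceAs (Decidable (_ ∧ _))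

/-- `m(r)`: the number of points of the state `x` in the interior of the rectangle `p`. -/
def interiorCount {n : ℕ} (x : GridState n) (p : Fin n × Fin n) : ℕ :=
  (Finset.univ.filter fun c : Fin n =>
    (c ≠ p.1 ∧ InCyc p.1 p.2 c) ∧ (x c ≠ x p.1 ∧ InCyc (x p.1) (x p.2) (x c))).card

/-- `𝓘(P, Q)`: the number of pairs `p ∈ P`, `q ∈ Q` with `q` strictly north-east of `p`. -/
def neCount (P Q : Finset (ℤ × ℤ)) : ℤ :=
  (((P ×ˢ Q).filter fun t => t.1.1 < t.2.1 ∧ t.1.2 < t.2.2).card : ℤ)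

/-- The points of a grid state in the fundamental domain `[0, n) × [0, n)`, with all coordinates
multiplied by two. -/
def statePoints {n : ℕ} (x : GridState n) : Finset (ℤ × ℤ) :=
  Finset.univ.image fun c : Fin n => (2 * (c.val : ℤ), 2 * ((x c).val : ℤ))

/-- The centres of the squares `(c, σ c)`, with all coordinates multiplied by two. -/
def markPoints {n : ℕ} (σ : Equiv.Perm (Fin n)) : Finset (ℤ × ℤ) :=
  Finset.univ.image fun c : Fin n => (2 * (c.val : ℤ) + 1, 2 * ((σ c).val : ℤ) + 1)

/-- `M_σ(x) = 𝓙(x - σ, x - σ) + 1`, where `𝓙` is the bilinear extension of the symmetrization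
`𝓙(P, Q) = (𝓘(P, Q) + 𝓘(Q, P)) / 2`. -/
def maslovWrt {n : ℕ} (σ : Equiv.Perm (Fin n)) (x : GridState n) : ℤ :=
  neCount (statePoints x) (statePoints x)
    - (neCount (statePoints x) (markPoints σ) + neCount (markPoints σ) (statePoints x))
    + neCount (markPoints σ) (markPoints σ) + 1

/-- The ring homomorphism `𝔽₂[U, v] → 𝔽₂[V_1, …, V_n, v]` with
`U ↦ V_i` and `v ↦ v`.  The variable `0` of the source is `U` and the variable `1` is `v`. -/
noncomputable def uvHom {n : ℕ} (i : Fin n) : MvPolynomial (Fin 2) (ZMod 2) →+* GridRing n :=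
  (MvPolynomial.aeval ![MvPolynomial.X (some i), MvPolynomial.X none] :
    MvPolynomial (Fin 2) (ZMod 2) →ₐ[ZMod 2] GridRing n).toRingHom

namespace GridDiagram

variable {n : ℕ} (G : GridDiagram n)

/-- The diagram represents a knot (a link with exactly one component): going from a column to its
`O`-marking, along the row to the `X`-marking, and so on, runs through all columns in one cycle.
(No column is fixed, so being a cycle means being transitive on a nonempty set.) -/
def IsKnot : Prop := (G.X⁻¹ * G.O).IsCycle

/-- The Maslov grading of a grid state. -/
def maslov (x : GridState n) : ℤ := maslovWrt G.O x

/-- The Alexander grading of a grid state of a knot diagram,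
`A(x) = (M_𝕆(x) - M_𝕏(x)) / 2 - (n - 1) / 2`. -/
def alexander (x : GridState n) : ℚ :=
  ((maslovWrt G.O x : ℚ) - (maslovWrt G.X x : ℚ)) / 2 - ((n : ℚ) - 1) / 2

/-- The rectangle contains no `X`-marking. -/
def AvoidsX (x : GridState n) (p : Fin n × Fin n) : Prop := ∀ c, ¬ HasSquare x p c (G.X c)

instance (x : GridState n) (p : Fin n × Fin n) : Decidable (G.AvoidsX x p) :=
  inferInstanceAs (Decidable (∀ _, _))

/-- `O_i(r) ∈ {0, 1}`. -/
def countO (x : GridState n) (p : Fin n × Fin n) (i : Fin n) : ℕ :=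
  if HasSquare x p i (G.O i) then 1 else 0

/-- The differential `∂^•`: every rectangle from `x` to `y` without `X`-markings contributes
`V_1^{O_1(r)} ⋯ V_n^{O_n(r)} v^{m(r)} · y`. -/
noncomputable def diff : GC n →ₗ[GridRing n] GC n :=
  Fintype.linearCombination (GridRing n) fun x : GridState n =>
    fun y : GridState n => ∑ p ∈ (rects x y).filter fun p => G.AvoidsX x p,
      (∏ i, (MvPolynomial.X (some i) : GridRing n) ^ G.countO x p i)
        * (MvPolynomial.X none : GridRing n) ^ interiorCount x p

/-- The chain `z` is homogeneous of Maslov degree `d` and Alexander degree `s`: every monomial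
`V_1^{k_1} ⋯ V_n^{k_n} v^m · x` in it satisfies `M(x) - 2 ∑ k_i + 2 m = d` and
`A(x) - ∑ k_i = s`. -/
def HomogeneousChain (d : ℤ) (s : ℚ) (z : GC n) : Prop :=
  ∀ x : GridState n, ∀ k ∈ (z x).support,
    G.maslov x - 2 * ∑ i, (k (some i) : ℤ) + 2 * (k none : ℤ) = d ∧
    G.alexander x - ∑ i, (k (some i) : ℚ) = s

/-- Double-point enhanced grid homology: cycles modulo boundaries. -/
abbrev GH : Type :=
  LinearMap.ker G.diff ⧸ (LinearMap.range G.diff).submoduleOf (LinearMap.ker G.diff)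

/-- The homology class `h` lies in the bigraded piece of bidegree `(d, s)`: it is represented by a
homogeneous cycle of that bidegree. -/
def HomogeneousClass (d : ℤ) (s : ℚ) (h : G.GH) : Prop :=
  ∃ z : LinearMap.ker G.diff, G.HomogeneousChain d s z ∧ Submodule.Quotient.mk z = h

/-- The same toroidal diagram seen in the fundamental domain moved by `s` columns and `t` rows. -/
def translate (s t : ℕ) : GridDiagram n where
  O := finRotate n ^ t * G.O * (finRotate n ^ s)⁻¹
  X := finRotate n ^ t * G.X * (finRotate n ^ s)⁻¹
  disjoint c := by
    intro h
    exact G.disjoint ((finRotate n ^ s)⁻¹ c) ((finRotate n ^ t).injective h)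

/-- Exchange the roles of the `X`- and the `O`-markings. -/
def exchange : GridDiagram n where
  O := G.X
  X := G.O
  disjoint c := (G.disjoint c).symm

/-- `G'` arises from `G` by a stabilization at the `X`-marked square in column `c₀`.  That column and
its row are split in two; `a` and `b` are the positions of the added column and row in `G'`,
next to (the other half of) the split ones, and `succAbove` renumbers the old columns and rows.
The two columns and two rows form a `2 × 2` block, in which the added column meets the added row
in an `O`-marking, the two neighbours of that square in the block carry an `X`-marking, and the
fourth square is empty; everything else is as in `G`.  The two choices of side for the column and
for the row give the four types: the empty square is the `SW`, `SE`, `NW` or `NE` one. -/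
def IsXStabilization (G : GridDiagram n) (G' : GridDiagram (n + 1)) : Prop :=
  ∃ (c₀ : Fin n) (a b : Fin (n + 1)),
    (a.succAbove c₀ = a + 1 ∨ a = a.succAbove c₀ + 1) ∧
    (b.succAbove (G.X c₀) = b + 1 ∨ b = b.succAbove (G.X c₀) + 1) ∧
    G'.O a = b ∧ (∀ c, G'.O (a.succAbove c) = b.succAbove (G.O c)) ∧
    G'.X a = b.succAbove (G.X c₀) ∧ G'.X (a.succAbove c₀) = b ∧
    ∀ c, c ≠ c₀ → G'.X (a.succAbove c) = b.succAbove (G.X c)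

/-- `G'` arises from the toroidal diagram `G` by a stabilization of any of the eight types (`X` or `O`,
with empty square `SW`, `SE`, `NW` or `NE`), whatever fundamental domains are used. -/
def IsStabilization (G : GridDiagram n) (G' : GridDiagram (n + 1)) : Prop :=
  ∃ s t : ℕ, IsXStabilization (G.translate s t) G' ∨
    IsXStabilization (G.translate s t).exchange G'.exchange

end GridDiagram

/-!
A grid differential counts rectangles with weights, so all constructions below are counts of rectangles
(`rectMatrix`) with products of weights of squares and of `v` for each interior point (`scal`). Such a
count squares to a scalar: disjoint pairs of rectangles cancel in pairs, pairs that share one vertical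
circle cancel in the `3 × 3` grid cut out by the three circles involved, and what remains are the thin
annuli of width one, provided that thicker annuli, which carry a positive power of `v`, have weight `0`
(`scal_sq`). In a grid diagram every annulus contains an `X`-marking, of weight `0`; hence `∂ ∘ ∂ = 0`
(`GridDiagram.diff_comp_diff`). For the commutations a more general count is needed, where the two
columns at one special vertical circle carry, instead of scalars, elements of a noncommutative ring
which are multiplied along the edge of a rectangle on this circle (`TurnData.rectMatrix_sq_eq`). With
the variable `v` this only works if rectangles of width one at the special circle are also allowed to go
once more around the torus, with weight `v`.

Acyclicity is always obtained from `exists_eq_mulVec_of_dual`: a weight `ε` is put on an `O`-marking or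
on a link in such a way that, modulo the other variables, the differential squares to `ε`; the
coefficient of `ε` is then a contraction, up to terms that raise the function `M_𝕆 - 2 M_𝕏`, suitably
corrected.

*Blocks.* Suppose that `G'` has a `2 × 2` block with `X`-markings in the south-west and north-east
squares and one `O`-marking, and that `G` arises by merging the two columns and the two rows. The states
of `G'` through the middle of the block form a subcomplex, which is the complex of `G` with one more
variable. If the north-east `X`-marking is erased and the other squares of the block are blocked, an
acyclic complex arises (`GridDiagram.IsBlock.exact`) with the same diagonal blocks as `∂`. The composite
of the two remaining off-diagonal blocks counts round trips from the middle of the block, which sweep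
out thin annuli; so it is the scalar `ω`, the sum of the variables of the `O`-markings in the column and
in the row of the erased `X`-marking (`blockPair_rectMatrix`, `GridDiagram.IsBlock.annulusSum_ne`). By
linear algebra (`BlockPair`) the homology of `G'` is that of the subcomplex modulo `ω`, that is, the
homology of `G`, and `ω` acts on it as zero (`GridDiagram.IsBlockRemoval.gridIso`). The south-west
`X`-marking gives a second relation.

*Commutations.* A column with two vertically adjacent markings can be interchanged with any neighbouring
column (`GridDiagram.IsPairColumn.gridIso`). Here the elements at the special circle between the two
columns are `2 × 2` matrices with the weights of the two columns on the diagonal and an entry `1` and an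
entry `ε` off the diagonal, at the two markings (`pairUp`). The diagonal entries of the count are the
two differentials. For `ε = 0` one off-diagonal entry vanishes and the other one is a chain map; the
square of the count is `ε`, so that the cone of the chain map is acyclic.

*Stabilizations.* Each of the eight types creates a column with two vertically adjacent markings
(`GridDiagram.IsPairStabilization`); for a stabilization at an `O`-marking the roles of the two new rows
are exchanged. This column is moved to the right by commutations until it forms a block with the
`X`-marking that was moved to the new row (`GridDiagram.IsPairStabilization.isStableIso`).

*Variables.* A stabilization at the `X`-marking of a column creates a block, whose two relations show
that the variables of the `O`-markings in the column and in the row of this `X`-marking act alike on the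
homology of the original diagram (`GridDiagram.smul_X_eq`). For a knot all `O`-markings are connected in
this way (`GridDiagram.IsKnot.smul_X_eq`).
-/

/-! ### Cyclic intervals -/

theorem Fin.sub_val_eq {N : ℕ} (c i : Fin N) :
    (c - i).val = if i.val ≤ c.val then c.val - i.val else c.val + N - i.val := by
  have h1 := c.isLt
  have h2 := i.isLt
  rw [Fin.val_sub]
  split_ifs with h
  · rw [show N - i.val + c.val = (c.val - i.val) + N by omega, Nat.add_mod_right,
      Nat.mod_eq_of_lt (by omega)]
  · rw [Nat.mod_eq_of_lt (by omega)]
    omega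

theorem inCyc_iff {N : ℕ} (i j c : Fin N) :
    InCyc i j c ↔ (i.val ≤ c.val ∧ c.val < j.val) ∨
      (j.val < i.val ∧ (i.val ≤ c.val ∨ c.val < j.val)) := by
  have h1 := c.isLt
  have h2 := i.isLt
  have h3 := j.isLt
  rw [InCyc, Fin.lt_def, Fin.sub_val_eq, Fin.sub_val_eq]
  split_ifs <;> omega

theorem inCyc_left {N : ℕ} {i j : Fin N} (h : i ≠ j) : InCyc i j i := by
  rw [Ne, Fin.ext_iff] at h
  rw [inCyc_iff]
  omega

theorem not_inCyc_right {N : ℕ} (i j : Fin N) : ¬ InCyc i j j := by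
  rw [inCyc_iff]
  omega

theorem not_inCyc_self {N : ℕ} (i c : Fin N) : ¬ InCyc i i c := by
  rw [inCyc_iff]
  omega

theorem inCyc_compl {N : ℕ} {i j : Fin N} (h : i ≠ j) (c : Fin N) :
    InCyc j i c ↔ ¬ InCyc i j c := by
  rw [Ne, Fin.ext_iff] at h
  rw [inCyc_iff, inCyc_iff]
  omega

/-- The half-open cyclic interval `[i, j)` as a finite set. -/
def cyc {N : ℕ} (i j : Fin N) : Finset (Fin N) := Finset.univ.filter (InCyc i j)

@[simp] theorem mem_cyc {N : ℕ} {i j c : Fin N} : c ∈ cyc i j ↔ InCyc i j c := by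
  simp [cyc]

/-- An injection `c` of a small cycle into a large one that preserves the cyclic order, together with
the retraction `a` that sends a point of the large cycle to the arc `[c k, c (k + 1))` in which
it lies. -/
structure CycMap {m N : ℕ} (c : Fin m → Fin N) (a : Fin N → Fin m) : Prop where
  inCyc : ∀ i j t, InCyc (c i) (c j) t ↔ InCyc i j (a t)
  retr : ∀ i, a (c i) = i

namespace CycMap

variable {m N : ℕ} {c : Fin m → Fin N} {a : Fin N → Fin m}

theorem injective (h : CycMap c a) : Function.Injective c :=
  Function.LeftInverse.injective h.retr

theorem cyc_eq (h : CycMap c a) (i j : Fin m) :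
    cyc (c i) (c j) = (cyc i j).biUnion fun k => Finset.univ.filter fun t => a t = k := by
  ext t
  simp [h.inCyc]

theorem prod_cyc {A : Type*} [CommMonoid A] (h : CycMap c a) (f : Fin N → A) (i j : Fin m) :
    ∏ t ∈ cyc (c i) (c j), f t = ∏ k ∈ cyc i j, ∏ t ∈ Finset.univ.filter (fun t => a t = k), f t := by
  rw [h.cyc_eq, Finset.prod_biUnion]
  intro k _ l _ hkl
  rw [Function.onFun, Finset.disjoint_left]
  intro t ht ht'
  simp only [Finset.mem_filter, Finset.mem_univ, true_and] at ht ht'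
  exact hkl (ht.symm.trans ht')

end CycMap

/-- Three distinct points in cyclic order span a cyclic map from `Fin 3`. -/
theorem cycMap_three {N : ℕ} {p q r : Fin N} (hpq : p ≠ q) (hqr : q ≠ r) (hpr : p ≠ r)
    (h : InCyc p r q) :
    CycMap ![p, q, r] fun t => if InCyc p q t then 0 else if InCyc q r t then 1 else 2 := by
  rw [inCyc_iff] at h
  rw [Ne, Fin.ext_iff] at hpq hqr hpr
  constructor
  · intro i j t
    simp only [inCyc_iff (N := N)]
    fin_cases i <;> fin_cases j <;> simp <;> split_ifs <;> simp [inCyc_iff] <;> omega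
  · intro i
    fin_cases i
    · exact if_pos (inCyc_left (by rwa [Ne, Fin.ext_iff]))
    · refine (if_neg (not_inCyc_right _ _)).trans (if_pos (inCyc_left (by rwa [Ne, Fin.ext_iff])))
    · refine (if_neg ?_).trans (if_neg (not_inCyc_right _ _))
      simp [inCyc_iff]
      omega

/-! ### Weighted rectangle counts -/

section Weights

variable {N : ℕ} {A : Type*} [CommRing A]

/-- The scalar weight of the rectangle `(l, r)` starting at the state `x`: the product of the weights
`u` of its squares times `v` to the number of its interior points. -/
def scal (u : Fin N → Fin N → A) (v : A) (x : GridState N) (l r : Fin N) : A :=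
  (∏ t ∈ cyc l r, ∏ q ∈ cyc (x l) (x r), u t q) * v ^ interiorCount x (l, r)

theorem interiorCount_eq (x : GridState N) (l r : Fin N) :
    interiorCount x (l, r) =
      ((cyc l r).filter fun c => c ≠ l ∧ InCyc (x l) (x r) (x c)).card := by
  rw [interiorCount]
  congr 1
  ext c
  simp only [Finset.mem_filter, Finset.mem_univ, true_and, mem_cyc, Ne, x.injective.eq_iff]
  tauto

variable {m : ℕ} {c h : Fin m → Fin N} {a b : Fin N → Fin m}

/-- The weight of a box of the coarse grid cut out by the circles `c` and `h`, where `a` and `b` send a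
circle of the fine grid to the arc that contains it: the weights of the squares of the box, and a factor
`v` for each point of the state in it that does not lie on the circles `c`. -/
def boxWeight (c : Fin m → Fin N) (a b : Fin N → Fin m) (u : Fin N → Fin N → A) (v : A)
    (x : GridState N) (i j : Fin m) : A :=
  (∏ t ∈ Finset.univ.filter (fun t => a t = i), ∏ q ∈ Finset.univ.filter (fun q => b q = j), u t q) *
    v ^ (Finset.univ.filter fun t => (t ∉ Set.range c ∧ a t = i) ∧ b (x t) = j).card

theorem interiorCount_coarse (hc : CycMap c a) (hh : CycMap h b) (x : GridState N)
    (y : GridState m) (hxy : ∀ k, x (c k) = h (y k)) (i j : Fin m) :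
    interiorCount x (c i, c j) = interiorCount y (i, j) +
      ∑ k ∈ cyc i j, ∑ l ∈ cyc (y i) (y j),
        (Finset.univ.filter fun t => (t ∉ Set.range c ∧ a t = k) ∧ b (x t) = l).card := by
  classical
  rw [interiorCount_eq, interiorCount_eq]
  rw [← Finset.card_filter_add_card_filter_not (p := fun t => t ∈ Set.range c)]
  congr 1
  · symm
    refine Finset.card_bij (fun k _ => c k) ?_ (fun k _ l _ e => hc.injective e) ?_
    · intro k
      simp only [Finset.mem_filter, mem_cyc, hxy, hc.inCyc, hh.inCyc, hc.retr, hh.retr,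
        hc.injective.ne_iff, Set.mem_range_self, and_true, imp_self]
    · rintro t ht
      simp only [Finset.mem_filter] at ht
      obtain ⟨⟨h1, h2⟩, k, rfl⟩ := ht
      refine ⟨k, ?_, rfl⟩
      simpa only [Finset.mem_filter, mem_cyc, hxy, hc.inCyc, hh.inCyc, hc.retr, hh.retr,
        hc.injective.ne_iff] using And.intro h1 h2
  · rw [← Finset.sum_product', ← Finset.card_biUnion]
    · congr 1
      ext t
      simp only [Finset.mem_filter, mem_cyc, Finset.mem_biUnion, Finset.mem_product,
        Finset.mem_univ, true_and, Prod.exists, hxy, hc.inCyc, hh.inCyc]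
      constructor
      · rintro ⟨⟨h1, h2, h3⟩, h4⟩
        exact ⟨_, _, ⟨h1, h3⟩, ⟨h4, rfl⟩, rfl⟩
      · rintro ⟨k, l, ⟨h1, h3⟩, ⟨h4, rfl⟩, rfl⟩
        exact ⟨⟨h1, fun e => h4 ⟨i, e.symm⟩, h3⟩, h4⟩
    · rintro p _ q _ hpq
      rw [Function.onFun, Finset.disjoint_left]
      intro t ht ht'
      simp only [Finset.mem_filter, Finset.mem_univ, true_and] at ht ht'
      exact hpq (Prod.ext (ht.1.2.symm.trans ht'.1.2) (ht.2.symm.trans ht'.2))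

theorem scal_coarse (hc : CycMap c a) (hh : CycMap h b) (u : Fin N → Fin N → A) (v : A)
    (x : GridState N) (y : GridState m) (hxy : ∀ k, x (c k) = h (y k)) (i j : Fin m) :
    scal u v x (c i) (c j) = scal (boxWeight c a b u v x) v y i j := by
  rw [scal, interiorCount_coarse hc hh x y hxy, scal, hc.prod_cyc]
  simp only [hxy, hh.prod_cyc, boxWeight, Finset.prod_mul_distrib, Finset.prod_pow_eq_pow_sum,
    pow_add]
  rw [mul_assoc, mul_comm (v ^ interiorCount _ _)]
  congr 1
  refine Finset.prod_congr rfl fun k _ => ?_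
  exact Finset.prod_comm

theorem boxWeight_mul_swap (u : Fin N → Fin N → A) (v : A) (x : GridState N) (k l : Fin m) :
    boxWeight c a b u v (x * Equiv.swap (c k) (c l)) = boxWeight c a b u v x := by
  funext i j
  simp only [boxWeight]
  congr 3
  refine Finset.filter_congr fun t _ => and_congr_right fun ht => ?_
  rw [Equiv.Perm.mul_apply, Equiv.swap_apply_of_ne_of_ne]
  · exact fun e => ht.1 ⟨k, e.symm⟩
  · exact fun e => ht.1 ⟨l, e.symm⟩

end Weights

/-! ### Squares of rectangle counts -/

section Square

variable {N : ℕ} {M : Type*} [Ring M]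

theorem mem_rects {x y : GridState N} {p : Fin N × Fin N} :
    p ∈ rects x y ↔ p.1 ≠ p.2 ∧ x * Equiv.swap p.1 p.2 = y := by
  simp only [rects, Finset.mem_filter, Finset.mem_univ, true_and]
  refine and_congr_right fun hp => ⟨?_, ?_⟩
  · rintro ⟨h1, h2, h3⟩
    ext1 c
    rw [Equiv.Perm.mul_apply]
    rcases eq_or_ne c p.1 with rfl | hc1
    · rw [Equiv.swap_apply_left, h1]
    rcases eq_or_ne c p.2 with rfl | hc2
    · rw [Equiv.swap_apply_right, h2]
    rw [Equiv.swap_apply_of_ne_of_ne hc1 hc2, h3 c hc1 hc2]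
  · rintro rfl
    refine ⟨by simp, by simp, fun c h1 h2 => ?_⟩
    rw [Equiv.Perm.mul_apply, Equiv.swap_apply_of_ne_of_ne h1 h2]

/-- The matrix of the operator that counts rectangles with the weight `w`: the entry at `(z, x)` is the
total weight of the rectangles from `x` to `z`. -/
def rectMatrix (w : GridState N → Fin N → Fin N → M) : Matrix (GridState N) (GridState N) M :=
  fun z x => ∑ p ∈ rects x z, w x p.1 p.2

/-- The weighted count of the pairs of consecutive rectangles of which the first one has its vertical
edges on `i`, `j` and the second one on `j`, `k`. -/
def tripleCount (w : GridState N → Fin N → Fin N → M) (x : GridState N) (i j k : Fin N) : M :=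
  (w (x * Equiv.swap i j) j k + w (x * Equiv.swap i j) k j) * (w x i j + w x j i)

/-- The sum over all pairs, sorted by the number of elements that they share with `{l, r}`. -/
theorem sum_pair_split (f : Fin N → Fin N → M) (hf : ∀ c, f c c = 0) {l r : Fin N} (hlr : l ≠ r) :
    ∑ i, ∑ j, f i j = f l r + f r l +
      (∑ t, if t ≠ l ∧ t ≠ r then f l t + f t l + (f r t + f t r) else 0) +
      ∑ i, ∑ j, if (i ≠ l ∧ i ≠ r) ∧ (j ≠ l ∧ j ≠ r) then f i j else 0 := by
  have key : ∀ g : Fin N → M, ∑ i, g i = g l + g r + ∑ t, if t ≠ l ∧ t ≠ r then g t else 0 := by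
    intro g
    rw [← Finset.sum_filter, ← Finset.sum_pair hlr, ← Finset.sum_add_sum_compl {l, r}]
    congr 2
    ext t
    simp
  have e1 : ∀ i, ∑ j, f i j = f i l + f i r + ∑ t, if t ≠ l ∧ t ≠ r then f i t else 0 :=
    fun i => key (f i)
  rw [key fun i => ∑ j, f i j, e1 l, e1 r, hf, hf]
  have e2 : ∀ t : Fin N, (if t ≠ l ∧ t ≠ r then ∑ j, f t j else 0) =
      (if t ≠ l ∧ t ≠ r then f t l + f t r else 0) +
      ∑ j, if (t ≠ l ∧ t ≠ r) ∧ (j ≠ l ∧ j ≠ r) then f t j else 0 := by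
    intro t
    by_cases ht : t ≠ l ∧ t ≠ r
    · simp only [if_pos ht, e1 t, and_iff_right ht]
    · simp only [ht, false_and, if_false, Finset.sum_const_zero, add_zero]
  have e3 : ∀ t : Fin N, (if t ≠ l ∧ t ≠ r then f l t + f t l + (f r t + f t r) else 0) =
      (if t ≠ l ∧ t ≠ r then f l t else 0) + (if t ≠ l ∧ t ≠ r then f r t else 0) +
      (if t ≠ l ∧ t ≠ r then f t l + f t r else 0) := by
    intro t
    split_ifs
    · abel
    · simp
  rw [Finset.sum_congr rfl fun t _ => e2 t, Finset.sum_congr rfl fun t _ => e3 t]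
  simp only [Finset.sum_add_distrib]
  abel

theorem swap_mul_swap_rotate {i j k : Fin N} (hki : k ≠ i) (hkj : k ≠ j) :
    Equiv.swap i j * Equiv.swap j k = Equiv.swap k i * Equiv.swap i j := by
  rw [Equiv.mul_swap_eq_swap_mul, Equiv.swap_apply_right, Equiv.swap_apply_of_ne_of_ne hki hkj,
    Equiv.swap_comm i k]

/-- The square of a rectangle count, as a sum over all pairs of successive transpositions. -/
theorem rectMatrix_sq_apply (w : GridState N → Fin N → Fin N → M) (x z : GridState N) :
    (rectMatrix w * rectMatrix w) z x = ∑ l, ∑ r, ∑ i, ∑ j,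
      if (l ≠ r ∧ i ≠ j) ∧ x * Equiv.swap l r * Equiv.swap i j = z then
        w (x * Equiv.swap l r) i j * w x l r else 0 := by
  have h : ∀ x z : GridState N, rectMatrix w z x =
      ∑ p : Fin N × Fin N, if p.1 ≠ p.2 ∧ x * Equiv.swap p.1 p.2 = z then w x p.1 p.2 else 0 := by
    intro x z
    rw [rectMatrix, ← Finset.sum_filter]
    refine Finset.sum_congr ?_ fun _ _ => rfl
    ext p
    simp [mem_rects]
  rw [Matrix.mul_apply]
  simp only [h x, Finset.mul_sum]
  rw [Finset.sum_comm, Fintype.sum_prod_type]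
  refine Finset.sum_congr rfl fun l _ => Finset.sum_congr rfl fun r _ => ?_
  simp only [mul_ite, mul_zero]
  by_cases hlr : l = r
  · simp [hlr]
  · simp only [ne_eq, hlr, not_false_eq_true, true_and]
    rw [Finset.sum_ite_eq Finset.univ]
    simp only [Finset.mem_univ, if_true]
    rw [h, Finset.sum_mul, Fintype.sum_prod_type]
    simp [ite_mul]

/-- The square of a weighted rectangle count is diagonal as soon as rectangles on disjoint pairs of
vertical circles commute and the contributions of every three vertical circles cancel. -/
theorem rectMatrix_sq (w : GridState N → Fin N → Fin N → M) (h2 : (2 : M) = 0)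
    (hcomm : ∀ (x : GridState N) (l r i j : Fin N), l ≠ r → i ≠ j → i ≠ l → i ≠ r → j ≠ l → j ≠ r →
      w (x * Equiv.swap l r) i j * w x l r = w (x * Equiv.swap i j) l r * w x i j)
    (htriple : ∀ (x : GridState N) (i j k : Fin N), i ≠ j → j ≠ k → i ≠ k →
      tripleCount w x i j k + tripleCount w x j k i + tripleCount w x k i j = 0)
    (x z : GridState N) :
    (rectMatrix w * rectMatrix w) z x = if x = z then ∑ l, ∑ r, if l ≠ r then
      (w (x * Equiv.swap l r) l r + w (x * Equiv.swap l r) r l) * w x l r else 0 else 0 := by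
  have hneg : ∀ a : M, a + a = 0 := fun a => by rw [← two_mul, h2, zero_mul]
  rw [rectMatrix_sq_apply]
  set F : Fin N → Fin N → Fin N → Fin N → M := fun l r i j =>
    if (l ≠ r ∧ i ≠ j) ∧ x * Equiv.swap l r * Equiv.swap i j = z then
        w (x * Equiv.swap l r) i j * w x l r else 0 with hF
  have hF1 : ∀ l r c, F l r c c = 0 := fun l r c => by simp [hF]
  have hF0 : ∀ l i j, F l l i j = 0 := fun l i j => by simp [hF]
  have step : ∀ l r, ∑ i, ∑ j, F l r i j = (F l r l r + F l r r l) +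
      (∑ t, if (l ≠ r ∧ t ≠ l ∧ t ≠ r) then
        F l r l t + F l r t l + (F l r r t + F l r t r) else 0) +
      ∑ i, ∑ j, if (i ≠ l ∧ i ≠ r) ∧ (j ≠ l ∧ j ≠ r) then F l r i j else 0 := by
    intro l r
    by_cases hlr : l = r
    · subst hlr
      simp [hF0]
    · rw [sum_pair_split _ (hF1 l r) hlr]
      simp [hlr]
  change ∑ l, ∑ r, ∑ i, ∑ j, F l r i j = _
  simp only [step, Finset.sum_add_distrib]
  -- On disjoint pairs of circles the two rectangles can be interchanged.
  have hdisj : ∑ l, ∑ r, ∑ i, ∑ j, (if (i ≠ l ∧ i ≠ r) ∧ (j ≠ l ∧ j ≠ r) then F l r i j else 0)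
      = 0 := by
    suffices h : ∑ t : (Fin N × Fin N) × (Fin N × Fin N),
        (if (t.2.1 ≠ t.1.1 ∧ t.2.1 ≠ t.1.2) ∧ (t.2.2 ≠ t.1.1 ∧ t.2.2 ≠ t.1.2) then
          F t.1.1 t.1.2 t.2.1 t.2.2 else 0) = 0 by
      simpa only [Fintype.sum_prod_type] using h
    refine Finset.sum_involution (fun t _ => (t.2, t.1)) ?_ ?_ (fun _ _ => Finset.mem_univ _)
      (fun _ _ => rfl)
    · rintro ⟨⟨l, r⟩, i, j⟩ -
      simp only
      by_cases hd : (i ≠ l ∧ i ≠ r) ∧ (j ≠ l ∧ j ≠ r)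
      · obtain ⟨⟨d1, d2⟩, d3, d4⟩ := hd
        rw [if_pos ⟨⟨d1, d2⟩, d3, d4⟩, if_pos ⟨⟨d1.symm, d3.symm⟩, d2.symm, d4.symm⟩]
        simp only [hF]
        have hs : x * Equiv.swap i j * Equiv.swap l r = x * Equiv.swap l r * Equiv.swap i j := by
          rw [mul_assoc, mul_assoc, (Equiv.Perm.Disjoint.commute _ : Commute (Equiv.swap i j) _).eq]
          intro c
          by_cases hc : c = i ∨ c = j
          · right
            rcases hc with rfl | rfl
            · exact Equiv.swap_apply_of_ne_of_ne d1 d2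
            · exact Equiv.swap_apply_of_ne_of_ne d3 d4
          · left
            push Not at hc
            exact Equiv.swap_apply_of_ne_of_ne hc.1 hc.2
        rw [hs]
        by_cases hlr : (l ≠ r ∧ i ≠ j) ∧ x * Equiv.swap l r * Equiv.swap i j = z
        · rw [if_pos hlr, if_pos ⟨hlr.1.symm, hlr.2⟩, hcomm x l r i j hlr.1.1 hlr.1.2 d1 d2 d3 d4,
            hneg]
        · rw [if_neg hlr, if_neg (fun h => hlr ⟨h.1.symm, h.2⟩), add_zero]
      · rw [if_neg hd, if_neg (fun h => hd ⟨⟨h.1.1.symm, h.2.1.symm⟩, h.1.2.symm, h.2.2.symm⟩),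
          add_zero]
    · rintro ⟨⟨l, r⟩, i, j⟩ - hne heq
      apply hne
      simp only [Prod.mk.injEq] at heq
      simp [heq.1.1]
  rw [hdisj, add_zero]
  -- The composites of two transpositions on three circles are the two rotations, and each rotation is such
  -- a composite in three ways, which `tripleCount` collects.
  have htrip : ∑ l, ∑ r, ∑ t, (if (l ≠ r ∧ t ≠ l ∧ t ≠ r) then
        F l r l t + F l r t l + (F l r r t + F l r t r) else 0) = 0 := by
    set T : Fin N → Fin N → Fin N → M := fun i j k =>
      if (i ≠ j ∧ j ≠ k ∧ k ≠ i) ∧ x * (Equiv.swap i j * Equiv.swap j k) = z then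
        tripleCount w x i j k else 0 with hT
    have e1 : ∑ l, ∑ r, ∑ t, (if (l ≠ r ∧ t ≠ l ∧ t ≠ r) then
        F l r l t + F l r t l + (F l r r t + F l r t r) else 0) = ∑ i, ∑ j, ∑ k, T i j k := by
      have : ∀ i j k, T i j k = (if (i ≠ j ∧ k ≠ i ∧ k ≠ j) then F j i j k + F j i k j else 0) +
          (if (i ≠ j ∧ k ≠ i ∧ k ≠ j) then F i j j k + F i j k j else 0) := by
        intro i j k
        by_cases hd : i ≠ j ∧ k ≠ i ∧ k ≠ j
        · have hd2 : (i ≠ j ∧ j ≠ k ∧ k ≠ i) := ⟨hd.1, hd.2.2.symm, hd.2.1⟩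
          simp only [hT, hF, hd2, ne_eq, hd.1.symm, hd.2.2, not_false_eq_true, and_self,
            true_and, Equiv.swap_comm k j, Equiv.swap_comm j i, mul_assoc]
          split_ifs
          · rw [tripleCount]
            noncomm_ring
          · simp
        · have : ¬ (i ≠ j ∧ j ≠ k ∧ k ≠ i) := fun h => hd ⟨h.1, h.2.2, h.2.1.symm⟩
          simp only [hT, if_neg hd, this, false_and, if_false, add_zero]
      simp only [this, Finset.sum_add_distrib]
      rw [Finset.sum_comm (f := fun i j => ∑ k, if (i ≠ j ∧ k ≠ i ∧ k ≠ j) then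
        F j i j k + F j i k j else 0)]
      simp only [← Finset.sum_add_distrib]
      refine Finset.sum_congr rfl fun i _ => Finset.sum_congr rfl fun j _ =>
        Finset.sum_congr rfl fun k _ => ?_
      have hiff : (j ≠ i ∧ k ≠ j ∧ k ≠ i) ↔ (i ≠ j ∧ k ≠ i ∧ k ≠ j) := by tauto
      simp only [hiff]
      split_ifs
      · rfl
      · rw [add_zero]
    rw [e1]
    have e2 : ∑ i, ∑ j, ∑ k, T j k i = ∑ i, ∑ j, ∑ k, T i j k := by
      rw [Finset.sum_comm]
      refine Finset.sum_congr rfl fun j _ => ?_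
      rw [Finset.sum_comm]
    have e3 : ∑ i, ∑ j, ∑ k, T k i j = ∑ i, ∑ j, ∑ k, T i j k := by
      rw [Finset.sum_congr rfl fun i _ => Finset.sum_comm]
      exact Finset.sum_comm
    have hsum : ∀ i j k, T i j k + T j k i + T k i j = 0 := by
      intro i j k
      by_cases hd : i ≠ j ∧ j ≠ k ∧ k ≠ i
      · obtain ⟨d1, d2, d3⟩ := hd
        have r1 : Equiv.swap j k * Equiv.swap k i = Equiv.swap i j * Equiv.swap j k := by
          exact swap_mul_swap_rotate d1 d3.symm
        have r2 : Equiv.swap k i * Equiv.swap i j = Equiv.swap i j * Equiv.swap j k :=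
          (swap_mul_swap_rotate d3 d2.symm).symm
        simp only [hT, r1, r2, d1, d2, d3, ne_eq, not_false_eq_true, true_and]
        split_ifs
        · exact htriple x i j k d1 d2 d3.symm
        · simp
      · have hd1 : ¬ (j ≠ k ∧ k ≠ i ∧ i ≠ j) := by tauto
        have hd2 : ¬ (k ≠ i ∧ i ≠ j ∧ j ≠ k) := by tauto
        simp only [hT, hd, hd1, hd2, false_and, if_false, add_zero]
    have : ∑ i, ∑ j, ∑ k, (T i j k + T j k i + T k i j) = 0 := by simp [hsum]
    simp only [Finset.sum_add_distrib] at this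
    rw [e2, e3, hneg, zero_add] at this
    exact this
  rw [htrip, add_zero]
  simp only [← Finset.sum_add_distrib]
  split_ifs with hxz
  · refine Finset.sum_congr rfl fun l _ => Finset.sum_congr rfl fun r _ => ?_
    by_cases hlr : l = r
    · simp [hF, hlr]
    · have hrl : r ≠ l := Ne.symm hlr
      simp [hF, hlr, hrl, hxz, Equiv.swap_comm r l, mul_assoc, add_mul]
  · refine Finset.sum_eq_zero fun l _ => Finset.sum_eq_zero fun r _ => ?_
    simp [hF, hxz, Equiv.swap_comm r l, mul_assoc]

end Square

/-! ### Rectangles on disjoint pairs of vertical circles -/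

section Commute

variable {N : ℕ} {A : Type*} [CommRing A]

theorem inCyc_disjoint_pairs {i j l r : Fin N} (hlr : l ≠ r) (hij : i ≠ j) (hil : i ≠ l) (hir : i ≠ r)
    (hjl : j ≠ l) (hjr : j ≠ r) :
    (if InCyc i j l then 1 else 0) - (if InCyc i j r then 1 else 0) =
      (if InCyc l r j then (1 : ℤ) else 0) - (if InCyc l r i then 1 else 0) := by
  simp only [Ne, Fin.ext_iff] at *
  simp only [inCyc_iff]
  split_ifs <;> omega

theorem interiorCount_eq_sum (x : GridState N) (i j : Fin N) :
    (interiorCount x (i, j) : ℤ) =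
      ∑ t, if t ≠ i ∧ InCyc i j t ∧ InCyc (x i) (x j) (x t) then 1 else 0 := by
  rw [interiorCount_eq, cyc, Finset.filter_filter, Finset.card_filter]
  push_cast
  refine Finset.sum_congr rfl fun t _ => if_congr ?_ rfl rfl
  tauto

theorem interiorCount_mul_swap (x : GridState N) {i j l r : Fin N} (hlr : l ≠ r)
    (hil : i ≠ l) (hir : i ≠ r) (hjl : j ≠ l) (hjr : j ≠ r) :
    (interiorCount (x * Equiv.swap l r) (i, j) : ℤ) = interiorCount x (i, j) -
      ((if InCyc i j l then 1 else 0) - (if InCyc i j r then 1 else 0)) *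
      ((if InCyc (x i) (x j) (x l) then 1 else 0) - (if InCyc (x i) (x j) (x r) then 1 else 0)) := by
  classical
  have key : ∀ g : Fin N → ℤ, ∑ t, g t = g l + g r + ∑ t, if t ≠ l ∧ t ≠ r then g t else 0 := by
    intro g
    rw [← Finset.sum_filter, ← Finset.sum_pair hlr, ← Finset.sum_add_sum_compl {l, r}]
    congr 2
    ext t
    simp
  rw [interiorCount_eq_sum, interiorCount_eq_sum, key,
    key fun t => if t ≠ i ∧ InCyc i j t ∧ InCyc (x i) (x j) (x t) then 1 else 0]
  have hi : (x * Equiv.swap l r) i = x i := by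
    rw [Equiv.Perm.mul_apply, Equiv.swap_apply_of_ne_of_ne hil hir]
  have hj : (x * Equiv.swap l r) j = x j := by
    rw [Equiv.Perm.mul_apply, Equiv.swap_apply_of_ne_of_ne hjl hjr]
  have hrest : ∀ t, (if t ≠ l ∧ t ≠ r then (if t ≠ i ∧ InCyc i j t ∧
      InCyc ((x * Equiv.swap l r) i) ((x * Equiv.swap l r) j) ((x * Equiv.swap l r) t) then (1 : ℤ)
        else 0) else 0) = if t ≠ l ∧ t ≠ r then (if t ≠ i ∧ InCyc i j t ∧
      InCyc (x i) (x j) (x t) then 1 else 0) else 0 := by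
    intro t
    split_ifs with h1 h2 h3 h3 <;> try rfl
    · rw [hi, hj, Equiv.Perm.mul_apply, Equiv.swap_apply_of_ne_of_ne h1.1 h1.2] at h2
      exact absurd h2 h3
    · rw [hi, hj, Equiv.Perm.mul_apply, Equiv.swap_apply_of_ne_of_ne h1.1 h1.2] at h2
      exact absurd h3 h2
  rw [Finset.sum_congr rfl fun t _ => hrest t, hi, hj]
  simp only [Equiv.Perm.mul_apply, Equiv.swap_apply_left, Equiv.swap_apply_right, hil.symm,
    hir.symm, ne_eq, not_false_eq_true, true_and, ite_and]
  split_ifs <;> ring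

theorem interiorCount_exchange (x : GridState N) {i j l r : Fin N} (hlr : l ≠ r) (hij : i ≠ j)
    (hil : i ≠ l) (hir : i ≠ r) (hjl : j ≠ l) (hjr : j ≠ r) :
    interiorCount (x * Equiv.swap l r) (i, j) + interiorCount x (l, r) =
      interiorCount (x * Equiv.swap i j) (l, r) + interiorCount x (i, j) := by
  have h1 := interiorCount_mul_swap x hlr hil hir hjl hjr
  have h2 := interiorCount_mul_swap x hij hil.symm hjl.symm hir.symm hjr.symm
  have h3 := inCyc_disjoint_pairs hlr hij hil hir hjl hjr
  have h4 := inCyc_disjoint_pairs (x.injective.ne hlr) (x.injective.ne hij) (x.injective.ne hil)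
    (x.injective.ne hir) (x.injective.ne hjl) (x.injective.ne hjr)
  zify
  rw [h1, h2, h3, h4]
  ring

theorem scal_exchange (u : Fin N → Fin N → A) (v : A) (x : GridState N) {i j l r : Fin N}
    (hlr : l ≠ r) (hij : i ≠ j) (hil : i ≠ l) (hir : i ≠ r) (hjl : j ≠ l) (hjr : j ≠ r) :
    scal u v (x * Equiv.swap l r) i j * scal u v x l r =
      scal u v (x * Equiv.swap i j) l r * scal u v x i j := by
  have h := congrArg (v ^ ·) (interiorCount_exchange x hlr hij hil hir hjl hjr)
  simp only [pow_add] at h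
  simp only [scal, Equiv.Perm.mul_apply, Equiv.swap_apply_of_ne_of_ne hil hir,
    Equiv.swap_apply_of_ne_of_ne hjl hjr, Equiv.swap_apply_of_ne_of_ne hil.symm hjl.symm,
    Equiv.swap_apply_of_ne_of_ne hir.symm hjr.symm]
  linear_combination (∏ t ∈ cyc i j, ∏ q ∈ cyc (x i) (x j), u t q) *
    (∏ t ∈ cyc l r, ∏ q ∈ cyc (x l) (x r), u t q) * h

end Commute

/-! ### Transfer elements along a special circle -/

section Turn

variable {N : ℕ} [NeZero N] {A M : Type*} [CommRing A] [Ring M] [Algebra A M]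

/-- The product `R (p + k - 1) ⋯ R (p + 1) R p` of transfer elements along an upward path. -/
def upPath (R : Fin N → M) : Fin N → ℕ → M
  | _, 0 => 1
  | p, k + 1 => upPath R (p + 1) k * R p

/-- The product `L p L (p + 1) ⋯ L (p + k - 1)` of transfer elements along a downward path. -/
def downPath (L : Fin N → M) : Fin N → ℕ → M
  | _, 0 => 1
  | p, k + 1 => L p * downPath L (p + 1) k

/-- The factor with which the special circle `μ` enters the weight of a rectangle with vertical edges on
`i`, `j` and horizontal edges on `p`, `q`: a path upwards along a left edge on `μ`, a path downwards
along a right edge on `μ`, and the scalars `s` if the rectangle crosses `μ`. A rectangle of width one at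
`μ` may in addition be tall, that is, go once more around the torus; the tall rectangles have the extra
weights `tR` and `tL`. -/
def turn (μ : Fin N) (R L : Fin N → M) (s : Fin N → A) (tR tL : A) (i j p q : Fin N) : M :=
  if i = μ then upPath R p (q - p).val +
    (if j = μ + 1 then tR • upPath R p ((q - p).val + N) else 0)
  else if j = μ then downPath L p (q - p).val +
    (if i + 1 = μ then tL • downPath L p ((q - p).val + N) else 0)
  else if InCyc i j μ then algebraMap A M (∏ t ∈ cyc p q, s t) else 1

/-- The weight of the rectangle from `x` with vertical edges on `i`, `j`, where the two columns at the
special circle `μ` are weighted by transfer elements. -/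
def turnWeight (u : Fin N → Fin N → A) (v : A) (μ : Fin N) (R L : Fin N → M) (s : Fin N → A)
    (tR tL : A) (x : GridState N) (i j : Fin N) : M :=
  scal u v x i j • turn μ R L s tR tL i j (x i) (x j)

end Turn

section Three

variable {A M : Type*} [CommRing A] [Ring M] [Algebra A M]

theorem interiorCount_three : ∀ (y : GridState 3) (i j k : Fin 3), i ≠ j → k ≠ i → k ≠ j →
    interiorCount y (i, j) = if InCyc i j k ∧ InCyc (y i) (y j) (y k) then 1 else 0 := by
  decide

/-- The weight of a rectangle in the `3 × 3` grid, where `k` is the third vertical circle and `r` the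
third horizontal one. -/
def threeWeight (U : Fin 3 → Fin 3 → A) (v : A) (R L : Fin 3 → M) (s : Fin 3 → A)
    (tR tL : A) (i j p q k r : Fin 3) : M :=
  ((∏ t ∈ cyc i j, ∏ h ∈ cyc p q, U t h) * v ^ (if InCyc i j k ∧ InCyc p q r then 1 else 0)) •
    turn 0 R L s tR tL i j p q

theorem tripleCount_three (U : Fin 3 → Fin 3 → A) (v : A) (R L : Fin 3 → M) (s : Fin 3 → A)
    (tR tL : A) (y : GridState 3) {i j k : Fin 3} (hij : i ≠ j) (hjk : j ≠ k) (hik : i ≠ k) :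
    tripleCount (turnWeight U v 0 R L s tR tL) y i j k =
    (threeWeight U v R L s tR tL j k (y i) (y k) i (y j) +
      threeWeight U v R L s tR tL k j (y k) (y i) i (y j)) *
    (threeWeight U v R L s tR tL i j (y i) (y j) k (y k) +
      threeWeight U v R L s tR tL j i (y j) (y i) k (y k)) := by
  have e1 : (y * Equiv.swap i j) i = y j := by simp
  have e2 : (y * Equiv.swap i j) j = y i := by simp
  have e3 : (y * Equiv.swap i j) k = y k := by
    rw [Equiv.Perm.mul_apply, Equiv.swap_apply_of_ne_of_ne hik.symm hjk.symm]
  simp only [tripleCount, turnWeight, scal, threeWeight]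
  rw [interiorCount_three y i j k hij hik.symm hjk.symm,
    interiorCount_three y j i k hij.symm hjk.symm hik.symm,
    interiorCount_three _ j k i hjk hij hik, interiorCount_three _ k j i hjk.symm hik hij,
    e1, e2, e3]

theorem cyc_three : cyc (0 : Fin 3) 1 = {0} ∧ cyc (0 : Fin 3) 2 = {0, 1} ∧ cyc (1 : Fin 3) 2 = {1} ∧
    cyc (1 : Fin 3) 0 = {1, 2} ∧ cyc (2 : Fin 3) 0 = {2} ∧ cyc (2 : Fin 3) 1 = {2, 0} := by
  decide

theorem inCyc_three : ¬ InCyc (0 : Fin 3) 1 2 ∧ InCyc (0 : Fin 3) 2 1 ∧ InCyc (1 : Fin 3) 0 2 ∧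
    ¬ InCyc (1 : Fin 3) 2 0 ∧ ¬ InCyc (2 : Fin 3) 0 1 ∧ InCyc (2 : Fin 3) 1 0 := by
  decide

/-- The cancellation behind `tripleCount` in the `3 × 3` grid, with the special circle at `0`.  The words
in `R` and `L` of length at least four are shortened by `hτ`, which exchanges the path once around
upwards for the path once around downwards; what remains are identities between scalars. -/
theorem threeWeight_cancel (U : Fin 3 → Fin 3 → A) (v : A) (R L : Fin 3 → M) (s : Fin 3 → A)
    (tR tL : A) (h2 : (2 : A) = 0) (hRL : ∀ b, R b * L b = algebraMap A M (s b))
    (hLR : ∀ b, L b * R b = algebraMap A M (s b)) (τ : A)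
    (hτ : ∀ b, upPath R b 3 + downPath L b 3 = algebraMap A M τ)
    (hτR : tR * τ = 0) (hτL : tL * τ = 0) (hsR : tR * (s 0 * s 1 * s 2) = 0)
    (hsL : tL * (s 0 * s 1 * s 2) = 0)
    (hR : (tR = v ∧ ∀ b, U 0 b = 1) ∨ (tR = 0 ∧ v * (U 0 0 * U 0 1 * U 0 2) = 0))
    (hL : (tL = v ∧ ∀ b, U 2 b = 1) ∨ (tL = 0 ∧ v * (U 2 0 * U 2 1 * U 2 2) = 0))
    (h1 : v * (U 1 0 * U 1 1 * U 1 2) = 0)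
    (hrow : ∀ b, v * (U 0 b * U 1 b * U 2 b * s b) = 0)
    (i j k p q r : Fin 3) (hi : i = 0 ∧ ((j = 1 ∧ k = 2) ∨ (j = 2 ∧ k = 1)))
    (hp : p = 0 ∧ ((q = 1 ∧ r = 2) ∨ (q = 2 ∧ r = 1))) :
    (threeWeight U v R L s tR tL j k p r i q + threeWeight U v R L s tR tL k j r p i q) *
      (threeWeight U v R L s tR tL i j p q k r + threeWeight U v R L s tR tL j i q p k r) +
    (threeWeight U v R L s tR tL k i q p j r + threeWeight U v R L s tR tL i k p q j r) *
      (threeWeight U v R L s tR tL j k q r i p + threeWeight U v R L s tR tL k j r q i p) +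
    (threeWeight U v R L s tR tL i j r q k p + threeWeight U v R L s tR tL j i q r k p) *
      (threeWeight U v R L s tR tL k i r p j q + threeWeight U v R L s tR tL i k p r j q) = 0 := by
  have a1 : (1 : Fin 3) + 1 = 2 := rfl
  have a2 : (2 : Fin 3) + 1 = 0 := rfl
  have a3 : (-2 : Fin 3) = 1 := rfl
  have a4 : (0 : Fin 3) + 1 = 1 := rfl
  have k1 : ∀ b m, R b * (L b * m) = s b • m := by
    intro b m
    rw [← mul_assoc, hRL, Algebra.smul_def]
  have k2 : ∀ b m, L b * (R b * m) = s b • m := by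
    intro b m
    rw [← mul_assoc, hLR, Algebra.smul_def]
  have t0 := hτ 0
  have t1 := hτ 1
  have t2 := hτ 2
  simp only [upPath, downPath, a1, a2, a4, mul_one, one_mul, Algebra.algebraMap_eq_smul_one] at t0 t1 t2
  have q0 : ∀ m, R 0 * (R 2 * (R 1 * (R 0 * m))) = τ • (R 0 * m) - s 0 • (L 1 * (L 2 * m)) := by
    intro m
    have := congrArg (fun t => R 0 * (t * m)) (eq_sub_of_add_eq t0)
    simpa only [mul_assoc, sub_mul, mul_sub, k1, smul_mul_assoc, mul_smul_comm, one_mul] using this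
  have q1 : ∀ m, R 1 * (R 0 * (R 2 * (R 1 * m))) = τ • (R 1 * m) - s 1 • (L 2 * (L 0 * m)) := by
    intro m
    have := congrArg (fun t => R 1 * (t * m)) (eq_sub_of_add_eq t1)
    simpa only [mul_assoc, sub_mul, mul_sub, k1, smul_mul_assoc, mul_smul_comm, one_mul] using this
  have q2 : ∀ m, L 2 * (L 0 * (L 1 * (L 2 * m))) = τ • (L 2 * m) - s 2 • (R 1 * (R 0 * m)) := by
    intro m
    have := congrArg (fun t => t * (L 2 * m)) (eq_sub_of_add_eq' t2)
    simpa only [mul_assoc, sub_mul, mul_sub, k1, smul_mul_assoc, mul_smul_comm, one_mul] using this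
  have q3 : ∀ m, L 1 * (L 2 * (L 0 * (L 1 * m))) = τ • (L 1 * m) - s 1 • (R 0 * (R 2 * m)) := by
    intro m
    have := congrArg (fun t => t * (L 1 * m)) (eq_sub_of_add_eq' t1)
    simpa only [mul_assoc, sub_mul, mul_sub, k1, smul_mul_assoc, mul_smul_comm, one_mul] using this
  have p0 := q0 1
  have p1 := q1 1
  have p2 := q2 1
  have p3 := q3 1
  simp only [mul_one] at p0 p1 p2 p3
  obtain ⟨c1, c2, c3, c4, c5, c6⟩ := cyc_three
  obtain ⟨b1, b2, b3, b4, b5, b6⟩ := inCyc_three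
  have r0 := hrow 0
  have r1 := hrow 1
  have r2 := hrow 2
  obtain ⟨rfl, ⟨rfl, rfl⟩ | ⟨rfl, rfl⟩⟩ := hi <;>
  obtain ⟨rfl, ⟨rfl, rfl⟩ | ⟨rfl, rfl⟩⟩ := hp <;>
  simp [threeWeight, turn, b1, b2, b3, b4, b5, b6, c1, c2, c3, c4, c5, c6, upPath, downPath, a1, a2,
    a3, add_mul, mul_add, smul_smul, mul_assoc, hRL, hLR, k1, k2, q2, p0, p1, p2, p3,
    Algebra.algebraMap_eq_smul_one, -smul_add, smul_add, mul_sub, sub_mul, smul_sub] <;>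
  match_scalars
  all_goals
    clear q0 q1 q2 q3 p0 p1 p2 p3 c1 c2 c3 c4 c5 c6 b1 b2 b3 b4 b5 b6 k1 k2 t0 t1 t2 a1 a2 a3 a4
      hRL hLR hτ hrow
    rcases hR with ⟨hR, hU⟩ | ⟨hR, hU⟩ <;> rcases hL with ⟨hL, hV⟩ | ⟨hL, hV⟩
    · simp only [hR, hL, hU, hV] at r0 r1 r2 hτR hτL hsR hsL ⊢; grind
    · simp only [hR, hL, hU] at r0 r1 r2 hV hτR hsR ⊢; grind
    · simp only [hR, hL, hV] at r0 r1 r2 hU hτL hsL ⊢; grind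
    · simp only [hR, hL] at r0 r1 r2 hU hV ⊢; grind

end Three

/-! ### Coarse grids -/

section Coarse

variable {N : ℕ} {A M : Type*} [CommRing A] [Ring M] [Algebra A M]

/-- Three distinct points span a cyclic map from `Fin 3` that starts at the first of them. -/
theorem exists_cycMap_three {p q r : Fin N} (hpq : p ≠ q) (hqr : q ≠ r) (hpr : p ≠ r) :
    ∃ (c : Fin 3 → Fin N) (a : Fin N → Fin 3) (j k : Fin 3), CycMap c a ∧
      ((j = 1 ∧ k = 2) ∨ (j = 2 ∧ k = 1)) ∧ c 0 = p ∧ c j = q ∧ c k = r := by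
  by_cases h : InCyc p r q
  · exact ⟨_, _, 1, 2, cycMap_three hpq hqr hpr h, Or.inl ⟨rfl, rfl⟩, rfl, rfl, rfl⟩
  · have h' : InCyc p q r := by
      rw [Ne, Fin.ext_iff] at hpq hqr hpr
      rw [inCyc_iff] at h ⊢
      omega
    exact ⟨_, _, 2, 1, cycMap_three hpr hqr.symm hpq h', Or.inr ⟨rfl, rfl⟩, rfl, rfl, rfl⟩

/-- The state of the coarse grid cut out by the circles `c` and `h`. -/
theorem exists_coarse_state {m : ℕ} {c h : Fin m → Fin N} {a : Fin N → Fin m} (hc : CycMap c a)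
    (x : GridState N) (hx : ∀ k, ∃ l, x (c k) = h l) :
    ∃ y : GridState m, ∀ k, x (c k) = h (y k) := by
  choose f hf using hx
  have hinj : Function.Injective f := fun k l e =>
    hc.injective (x.injective (by rw [hf, hf, e]))
  exact ⟨Equiv.ofBijective f (Finite.injective_iff_bijective.mp hinj), hf⟩

/-- Contributions of triples of vertical circles can be computed in a coarse grid. -/
theorem tripleCount_coarse {m : ℕ} {c h : Fin m → Fin N} {a : Fin N → Fin m} (hc : CycMap c a)
    (w : GridState N → Fin N → Fin N → M) (w' : GridState m → Fin m → Fin m → M)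
    (x : GridState N) (y : GridState m) (hxy : ∀ k, x (c k) = h (y k))
    (hw : ∀ (σ : GridState N) (τ : GridState m), (∀ k, σ (c k) = h (τ k)) →
      (σ = x ∨ ∃ k l, σ = x * Equiv.swap (c k) (c l)) →
      ∀ i j, i ≠ j → w σ (c i) (c j) = w' τ i j) {i j k : Fin m} (hij : i ≠ j) (hjk : j ≠ k) :
    tripleCount w x (c i) (c j) (c k) = tripleCount w' y i j k := by
  have hswap : ∀ l, (x * Equiv.swap (c i) (c j)) (c l) = h ((y * Equiv.swap i j) l) := by
    intro l
    rw [Equiv.Perm.mul_apply, Equiv.Perm.mul_apply, ← hxy, hc.injective.map_swap]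
  rw [tripleCount, tripleCount, hw _ _ hswap (Or.inr ⟨i, j, rfl⟩) _ _ hjk,
    hw _ _ hswap (Or.inr ⟨i, j, rfl⟩) _ _ hjk.symm, hw _ _ hxy (Or.inl rfl) _ _ hij,
    hw _ _ hxy (Or.inl rfl) _ _ hij.symm]

variable {m : ℕ} {c h : Fin m → Fin N} {a b : Fin N → Fin m}

theorem prod_boxWeight_col (u : Fin N → Fin N → A) (v : A) (x : GridState N) (i : Fin m) :
    (∏ t ∈ Finset.univ.filter (fun t => a t = i), ∏ q, u t q) ∣
      ∏ j, boxWeight c a b u v x i j := by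
  simp only [boxWeight, Finset.prod_mul_distrib]
  apply Dvd.dvd.mul_right
  have : ∏ j, ∏ t ∈ Finset.univ.filter (fun t => a t = i),
      ∏ q ∈ Finset.univ.filter (fun q => b q = j), u t q =
      ∏ t ∈ Finset.univ.filter (fun t => a t = i), ∏ j,
      ∏ q ∈ Finset.univ.filter (fun q => b q = j), u t q := Finset.prod_comm
  rw [this]
  refine dvd_of_eq (Finset.prod_congr rfl fun t _ => ?_)
  rw [Finset.prod_fiberwise]

theorem prod_dvd_boxWeight_col (u : Fin N → Fin N → A) (v : A) (x : GridState N) {i : Fin m}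
    {t : Fin N} (ht : a t = i) : (∏ q, u t q) ∣ ∏ j, boxWeight c a b u v x i j := by
  exact (Finset.dvd_prod_of_mem _ (Finset.mem_filter.mpr ⟨Finset.mem_univ t, ht⟩)).trans
    (prod_boxWeight_col u v x i)

theorem prod_dvd_boxWeight_row (u : Fin N → Fin N → A) (v : A) (x : GridState N) {j : Fin m}
    {q : Fin N} (hq : b q = j) : (∏ t, u t q) ∣ ∏ i, boxWeight c a b u v x i j := by
  simp only [boxWeight, Finset.prod_mul_distrib]
  apply Dvd.dvd.mul_right
  rw [Finset.prod_fiberwise (f := fun t => ∏ q ∈ Finset.univ.filter (fun q => b q = j), u t q)]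
  exact Finset.prod_dvd_prod_of_dvd _ _ fun t _ =>
    Finset.dvd_prod_of_mem _ (Finset.mem_filter.mpr ⟨Finset.mem_univ q, hq⟩)

theorem mul_eq_zero_of_dvd {v w z : A} (hw : v * w = 0) (h : w ∣ z) : v * z = 0 := by
  obtain ⟨k, rfl⟩ := h
  rw [← mul_assoc, hw, zero_mul]

theorem upPath_one [NeZero N] (p : Fin N) (k : ℕ) : upPath (fun _ => (1 : M)) p k = 1 := by
  induction k generalizing p with
  | zero => rfl
  | succ k ih => rw [upPath, ih, one_mul]

theorem downPath_one [NeZero N] (p : Fin N) (k : ℕ) : downPath (fun _ => (1 : M)) p k = 1 := by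
  induction k generalizing p with
  | zero => rfl
  | succ k ih => rw [downPath, ih, one_mul]

theorem turn_one [NeZero N] (μ i j p q : Fin N) :
    turn μ (fun _ => (1 : M)) (fun _ => (1 : M)) (fun _ => (1 : A)) 0 0 i j p q = 1 := by
  rw [turn]
  split_ifs <;> simp [upPath_one, downPath_one]

/-- Three vertical circles contribute nothing to the square of a scalar weighted count. -/
theorem scal_tripleCount (u : Fin N → Fin N → A) (v : A) (h2 : (2 : A) = 0)
    (x : GridState N) {p q r : Fin N} (hpq : p ≠ q) (hqr : q ≠ r) (hpr : p ≠ r)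
    (hcol : ∀ i j, i ∈ ({p, q, r} : Set (Fin N)) → j ∈ ({p, q, r} : Set (Fin N)) → i ≠ j →
      v * ∏ t ∈ cyc i j, ∏ h, u t h = 0)
    (hrow : ∀ h, v * ∏ t, u t h = 0) :
    tripleCount (scal u v) x p q r + tripleCount (scal u v) x q r p +
      tripleCount (scal u v) x r p q = 0 := by
  obtain ⟨c, a, j, k, hc, hjk, rfl, rfl, rfl⟩ := exists_cycMap_three hpq hqr hpr
  obtain ⟨h, b, j', k', hh, hjk', e0, e1, e2⟩ := exists_cycMap_three
    (x.injective.ne hpq) (x.injective.ne hqr) (x.injective.ne hpr)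
  obtain ⟨y, hy⟩ := exists_coarse_state hc x (by
    intro l
    have : l = 0 ∨ l = j ∨ l = k := by omega
    rcases this with rfl | rfl | rfl
    · exact ⟨0, e0.symm⟩
    · exact ⟨j', e1.symm⟩
    · exact ⟨k', e2.symm⟩)
  have hy0 : y 0 = 0 := hh.injective (by rw [← hy, e0])
  have hyj : y j = j' := hh.injective (by rw [← hy, e1])
  have hyk : y k = k' := hh.injective (by rw [← hy, e2])
  set U := boxWeight c a b u v x with hU
  have hw : ∀ (σ : GridState N) (τ : GridState 3), (∀ k, σ (c k) = h (τ k)) →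
      (σ = x ∨ ∃ k l, σ = x * Equiv.swap (c k) (c l)) → ∀ i j, i ≠ j → scal u v σ (c i) (c j) =
        turnWeight U v 0 (fun _ => (1 : A)) (fun _ => 1) (fun _ => (1 : A)) 0 0 τ i j := by
    intro σ τ hστ hσ i j _
    rw [scal_coarse hc hh u v σ τ hστ, turnWeight, turn_one, smul_eq_mul, mul_one]
    congr 1
    rcases hσ with rfl | ⟨k, l, rfl⟩
    · rfl
    · rw [hU, boxWeight_mul_swap]
  have n1 : (0 : Fin 3) ≠ j := by omega
  have n2 : j ≠ k := by omega
  have n3 : k ≠ 0 := by omega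
  rw [tripleCount_coarse hc _ _ x y hy hw n1 n2, tripleCount_coarse hc _ _ x y hy hw n2 n3,
    tripleCount_coarse hc _ _ x y hy hw n3 n1, tripleCount_three _ _ _ _ _ _ _ _ n1 n2 n3.symm,
    tripleCount_three _ _ _ _ _ _ _ _ n2 n3 n1.symm, tripleCount_three _ _ _ _ _ _ _ _ n3 n1 n2.symm,
    hy0, hyj, hyk]
  have hcolU : ∀ i : Fin 3, v * (U i 0 * U i 1 * U i 2) = 0 := by
    intro i
    have hne : ∀ l, c l ∈ ({c 0, c j, c k} : Set (Fin N)) := by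
      intro l
      have : l = 0 ∨ l = j ∨ l = k := by omega
      rcases this with rfl | rfl | rfl <;> simp
    have := hcol (c i) (c (i + 1)) (hne _) (hne _) (hc.injective.ne (by omega))
    rw [← Fin.prod_univ_three]
    refine mul_eq_zero_of_dvd this ?_
    rw [hc.prod_cyc]
    have hcyc : ∀ i : Fin 3, cyc i (i + 1) = {i} := by decide
    rw [hcyc, Finset.prod_singleton]
    exact prod_boxWeight_col u v x i
  refine threeWeight_cancel U v _ _ _ 0 0 h2 (fun _ => by simp) (fun _ => by simp) 0 ?_ (by simp) (by simp)
    (by simp) (by simp) (Or.inr ⟨rfl, hcolU 0⟩) (Or.inr ⟨rfl, hcolU 2⟩) (hcolU 1) ?_ 0 j k 0 j' k' ⟨rfl, hjk⟩ ⟨rfl, hjk'⟩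
  · intro i
    rw [upPath_one, downPath_one, map_zero, one_add_one_eq_two, h2]
  · intro i
    rw [mul_one, ← Fin.prod_univ_three (fun t => U t i)]
    exact mul_eq_zero_of_dvd (hrow (h i)) (prod_dvd_boxWeight_row u v x (hh.retr i))

end Coarse

/-! ### Annuli and the square of a scalar count -/

section Annuli

variable {N : ℕ} {A : Type*} [CommRing A]

theorem compl_cyc {p q : Fin N} (h : p ≠ q) : (cyc p q)ᶜ = cyc q p := by
  ext t
  simp [inCyc_compl h]

theorem left_mem_cyc {p q : Fin N} (h : p ≠ q) : p ∈ cyc p q := mem_cyc.mpr (inCyc_left h)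

theorem ne_add_one [NeZero N] (hN : N ≠ 1) (l : Fin N) : l ≠ l + 1 := by
  intro e
  have h0 : (1 : Fin N) = 0 := by
    have := congrArg (fun t => t - l) e
    simpa using this.symm
  have h0' := congrArg Fin.val h0
  rw [Fin.val_one', Fin.val_zero] at h0'
  exact hN (Nat.dvd_one.mp (Nat.dvd_of_mod_eq_zero h0'))

theorem ne_one_of_ne {l r : Fin N} (h : l ≠ r) : N ≠ 1 := by
  rintro rfl
  exact h (Subsingleton.elim _ _)

theorem cyc_succ [NeZero N] {l : Fin N} (h : l ≠ l + 1) : cyc l (l + 1) = {l} := by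
  ext t
  have h1 : (l + 1 - l : Fin N) = 1 := by abel
  have hN : 1 < N := by have := NeZero.pos N; have := ne_one_of_ne h; omega
  rw [mem_cyc, InCyc, h1, Finset.mem_singleton, Fin.lt_def, Fin.val_one', Nat.mod_eq_of_lt hN,
    Nat.lt_one_iff, Fin.val_eq_zero_iff, sub_eq_zero]

theorem succ_mem_cyc [NeZero N] {l r : Fin N} (h : l ≠ r) (hr : r ≠ l + 1) : l + 1 ∈ cyc l r := by
  have h1 : (l + 1 - l : Fin N) = 1 := by abel
  rw [mem_cyc, InCyc, h1]
  have h2 : (r - l) ≠ 1 := fun e => hr (by rw [← e]; abel)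
  have h3 : (r - l) ≠ 0 := sub_ne_zero.mpr h.symm
  have hN : 1 < N := by have := NeZero.pos N; have := ne_one_of_ne h; omega
  rw [Fin.lt_def, Fin.val_one', Nat.mod_eq_of_lt hN]
  rw [Ne, Fin.ext_iff, Fin.val_one', Nat.mod_eq_of_lt hN] at h2
  rw [Ne, ← Fin.val_eq_zero_iff] at h3
  omega

theorem interiorCount_add_col (x : GridState N) {l r : Fin N} (h : l ≠ r) :
    interiorCount (x * Equiv.swap l r) (l, r) + interiorCount x (l, r) = (cyc l r).card - 1 := by
  have e1 : (x * Equiv.swap l r) l = x r := by simp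
  have e2 : (x * Equiv.swap l r) r = x l := by simp
  have hx := x.injective.ne h
  rw [interiorCount_eq, interiorCount_eq, e1, e2, ← Finset.card_erase_of_mem (left_mem_cyc h),
    ← Finset.card_filter_add_card_filter_not (s := (cyc l r).erase l)
      (p := fun t => InCyc (x r) (x l) (x t))]
  refine congrArg₂ (· + ·) (congrArg Finset.card ?_) (congrArg Finset.card ?_)
  · ext t
    simp only [Finset.mem_filter, Finset.mem_erase, mem_cyc]
    by_cases htr : t = r
    · subst htr
      simp [not_inCyc_right]
    by_cases htl : t = l
    · simp [htl]
    rw [Equiv.Perm.mul_apply, Equiv.swap_apply_of_ne_of_ne htl htr]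
    tauto
  · ext t
    simp only [Finset.mem_filter, Finset.mem_erase, mem_cyc, inCyc_compl hx]
    tauto

/-- Two consecutive rectangles that fill a column annulus. -/
theorem scal_mul_scal_col (u : Fin N → Fin N → A) (v : A) (x : GridState N) {l r : Fin N}
    (h : l ≠ r) : scal u v (x * Equiv.swap l r) l r * scal u v x l r =
      (∏ t ∈ cyc l r, ∏ q, u t q) * v ^ ((cyc l r).card - 1) := by
  have e1 : (x * Equiv.swap l r) l = x r := by simp
  have e2 : (x * Equiv.swap l r) r = x l := by simp
  have hx := x.injective.ne h
  have hcard := interiorCount_add_col x h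
  rw [← hcard, pow_add, scal, scal, e1, e2]
  have hprod : (∏ t ∈ cyc l r, ∏ q, u t q) = (∏ t ∈ cyc l r, ∏ q ∈ cyc (x r) (x l), u t q) *
      ∏ t ∈ cyc l r, ∏ q ∈ cyc (x l) (x r), u t q := by
    rw [← Finset.prod_mul_distrib]
    refine Finset.prod_congr rfl fun t _ => ?_
    rw [← compl_cyc hx, mul_comm, Finset.prod_mul_prod_compl]
  rw [hprod]
  ring

theorem interiorCount_add_row (x : GridState N) {l r : Fin N} (h : l ≠ r) :
    interiorCount (x * Equiv.swap l r) (r, l) + interiorCount x (l, r) =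
      (cyc (x l) (x r)).card - 1 := by
  have e1 : (x * Equiv.swap l r) l = x r := by simp
  have e2 : (x * Equiv.swap l r) r = x l := by simp
  have hx := x.injective.ne h
  have hmap : ((cyc (x l) (x r)).erase (x l)).card =
      (Finset.univ.filter fun t => t ≠ l ∧ InCyc (x l) (x r) (x t)).card := by
    symm
    refine Finset.card_bij (fun t _ => x t) ?_ (fun _ _ _ _ e => x.injective e) ?_
    · intro t ht
      simpa [x.injective.eq_iff] using ht
    · intro q hq
      refine ⟨x.symm q, ?_, by simp⟩
      simp only [Finset.mem_erase, mem_cyc] at hq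
      simp only [Finset.mem_filter, Finset.mem_univ, true_and, Equiv.apply_symm_apply]
      exact ⟨fun e => hq.1 (by rw [← e]; simp), hq.2⟩
  rw [interiorCount_eq, interiorCount_eq, e1, e2, ← Finset.card_erase_of_mem (left_mem_cyc hx),
    hmap, ← Finset.card_filter_add_card_filter_not
      (s := Finset.univ.filter fun t => t ≠ l ∧ InCyc (x l) (x r) (x t)) (p := fun t => t ∈ cyc r l)]
  refine congrArg₂ (· + ·) (congrArg Finset.card ?_) (congrArg Finset.card ?_)
  · ext t
    simp only [Finset.mem_filter, Finset.mem_univ, true_and, mem_cyc]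
    by_cases htr : t = r
    · subst htr
      simp [not_inCyc_right]
    by_cases htl : t = l
    · simp [htl, not_inCyc_right]
    rw [Equiv.Perm.mul_apply, Equiv.swap_apply_of_ne_of_ne htl htr]
    tauto
  · ext t
    simp only [Finset.mem_filter, Finset.mem_univ, true_and, mem_cyc, inCyc_compl h, not_not]
    tauto

/-- Two consecutive rectangles that fill a row annulus. -/
theorem scal_mul_scal_row (u : Fin N → Fin N → A) (v : A) (x : GridState N) {l r : Fin N}
    (h : l ≠ r) : scal u v (x * Equiv.swap l r) r l * scal u v x l r =
      (∏ q ∈ cyc (x l) (x r), ∏ t, u t q) * v ^ ((cyc (x l) (x r)).card - 1) := by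
  have e1 : (x * Equiv.swap l r) l = x r := by simp
  have e2 : (x * Equiv.swap l r) r = x l := by simp
  have hx := x.injective.ne h
  have hcard := interiorCount_add_row x h
  rw [← hcard, pow_add, scal, scal, e1, e2]
  have hprod : (∏ q ∈ cyc (x l) (x r), ∏ t, u t q) =
      (∏ t ∈ cyc r l, ∏ q ∈ cyc (x l) (x r), u t q) *
      ∏ t ∈ cyc l r, ∏ q ∈ cyc (x l) (x r), u t q := by
    rw [Finset.prod_comm' (t' := Finset.univ) (s' := fun _ => cyc (x l) (x r)) (by simp),
      ← compl_cyc h, mul_comm, Finset.prod_mul_prod_compl]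
  rw [hprod]
  ring

theorem prod_mul_pow_eq_zero {ι : Type*} [DecidableEq ι] {s : Finset ι} {f : ι → A} {v : A} {i : ι}
    (hi : i ∈ s) (h : v * f i = 0) (hs : s.card ≠ 1) : (∏ j ∈ s, f j) * v ^ (s.card - 1) = 0 := by
  have h1 : 1 ≤ s.card - 1 := by
    have : 0 < s.card := Finset.card_pos.mpr ⟨i, hi⟩
    omega
  have h2 : v * f i ∣ (∏ j ∈ s, f j) * v ^ (s.card - 1) := by
    rw [mul_comm (∏ j ∈ s, f j)]
    exact mul_dvd_mul (dvd_pow_self v (Nat.one_le_iff_ne_zero.mp h1)) (Finset.dvd_prod_of_mem _ hi)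
  rw [h] at h2
  exact zero_dvd_iff.mp h2

theorem card_cyc_ne_one [NeZero N] {l r : Fin N} (h : l ≠ r) (hr : r ≠ l + 1) :
    (cyc l r).card ≠ 1 := by
  intro hc
  obtain ⟨t, ht⟩ := Finset.card_eq_one.mp hc
  have h1 := left_mem_cyc h
  have h2 := succ_mem_cyc h hr
  rw [ht, Finset.mem_singleton] at h1 h2
  rw [← h1] at h2
  exact ne_add_one (ne_one_of_ne h) l h2.symm

/-- A scalar weighted count of rectangles squares to the sum of the weights of the thin annuli, if `v`
kills the weights of all annuli. -/
theorem scal_sq [NeZero N] (hN : N ≠ 1) (u : Fin N → Fin N → A) (v : A) (h2 : (2 : A) = 0)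
    (hcol : ∀ t, v * ∏ q, u t q = 0) (hrow : ∀ q, v * ∏ t, u t q = 0) :
    rectMatrix (scal u v) * rectMatrix (scal u v) =
      ((∑ t, ∏ q, u t q) + ∑ q, ∏ t, u t q) • (1 : Matrix (GridState N) (GridState N) A) := by
  ext z x
  rw [rectMatrix_sq _ h2, Matrix.smul_apply, Matrix.one_apply, smul_eq_mul, mul_ite, mul_one, mul_zero]
  · refine if_congr eq_comm ?_ rfl
    have hc : ∀ l, (∑ r, if l ≠ r then scal u v (x * Equiv.swap l r) l r * scal u v x l r else 0) =
        ∏ q, u l q := by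
      intro l
      rw [Finset.sum_eq_single (l + 1)]
      · rw [if_pos (ne_add_one hN l), scal_mul_scal_col _ _ _ (ne_add_one hN l),
          cyc_succ (ne_add_one hN l)]
        simp
      · intro r _ hr
        split_ifs with hlr
        · rw [scal_mul_scal_col _ _ _ hlr]
          exact prod_mul_pow_eq_zero (left_mem_cyc hlr) (hcol l) (card_cyc_ne_one hlr hr)
        · rfl
      · simp
    have hr : ∀ l, (∑ r, if l ≠ r then scal u v (x * Equiv.swap l r) r l * scal u v x l r else 0) =
        ∏ t, u t (x l) := by
      intro l
      have hx : x (x.symm (x l + 1)) = x l + 1 := by simp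
      have hne : l ≠ x.symm (x l + 1) := fun e => ne_add_one hN (x l) (by rw [← hx, ← e])
      rw [Finset.sum_eq_single (x.symm (x l + 1))]
      · rw [if_pos hne, scal_mul_scal_row _ _ _ hne, hx, cyc_succ (ne_add_one hN _)]
        simp
      · intro r _ hr
        split_ifs with hlr
        · rw [scal_mul_scal_row _ _ _ hlr]
          exact prod_mul_pow_eq_zero (left_mem_cyc (x.injective.ne hlr)) (hrow (x l))
            (card_cyc_ne_one (x.injective.ne hlr) fun e => hr (by rw [← e]; simp))
        · rfl
      · simp
    rw [← Equiv.sum_comp x fun q => ∏ t, u t q, ← Finset.sum_add_distrib]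
    refine Finset.sum_congr rfl fun l _ => ?_
    rw [← hc l, ← hr l, ← Finset.sum_add_distrib]
    refine Finset.sum_congr rfl fun r _ => ?_
    split_ifs
    · rw [add_mul]
    · rw [add_zero]
  · intro x l r i j hlr hij hil hir hjl hjr
    exact scal_exchange u v x hlr hij hil hir hjl hjr
  · intro x p q r hpq hqr hpr
    exact scal_tripleCount u v h2 x hpq hqr hpr (fun i j _ _ hij =>
      mul_eq_zero_of_dvd (hcol i) (Finset.dvd_prod_of_mem _ (left_mem_cyc hij))) hrow

end Annuli

/-! ### Paths around the torus -/

section Paths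

variable {N : ℕ} [NeZero N] {A M : Type*} [CommRing A] [Ring M] [Algebra A M]

theorem add_one_add_ofNat (p : Fin N) (k : ℕ) :
    p + 1 + Fin.ofNat N k = p + Fin.ofNat N (k + 1) := by
  rw [add_assoc]
  congr 1
  ext
  simp [Fin.val_add, add_comm]

theorem add_ofNat_val_sub (p q : Fin N) : p + Fin.ofNat N (q - p).val = q := by
  rw [Fin.ofNat_val_eq_self]
  abel

theorem upPath_add (R : Fin N → M) (p : Fin N) (k l : ℕ) :
    upPath R p (k + l) = upPath R (p + Fin.ofNat N k) l * upPath R p k := by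
  induction k generalizing p with
  | zero => simp [upPath]
  | succ k ih => rw [Nat.succ_add, upPath, upPath, ih, add_one_add_ofNat, mul_assoc]

theorem downPath_add (L : Fin N → M) (p : Fin N) (k l : ℕ) :
    downPath L p (k + l) = downPath L p k * downPath L (p + Fin.ofNat N k) l := by
  induction k generalizing p with
  | zero => simp [downPath]
  | succ k ih => rw [Nat.succ_add, downPath, downPath, ih, add_one_add_ofNat, mul_assoc]

omit [NeZero N] in
theorem val_sub_add_val_sub {p q : Fin N} (h : p ≠ q) : (q - p).val + (p - q).val = N := by
  rw [Ne, Fin.ext_iff] at h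
  rw [Fin.sub_val_eq, Fin.sub_val_eq]
  split_ifs <;> omega

theorem cyc_eq_insert {p q : Fin N} (h : p ≠ q) :
    cyc p q = insert p (cyc (p + 1) q) ∧ p ∉ cyc (p + 1) q ∧
      (q - p).val = (q - (p + 1)).val + 1 := by
  have hN := ne_one_of_ne h
  have h0 := NeZero.pos N
  have h1 : (p + 1).val = if p.val + 1 = N then 0 else p.val + 1 := by
    rw [Fin.val_add, Fin.val_one', Nat.mod_eq_of_lt (show 1 < N by omega)]
    split_ifs with hp
    · rw [hp, Nat.mod_self]
    · rw [Nat.mod_eq_of_lt]; omega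
  rw [Ne, Fin.ext_iff] at h
  refine ⟨?_, ?_, ?_⟩
  · ext t
    rw [Finset.mem_insert, mem_cyc, mem_cyc, inCyc_iff, inCyc_iff, h1, Fin.ext_iff]
    split_ifs <;> omega
  · rw [mem_cyc, inCyc_iff, h1]
    split_ifs <;> omega
  · rw [Fin.sub_val_eq, Fin.sub_val_eq, h1]
    split_ifs <;> omega

theorem upPath_mul_downPath {R L : Fin N → M} {s : Fin N → A}
    (h : ∀ q, R q * L q = algebraMap A M (s q)) (p q : Fin N) :
    upPath R p (q - p).val * downPath L p (q - p).val = algebraMap A M (∏ t ∈ cyc p q, s t) := by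
  induction hk : (q - p).val generalizing p with
  | zero =>
    have : p = q := (sub_eq_zero.mp (Fin.val_eq_zero_iff.mp hk)).symm
    subst this
    simp [upPath, downPath, cyc, not_inCyc_self]
  | succ k ih =>
    have hpq : p ≠ q := by rintro rfl; simp at hk
    obtain ⟨h1, h2, h3⟩ := cyc_eq_insert hpq
    rw [h1, Finset.prod_insert h2, upPath, downPath, mul_assoc, ← mul_assoc (R p), h,
      Algebra.left_comm, ih (p + 1) (by omega), map_mul]

theorem downPath_mul_upPath {R L : Fin N → M} {s : Fin N → A}
    (h : ∀ q, L q * R q = algebraMap A M (s q)) (p q : Fin N) :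
    downPath L p (q - p).val * upPath R p (q - p).val = algebraMap A M (∏ t ∈ cyc p q, s t) := by
  induction hk : (q - p).val generalizing p with
  | zero =>
    have : p = q := (sub_eq_zero.mp (Fin.val_eq_zero_iff.mp hk)).symm
    subst this
    simp [upPath, downPath, cyc, not_inCyc_self]
  | succ k ih =>
    have hpq : p ≠ q := by rintro rfl; simp at hk
    obtain ⟨h1, h2, h3⟩ := cyc_eq_insert hpq
    rw [h1, Finset.prod_insert h2, upPath, downPath, mul_assoc, ← mul_assoc (downPath L (p + 1) k),
      ih (p + 1) (by omega), ← mul_assoc, ← Algebra.commutes, mul_assoc, h, map_mul]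
    exact Algebra.commutes _ _

theorem upPath_lap (R : Fin N → M) {p q : Fin N} (h : p ≠ q) :
    upPath R q (p - q).val * upPath R p (q - p).val = upPath R p N := by
  have := upPath_add R p (q - p).val (p - q).val
  rw [add_ofNat_val_sub, val_sub_add_val_sub h] at this
  exact this.symm

theorem downPath_lap (L : Fin N → M) {p q : Fin N} (h : p ≠ q) :
    downPath L p (q - p).val * downPath L q (p - q).val = downPath L p N := by
  have := downPath_add L p (q - p).val (p - q).val
  rw [add_ofNat_val_sub, val_sub_add_val_sub h] at this
  exact this.symm

theorem add_ofNat_self (p : Fin N) : p + Fin.ofNat N N = p := by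
  ext
  simp

theorem upPath_add_lap (R : Fin N → M) (p q : Fin N) :
    upPath R p ((q - p).val + N) = upPath R p (q - p).val * upPath R p N := by
  rw [add_comm, upPath_add, add_ofNat_self]

theorem downPath_add_lap (L : Fin N → M) (p q : Fin N) :
    downPath L p ((q - p).val + N) = downPath L p N * downPath L p (q - p).val := by
  rw [add_comm, downPath_add, add_ofNat_self]

/-- The lengths of the arcs of a cyclic map from `Fin 3`, added up from the arc `i` on. -/
def gapSum (h : Fin 3 → Fin N) : Fin 3 → ℕ → ℕ
  | _, 0 => 0
  | i, k + 1 => (h (i + 1) - h i).val + gapSum h (i + 1) k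

theorem upPath_gapSum (R : Fin N → M) (h : Fin 3 → Fin N) (i : Fin 3) (k : ℕ) :
    upPath R (h i) (gapSum h i k) = upPath (fun b => upPath R (h b) (h (b + 1) - h b).val) i k := by
  induction k generalizing i with
  | zero => rfl
  | succ k ih => rw [gapSum, upPath_add, add_ofNat_val_sub, ih]; rfl

theorem downPath_gapSum (L : Fin N → M) (h : Fin 3 → Fin N) (i : Fin 3) (k : ℕ) :
    downPath L (h i) (gapSum h i k) =
      downPath (fun b => downPath L (h b) (h (b + 1) - h b).val) i k := by
  induction k generalizing i with
  | zero => rfl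
  | succ k ih => rw [gapSum, downPath_add, add_ofNat_val_sub, ih]; rfl

theorem gapSum_eq {h : Fin 3 → Fin N} {b : Fin N → Fin 3} (hh : CycMap h b) (i j : Fin 3) :
    gapSum h i (j - i).val = (h j - h i).val ∧ gapSum h i ((j - i).val + 3) = (h j - h i).val + N := by
  have h1 : InCyc (h 0) (h 2) (h 1) := by
    rw [hh.inCyc, hh.retr]
    decide
  have n1 := hh.injective.ne (show (0 : Fin 3) ≠ 1 by decide)
  have n2 := hh.injective.ne (show (1 : Fin 3) ≠ 2 by decide)
  have n3 := hh.injective.ne (show (0 : Fin 3) ≠ 2 by decide)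
  rw [inCyc_iff] at h1
  rw [Ne, Fin.ext_iff] at n1 n2 n3
  have a0 : (0 : Fin 3) + 1 = 1 := rfl
  have a1 : (1 : Fin 3) + 1 = 2 := rfl
  have a2 : (2 : Fin 3) + 1 = 0 := rfl
  fin_cases i <;> fin_cases j <;>
    simp [gapSum, a0, a1, a2, show (-2 : Fin 3) = 1 from rfl, Fin.sub_val_eq] <;> split_ifs <;> omega

end Paths

/-! ### Three vertical circles, one of them special -/

section TurnSquare

variable {N : ℕ} [NeZero N] {A M : Type*} [CommRing A] [Ring M] [Algebra A M]

/-- The hypotheses under which the count of rectangles with transfer elements `R`, `L` along the special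
circle `μ` squares to a constant.  The columns on both sides of `μ` have scalar weight `1`: their
squares are accounted for by `R` (the column to the right) and `L` (the column to the left). -/
structure TurnData (μ : Fin N) (R L : Fin N → M) (s : Fin N → A) (u : Fin N → Fin N → A)
    (v τ : A) : Prop where
  two : (2 : A) = 0
  mul_down : ∀ q, R q * L q = algebraMap A M (s q)
  mul_up : ∀ q, L q * R q = algebraMap A M (s q)
  right : ∀ q, u μ q = 1
  left : ∀ t, t + 1 = μ → ∀ q, u t q = 1
  lap : ∀ p, upPath R p N + downPath L p N = algebraMap A M τ
  mul_trace : v * τ = 0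
  mul_det : v * ∏ q, s q = 0
  col : ∀ t, t ≠ μ → t + 1 ≠ μ → v * ∏ q, u t q = 0
  row : ∀ q, v * ((∏ t, u t q) * s q) = 0

variable {μ : Fin N} {R L : Fin N → M} {s : Fin N → A} {u : Fin N → Fin N → A} {v τ : A}

/-- Away from `μ`, the transfer elements enter only through the scalars `s`. -/
theorem turnWeight_eq_scal (x : GridState N) {i j : Fin N} (hi : i ≠ μ) (hj : j ≠ μ) (tR tL : A)
    (hμ : ∀ q, u μ q = 1) :
    turnWeight u v μ R L s tR tL x i j =
      algebraMap A M (scal (Function.update u μ s) v x i j) := by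
  rw [turnWeight, turn, if_neg hi, if_neg hj, Algebra.smul_def]
  have h : ∀ t ∈ cyc i j, t ≠ μ → ∏ q ∈ cyc (x i) (x j), Function.update u μ s t q =
      ∏ q ∈ cyc (x i) (x j), u t q := fun t _ ht => by rw [Function.update_of_ne ht]
  split_ifs with hc
  · rw [← map_mul]
    congr 1
    rw [scal, scal, ← Finset.mul_prod_erase (cyc i j) (fun t => ∏ q ∈ cyc (x i) (x j), u t q)
        (mem_cyc.mpr hc),
      ← Finset.mul_prod_erase (cyc i j)
        (fun t => ∏ q ∈ cyc (x i) (x j), Function.update u μ s t q) (mem_cyc.mpr hc),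
      Finset.prod_congr rfl fun t ht => h t (Finset.mem_of_mem_erase ht) (Finset.ne_of_mem_erase ht),
      Function.update_self, Finset.prod_congr rfl fun q _ => hμ q, Finset.prod_const_one]
    ring
  · rw [mul_one, scal, scal, Finset.prod_congr rfl fun t ht => h t ht fun e =>
      hc (by rw [← e]; exact mem_cyc.mp ht)]

omit [NeZero N] in
theorem boxWeight_eq_one {m : ℕ} {c : Fin m → Fin N} {a b : Fin N → Fin m} {i : Fin m}
    (hi : ∀ t, a t = i ↔ t = c i) (v : A) (x : GridState N) (j : Fin m) (hu : ∀ q, u (c i) q = 1) :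
    boxWeight c a b u v x i j = 1 := by
  have h1 : ∀ t, ((t ∉ Set.range c ∧ t = c i) ∧ b (x t) = j) ↔ False := by
    intro t
    simp only [iff_false]
    rintro ⟨⟨h, rfl⟩, -⟩
    exact h ⟨i, rfl⟩
  simp only [boxWeight, hi, h1]
  simp [hu, Finset.filter_eq']

namespace TurnData

/-- An annulus of columns that are bounded by circles other than `μ` contains a whole column away from
`μ`, or both columns at `μ`. -/
theorem col_update (D : TurnData μ R L s u v τ) {i j : Fin N} (hij : i ≠ j) (hi : i ≠ μ)
    (hj : j ≠ μ) : v * ∏ t ∈ cyc i j, ∏ q, Function.update u μ s t q = 0 := by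
  by_cases h : i + 1 = μ
  · have hm : μ ∈ cyc i j := by
      rw [← h]
      exact succ_mem_cyc hij fun e => hj (by rw [e, h])
    refine mul_eq_zero_of_dvd D.mul_det ?_
    refine dvd_trans ?_ (Finset.dvd_prod_of_mem _ hm)
    rw [Function.update_self]
  · refine mul_eq_zero_of_dvd (D.col i hi h) ?_
    refine dvd_trans ?_ (Finset.dvd_prod_of_mem _ (left_mem_cyc hij))
    rw [Function.update_of_ne hi]

theorem row_update (D : TurnData μ R L s u v τ) (q : Fin N) :
    ∏ t, Function.update u μ s t q = (∏ t, u t q) * s q := by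
  rw [← Finset.mul_prod_erase _ _ (Finset.mem_univ μ),
    ← Finset.mul_prod_erase _ (fun t => u t q) (Finset.mem_univ μ), Function.update_self, D.right,
    one_mul, mul_comm]
  congr 1
  exact Finset.prod_congr rfl fun t ht => by rw [Function.update_of_ne (Finset.ne_of_mem_erase ht)]

theorem tripleCount_of_ne (D : TurnData μ R L s u v τ) (x : GridState N) {p q r : Fin N}
    (hpq : p ≠ q) (hqr : q ≠ r) (hpr : p ≠ r) (hp : p ≠ μ) (hq : q ≠ μ) (hr : r ≠ μ) :
    tripleCount (turnWeight u v μ R L s v v) x p q r +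
      tripleCount (turnWeight u v μ R L s v v) x q r p +
      tripleCount (turnWeight u v μ R L s v v) x r p q = 0 := by
  have h := scal_tripleCount (Function.update u μ s) v D.two x hpq hqr hpr (fun i j hi hj hij => by
    refine D.col_update hij ?_ ?_
    · rcases hi with rfl | rfl | rfl <;> assumption
    · rcases hj with rfl | rfl | rfl <;> assumption) (fun q => by rw [D.row_update, D.row])
  have := congrArg (algebraMap A M) h
  simpa only [tripleCount, turnWeight_eq_scal _ hp hq _ _ D.right,
    turnWeight_eq_scal _ hq hp _ _ D.right, turnWeight_eq_scal _ hq hr _ _ D.right,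
    turnWeight_eq_scal _ hr hq _ _ D.right, turnWeight_eq_scal _ hp hr _ _ D.right,
    turnWeight_eq_scal _ hr hp _ _ D.right, map_add, map_mul, map_zero] using this

theorem tripleCount_special (D : TurnData μ R L s u v τ) (x : GridState N) {q r : Fin N}
    (hq : μ ≠ q) (hqr : q ≠ r) (hr : μ ≠ r) :
    tripleCount (turnWeight u v μ R L s v v) x μ q r +
      tripleCount (turnWeight u v μ R L s v v) x q r μ +
      tripleCount (turnWeight u v μ R L s v v) x r μ q = 0 := by
  obtain ⟨c, a, j, k, hc, hjk, rfl, rfl, rfl⟩ := exists_cycMap_three hq hqr hr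
  obtain ⟨h, b, j', k', hh, hjk', e0, e1, e2⟩ := exists_cycMap_three
    (x.injective.ne hq) (x.injective.ne hqr) (x.injective.ne hr)
  obtain ⟨y, hy⟩ := exists_coarse_state hc x (h := h) (by
    intro l
    have : l = 0 ∨ l = j ∨ l = k := by omega
    rcases this with rfl | rfl | rfl
    · exact ⟨0, e0.symm⟩
    · exact ⟨j', e1.symm⟩
    · exact ⟨k', e2.symm⟩)
  have hy0 : y 0 = 0 := hh.injective (by rw [← hy, e0])
  have hyj : y j = j' := hh.injective (by rw [← hy, e1])
  have hyk : y k = k' := hh.injective (by rw [← hy, e2])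
  -- All data of the `3 × 3` grid cut out by the three circles.  Tall rectangles survive only on arcs of
  -- width one, which are recorded by `tR` and `tL`.
  set U := boxWeight c a b u v x with hU
  set R' : Fin 3 → M := fun b => upPath R (h b) (h (b + 1) - h b).val with hR'
  set L' : Fin 3 → M := fun b => downPath L (h b) (h (b + 1) - h b).val with hL'
  set s' : Fin 3 → A := fun i => ∏ t ∈ Finset.univ.filter (fun t => b t = i), s t with hs'
  set tR : A := if c 1 = c 0 + 1 then v else 0 with htR
  set tL : A := if c 2 + 1 = c 0 then v else 0 with htL
  have hcyc : ∀ i : Fin 3, cyc i (i + 1) = {i} := by decide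
  have hs1 : ∀ i, ∏ t ∈ cyc (h i) (h (i + 1)), s t = s' i := by
    intro i
    rw [hh.prod_cyc, hcyc, Finset.prod_singleton]
  have hc1 : c 1 ≠ c 0 := fun e => absurd (hc.injective e) (by decide)
  have hc2 : c 2 ≠ c 0 := fun e => absurd (hc.injective e) (by decide)
  have n12 : c 1 ≠ c 2 := hc.injective.ne (by decide)
  have hin1 : InCyc (c 0) (c 2) (c 1) := by rw [hc.inCyc, hc.retr]; decide
  have hc2s : c 2 ≠ c 0 + 1 := by
    intro e
    rw [e] at hin1
    have : c 1 ∈ cyc (c 0) (c 0 + 1) := mem_cyc.mpr hin1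
    rw [cyc_succ (ne_add_one (ne_one_of_ne hq) (c 0)), Finset.mem_singleton] at this
    exact hc1 this
  have hc1s : c 1 + 1 ≠ c 0 := by
    intro e
    have hin2 : InCyc (c 1) (c 0) (c 2) := by rw [hc.inCyc, hc.retr]; decide
    have : c 2 ∈ cyc (c 1) (c 1 + 1) := mem_cyc.mpr (by rw [e]; exact hin2)
    rw [cyc_succ (ne_add_one (ne_one_of_ne hq) _), Finset.mem_singleton] at this
    exact n12 this.symm
  have hc0i : ∀ i, c i = c 0 ↔ i = 0 := fun i => hc.injective.eq_iff
  have hturn : ∀ i j p q, i ≠ j → turn (c 0) R L s v v (c i) (c j) (h p) (h q) =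
      turn 0 R' L' s' tR tL i j p q := by
    intro i j p q hij
    have hm : InCyc (c i) (c j) (c 0) ↔ InCyc i j 0 := by rw [hc.inCyc, hc.retr]
    rw [turn, turn, ← (gapSum_eq hh p q).2, ← (gapSum_eq hh p q).1, upPath_gapSum, downPath_gapSum,
      upPath_gapSum, downPath_gapSum, hh.prod_cyc]
    simp only [hc0i, hm]
    refine ite_congr rfl (fun hi => ?_) fun hi => ite_congr rfl (fun hj => ?_) fun _ => rfl
    · congr 1
      have : j = 1 ∨ j = 2 := by omega
      rcases this with rfl | rfl
      · by_cases hs : c 1 = c 0 + 1 <;> simp [htR, hs, hR']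
      · simp [hc2s]
    · congr 1
      have : i = 1 ∨ i = 2 := by omega
      rcases this with rfl | rfl
      · simp [hc1s]
      · by_cases hs : c 2 + 1 = c 0
        · simp [htL, hs, hL', show (2 : Fin 3) + 1 = 0 from rfl]
        · simp [htL, hs]
  have hw : ∀ (σ : GridState N) (τ : GridState 3), (∀ k, σ (c k) = h (τ k)) →
      (σ = x ∨ ∃ k l, σ = x * Equiv.swap (c k) (c l)) → ∀ i j, i ≠ j →
        turnWeight u v (c 0) R L s v v σ (c i) (c j) = turnWeight U v 0 R' L' s' tR tL τ i j := by
    intro σ τ hστ hσ i j hij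
    rw [turnWeight, turnWeight, scal_coarse hc hh u v σ τ hστ, hστ, hστ, hturn _ _ _ _ hij]
    congr 2
    rcases hσ with rfl | ⟨k, l, rfl⟩
    · rfl
    · rw [hU, boxWeight_mul_swap]
  have n1 : (0 : Fin 3) ≠ j := by omega
  have n2 : j ≠ k := by omega
  have n3 : k ≠ 0 := by omega
  have hcolU : ∀ i : Fin 3, ∀ t, a t = i → t ≠ c 0 → t + 1 ≠ c 0 → v * (U i 0 * U i 1 * U i 2) = 0 := by
    intro i t ht h1 h2
    rw [← Fin.prod_univ_three]
    exact mul_eq_zero_of_dvd (D.col t h1 h2) (prod_dvd_boxWeight_col u v x ht)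
  rw [tripleCount_coarse hc _ _ x y hy hw n1 n2, tripleCount_coarse hc _ _ x y hy hw n2 n3,
    tripleCount_coarse hc _ _ x y hy hw n3 n1, tripleCount_three _ _ _ _ _ _ _ _ n1 n2 n3.symm,
    tripleCount_three _ _ _ _ _ _ _ _ n2 n3 n1.symm, tripleCount_three _ _ _ _ _ _ _ _ n3 n1 n2.symm,
    hy0, hyj, hyk]
  have hs3 : s' 0 * s' 1 * s' 2 = ∏ q, s q := by
    rw [← Fin.prod_univ_three, hs', Finset.prod_fiberwise]
  have htRv : tR = v ∨ tR = 0 := by rw [htR]; split_ifs <;> simp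
  have htLv : tL = v ∨ tL = 0 := by rw [htL]; split_ifs <;> simp
  refine threeWeight_cancel U v R' L' s' tR tL D.two (fun i => ?_) (fun i => ?_) τ (fun i => ?_)
    ?_ ?_ ?_ ?_ ?_ ?_ ?_ (fun i => ?_) 0 j k 0 j' k' ⟨rfl, hjk⟩ ⟨rfl, hjk'⟩
  · rw [← hs1, ← upPath_mul_downPath D.mul_down]
  · rw [← hs1, ← downPath_mul_upPath D.mul_up]
  · have hg := (gapSum_eq hh i i).2
    rw [sub_self, sub_self, Fin.val_zero, Fin.val_zero, zero_add, zero_add] at hg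
    rw [hR', hL', ← upPath_gapSum, ← downPath_gapSum, hg, D.lap]
  · rcases htRv with h | h <;> simp [h, D.mul_trace]
  · rcases htLv with h | h <;> simp [h, D.mul_trace]
  · rcases htRv with h | h <;> simp [h, hs3, D.mul_det]
  · rcases htLv with h | h <;> simp [h, hs3, D.mul_det]
  · by_cases hs : c 1 = c 0 + 1
    · refine Or.inl ⟨if_pos hs, fun i => boxWeight_eq_one (fun t => ?_) v x i D.right⟩
      have : InCyc (c 0) (c 1) t ↔ a t = 0 := by
        rw [hc.inCyc]
        generalize a t = i
        revert i
        decide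
      rw [← this, ← mem_cyc, hs, cyc_succ (ne_add_one (ne_one_of_ne hq) _), Finset.mem_singleton]
    · refine Or.inr ⟨if_neg hs, hcolU 0 (c 0 + 1) ?_ (ne_add_one (ne_one_of_ne hq) _).symm fun e => ?_⟩
      · have := succ_mem_cyc hc1.symm hs
        rw [mem_cyc, hc.inCyc] at this
        revert this
        generalize a (c 0 + 1) = i
        revert i
        decide
      · have h1 := cyc_succ (ne_add_one (ne_one_of_ne hq) (c 0))
        rw [← compl_cyc (ne_add_one (ne_one_of_ne hq) (c 0)).symm] at h1
        nth_rw 2 [← e] at h1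
        rw [cyc_succ (ne_add_one (ne_one_of_ne hq) _)] at h1
        have h2 : c 1 ∈ ({c 0 + 1} : Finset (Fin N))ᶜ := by simpa using hs
        rw [h1, Finset.mem_singleton] at h2
        exact hc1 h2
  · by_cases hs : c 2 + 1 = c 0
    · refine Or.inl ⟨if_pos hs, fun i => boxWeight_eq_one (fun t => ?_) v x i (D.left _ hs)⟩
      have : InCyc (c 2) (c 0) t ↔ a t = 2 := by
        rw [hc.inCyc]
        generalize a t = i
        revert i
        decide
      rw [← this, ← mem_cyc, ← hs, cyc_succ (ne_add_one (ne_one_of_ne hq) _), Finset.mem_singleton]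
    · exact Or.inr ⟨if_neg hs, hcolU 2 (c 2) (hc.retr 2) hc2 hs⟩
  · exact hcolU 1 (c 1) (hc.retr 1) hc1 hc1s
  · have : U 0 i * U 1 i * U 2 i * s' i = (∏ t, U t i) * ∏ t ∈ cyc (h i) (h (i + 1)), s t := by
      rw [Fin.prod_univ_three, hs1]
    rw [this]
    refine mul_eq_zero_of_dvd (D.row (h i)) (mul_dvd_mul (prod_dvd_boxWeight_row u v x (hh.retr i))
      (Finset.dvd_prod_of_mem _ (left_mem_cyc (hh.injective.ne (by omega)))))

end TurnData

end TurnSquare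

/-! ### The square of a count with transfer elements -/

section TurnSquare

variable {N : ℕ} [NeZero N] {A M : Type*} [CommRing A] [Ring M] [Algebra A M]
variable {μ : Fin N} {R L : Fin N → M} {s : Fin N → A} {u : Fin N → Fin N → A} {v τ : A}

namespace TurnData

theorem tripleCount_eq_zero (D : TurnData μ R L s u v τ) (x : GridState N) {p q r : Fin N}
    (hpq : p ≠ q) (hqr : q ≠ r) (hpr : p ≠ r) :
    tripleCount (turnWeight u v μ R L s v v) x p q r +
      tripleCount (turnWeight u v μ R L s v v) x q r p +
      tripleCount (turnWeight u v μ R L s v v) x r p q = 0 := by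
  by_cases hp : p = μ
  · subst hp
    exact D.tripleCount_special x hpq hqr hpr
  by_cases hq : q = μ
  · subst hq
    rw [← D.tripleCount_special x hqr hpr.symm hpq.symm]
    abel
  by_cases hr : r = μ
  · subst hr
    rw [← D.tripleCount_special x hpr.symm hpq hqr.symm]
    abel
  exact D.tripleCount_of_ne x hpq hqr hpr hp hq hr

theorem turn_commute {l r i j p q p' q' : Fin N} (hij : i ≠ μ ∧ j ≠ μ) (tR tL : A) :
    turn μ R L s tR tL i j p q * turn μ R L s tR tL l r p' q' =
      turn μ R L s tR tL l r p' q' * turn μ R L s tR tL i j p q := by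
  rw [turn, if_neg hij.1, if_neg hij.2]
  split_ifs
  · exact Algebra.commutes _ _
  · rw [one_mul, mul_one]

theorem exchange (x : GridState N) {l r i j : Fin N} (hlr : l ≠ r) (hij : i ≠ j) (hil : i ≠ l)
    (hir : i ≠ r) (hjl : j ≠ l) (hjr : j ≠ r) :
    turnWeight u v μ R L s v v (x * Equiv.swap l r) i j * turnWeight u v μ R L s v v x l r =
      turnWeight u v μ R L s v v (x * Equiv.swap i j) l r * turnWeight u v μ R L s v v x i j := by
  have hs := scal_exchange u v x hlr hij hil hir hjl hjr
  simp only [turnWeight, smul_mul_smul_comm, hs, Equiv.Perm.mul_apply,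
    Equiv.swap_apply_of_ne_of_ne hil hir, Equiv.swap_apply_of_ne_of_ne hjl hjr,
    Equiv.swap_apply_of_ne_of_ne hil.symm hjl.symm, Equiv.swap_apply_of_ne_of_ne hir.symm hjr.symm]
  congr 1
  by_cases h : i ≠ μ ∧ j ≠ μ
  · exact turn_commute h v v
  · refine (turn_commute ⟨?_, ?_⟩ v v).symm
    · rintro rfl
      exact h ⟨hil, hjl⟩
    · rintro rfl
      exact h ⟨hir, hjr⟩

/-- By the trace identity `lap`, a double turn is a sum of a multiple of `τ` and a multiple of the
product of all `s`. -/
theorem mul_lap_sq (D : TurnData μ R L s u v τ) (hN : N ≠ 1) (p : Fin N) :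
    v • (upPath R p N * upPath R p N) = 0 ∧ v • (downPath L p N * downPath L p N) = 0 := by
  have hp := ne_add_one hN p
  have h1 : v • (upPath R p N * downPath L p N) = 0 := by
    rw [← upPath_lap R hp, ← downPath_lap L hp, mul_assoc, ← mul_assoc (upPath R p _),
      upPath_mul_downPath D.mul_down, ← mul_assoc, ← Algebra.commutes, mul_assoc,
      upPath_mul_downPath D.mul_down, ← map_mul, Algebra.algebraMap_eq_smul_one, smul_smul,
      ← compl_cyc hp.symm, Finset.prod_compl_mul_prod, D.mul_det, zero_smul]
  have h2 : v • (downPath L p N * upPath R p N) = 0 := by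
    rw [← upPath_lap R hp, ← downPath_lap L hp, mul_assoc, ← mul_assoc (downPath L (p + 1) _),
      downPath_mul_upPath D.mul_up, ← mul_assoc, ← Algebra.commutes, mul_assoc,
      downPath_mul_upPath D.mul_up, ← map_mul, Algebra.algebraMap_eq_smul_one, smul_smul,
      ← compl_cyc hp, Finset.prod_compl_mul_prod, D.mul_det, zero_smul]
  have e := D.lap p
  have e1 := eq_sub_of_add_eq e
  have e2 := eq_sub_of_add_eq' e
  constructor
  · nth_rw 2 [e1]
    rw [mul_sub, smul_sub, h1, sub_zero, ← Algebra.commutes, Algebra.algebraMap_eq_smul_one,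
      smul_mul_assoc, smul_smul, D.mul_trace, zero_smul]
  · nth_rw 2 [e2]
    rw [mul_sub, smul_sub, h2, sub_zero, ← Algebra.commutes, Algebra.algebraMap_eq_smul_one,
      smul_mul_assoc, smul_smul, D.mul_trace, zero_smul]

/-- Column annuli to the right of `μ`. -/
theorem col_right (D : TurnData μ R L s u v τ) (x : GridState N) {r : Fin N} (hr : μ ≠ r) :
    turnWeight u v μ R L s v v (x * Equiv.swap μ r) μ r * turnWeight u v μ R L s v v x μ r =
      if r = μ + 1 then upPath R (x μ) N else 0 := by
  have hN := ne_one_of_ne hr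
  have hx := x.injective.ne hr
  simp only [turnWeight, smul_mul_smul_comm, scal_mul_scal_col u v x hr]
  have e1 : (x * Equiv.swap μ r) μ = x r := by simp
  have e2 : (x * Equiv.swap μ r) r = x μ := by simp
  rw [e1, e2]
  split_ifs with h
  · rw [h, cyc_succ (ne_add_one hN μ), ← h]
    simp only [Finset.prod_singleton, Finset.card_singleton, D.right, Finset.prod_const_one, turn,
      if_true, if_pos h, upPath_add_lap, pow_zero, mul_one, Nat.sub_self, one_smul]
    -- The tall terms contribute double and triple turns, which `v` kills.
    have hlap := upPath_lap R hx
    have hlap' := upPath_lap R hx.symm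
    have hsq := (D.mul_lap_sq hN (x μ)).1
    have hsq' := (D.mul_lap_sq hN (x r)).1
    have h2 : ∀ m : M, v • m + v • m = 0 := fun m => by
      rw [← add_smul, ← two_mul, D.two, zero_mul, zero_smul]
    have t1 : upPath R (x r) (x μ - x r).val * (upPath R (x μ) (x r - x μ).val * upPath R (x μ) N)
        = upPath R (x μ) N * upPath R (x μ) N := by rw [← mul_assoc, hlap]
    have t2 : upPath R (x r) (x μ - x r).val * upPath R (x r) N * upPath R (x μ) (x r - x μ).val =
        upPath R (x μ) N * upPath R (x μ) N := by
      rw [← hlap', ← mul_assoc, hlap, mul_assoc, hlap]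
    have t3 : upPath R (x r) (x μ - x r).val * upPath R (x r) N *
        (upPath R (x μ) (x r - x μ).val * upPath R (x μ) N) =
        (upPath R (x μ) N * upPath R (x μ) N) * upPath R (x μ) N := by rw [← mul_assoc, t2]
    rw [add_mul, mul_add, mul_add, hlap, mul_smul_comm, smul_mul_assoc, smul_mul_smul_comm, t1, t2,
      t3, hsq, mul_smul, ← smul_mul_assoc v, hsq]
    simp
  · have hs : μ + 1 ≠ μ := (ne_add_one hN μ).symm
    have hs2 : μ + 1 + 1 ≠ μ := by
      intro e
      have h1 := cyc_succ (ne_add_one hN μ)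
      rw [← compl_cyc (ne_add_one hN μ).symm] at h1
      nth_rw 2 [← e] at h1
      rw [cyc_succ (ne_add_one hN _)] at h1
      have h2 : r ∈ ({μ + 1} : Finset (Fin N))ᶜ := by simpa using h
      rw [h1, Finset.mem_singleton] at h2
      exact hr h2.symm
    rw [prod_mul_pow_eq_zero (succ_mem_cyc hr h) (D.col _ hs hs2) (card_cyc_ne_one hr h), zero_smul]

/-- Column annuli to the left of `μ`. -/
theorem col_left (D : TurnData μ R L s u v τ) (x : GridState N) {l : Fin N} (hl : l ≠ μ) :
    turnWeight u v μ R L s v v (x * Equiv.swap l μ) l μ * turnWeight u v μ R L s v v x l μ =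
      if l + 1 = μ then downPath L (x μ) N else 0 := by
  have hN := ne_one_of_ne hl
  have hx := x.injective.ne hl
  simp only [turnWeight, smul_mul_smul_comm, scal_mul_scal_col u v x hl]
  have e1 : (x * Equiv.swap l μ) l = x μ := by simp
  have e2 : (x * Equiv.swap l μ) μ = x l := by simp
  rw [e1, e2]
  split_ifs with h
  · have hc : cyc l μ = {l} := by rw [← h, cyc_succ (ne_add_one hN l)]
    rw [hc]
    simp only [Finset.prod_singleton, Finset.card_singleton, D.left l h, Finset.prod_const_one, turn,
      if_true, if_pos h, if_neg hl, downPath_add_lap, pow_zero, mul_one, Nat.sub_self, one_smul]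
    have hlap := downPath_lap L hx
    have hlap' := downPath_lap L hx.symm
    have hsq := (D.mul_lap_sq hN (x μ)).2
    have t1 : downPath L (x μ) (x l - x μ).val * (downPath L (x l) N * downPath L (x l) (x μ - x l).val)
        = downPath L (x μ) N * downPath L (x μ) N := by
      rw [← hlap, mul_assoc, hlap', ← mul_assoc, hlap', ]
    have t2 : downPath L (x μ) N * downPath L (x μ) (x l - x μ).val * downPath L (x l) (x μ - x l).val =
        downPath L (x μ) N * downPath L (x μ) N := by
      rw [mul_assoc, hlap']
    have t3 : downPath L (x μ) N * downPath L (x μ) (x l - x μ).val *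
        (downPath L (x l) N * downPath L (x l) (x μ - x l).val) =
        (downPath L (x μ) N * downPath L (x μ) N) * downPath L (x μ) N := by
      rw [mul_assoc, t1, mul_assoc]
    rw [add_mul, mul_add, mul_add, hlap', mul_smul_comm, smul_mul_assoc, smul_mul_smul_comm, t1, t2,
      t3, hsq, mul_smul, ← smul_mul_assoc v, hsq]
    simp
  · rw [prod_mul_pow_eq_zero (left_mem_cyc hl) (D.col _ hl h) (card_cyc_ne_one hl fun e => h e.symm),
      zero_smul]

/-- Column annuli away from `μ`. -/
theorem col_of_ne (D : TurnData μ R L s u v τ) (x : GridState N) {l r : Fin N} (hlr : l ≠ r)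
    (hl : l ≠ μ) (hr : r ≠ μ) :
    turnWeight u v μ R L s v v (x * Equiv.swap l r) l r * turnWeight u v μ R L s v v x l r =
      if r = l + 1 then algebraMap A M (∏ q, u l q) else 0 := by
  have hN := ne_one_of_ne hlr
  rw [turnWeight_eq_scal _ hl hr _ _ D.right, turnWeight_eq_scal _ hl hr _ _ D.right, ← map_mul,
    scal_mul_scal_col _ _ _ hlr]
  split_ifs with h
  · rw [h, cyc_succ (ne_add_one hN l)]
    simp [Function.update_of_ne hl]
  · have h1 : 1 ≤ (cyc l r).card - 1 := by
      have : 0 < (cyc l r).card := Finset.card_pos.mpr ⟨l, left_mem_cyc hlr⟩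
      have := card_cyc_ne_one hlr h
      omega
    obtain ⟨k, hk⟩ := Nat.exists_eq_add_of_le h1
    rw [hk, pow_add, pow_one, ← mul_assoc, mul_comm _ v, D.col_update hlr hl hr, zero_mul, map_zero]

/-- Row annuli. -/
theorem row_annulus (D : TurnData μ R L s u v τ) (x : GridState N) {l r : Fin N} (hlr : l ≠ r) :
    turnWeight u v μ R L s v v (x * Equiv.swap l r) r l * turnWeight u v μ R L s v v x l r =
      if x r = x l + 1 then algebraMap A M ((∏ t, u t (x l)) * s (x l)) else 0 := by
  have hN := ne_one_of_ne hlr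
  have hx := x.injective.ne hlr
  simp only [turnWeight, smul_mul_smul_comm, scal_mul_scal_row u v x hlr]
  have e1 : (x * Equiv.swap l r) l = x r := by simp
  have e2 : (x * Equiv.swap l r) r = x l := by simp
  rw [e1, e2]
  -- The tall terms give multiples of `v`, which are killed by the weight of the row.
  obtain ⟨m, hm⟩ : ∃ m : M, turn μ R L s v v r l (x l) (x r) * turn μ R L s v v l r (x l) (x r) =
      algebraMap A M (∏ q ∈ cyc (x l) (x r), s q) * (1 + v • m) := by
    have hup := upPath_mul_downPath D.mul_down (x l) (x r)
    have hdown := downPath_mul_upPath D.mul_up (x l) (x r)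
    have hite : ∀ (P : Prop) [Decidable P] (m : M),
        (if P then v • m else 0) = v • ((if P then (1 : A) else 0) • m) := by
      intro P _ m
      split_ifs <;> simp
    have hcent : ∀ (a : A) (m m' : M), m * (algebraMap A M a * m') = algebraMap A M a * (m * m') :=
      fun a m m' => by rw [← mul_assoc, ← Algebra.commutes, mul_assoc]
    by_cases hl : l = μ
    · subst hl
      simp only [turn, if_true, if_neg hlr.symm, upPath_add_lap, downPath_add_lap, hite]
      generalize (if r = l + 1 then (1 : A) else 0) = α
      generalize (if r + 1 = l then (1 : A) else 0) = β
      refine ⟨α • upPath R (x l) N + β • downPath L (x l) N +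
        (v * α * β) • (downPath L (x l) N * upPath R (x l) N), ?_⟩
      rw [← hdown]
      have e1 := hcent (∏ q ∈ cyc (x l) (x r), s q) (downPath L (x l) N) 1
      have e2 := hcent (∏ q ∈ cyc (x l) (x r), s q) (downPath L (x l) N) (upPath R (x l) N)
      rw [← hdown] at e1 e2
      simp only [mul_assoc, mul_one] at e1 e2
      simp only [mul_add, add_mul, smul_mul_assoc, mul_smul_comm, smul_smul, smul_add, mul_assoc,
        e1, e2, mul_one]
      module
    by_cases hr : r = μ
    · subst hr
      simp only [turn, if_true, if_neg hlr, upPath_add_lap, downPath_add_lap, hite]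
      generalize (if l = r + 1 then (1 : A) else 0) = α
      generalize (if l + 1 = r then (1 : A) else 0) = β
      refine ⟨α • upPath R (x r) N + β • downPath L (x r) N +
        (v * α * β) • (upPath R (x r) N * downPath L (x r) N), ?_⟩
      rw [← hup]
      have e1 : upPath R (x l) (x r - x l).val * upPath R (x l) N =
          upPath R (x r) N * upPath R (x l) (x r - x l).val := by
        rw [← upPath_lap R hx, ← upPath_lap R hx.symm, mul_assoc]
      have e2 : downPath L (x l) N * downPath L (x l) (x r - x l).val =
          downPath L (x l) (x r - x l).val * downPath L (x r) N := by
        rw [← downPath_lap L hx, ← downPath_lap L hx.symm, mul_assoc]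
      have e3 := hcent (∏ q ∈ cyc (x l) (x r), s q) (upPath R (x r) N) 1
      have e4 := hcent (∏ q ∈ cyc (x l) (x r), s q) (upPath R (x r) N) (downPath L (x r) N)
      rw [← hup] at e3 e4
      simp only [mul_assoc, mul_one] at e3 e4
      rw [e1, e2]
      simp only [mul_add, add_mul, smul_mul_assoc, mul_smul_comm, smul_smul, smul_add, mul_assoc,
        e3, e4, mul_one]
      module
    · refine ⟨0, ?_⟩
      rw [turn, turn, if_neg hl, if_neg hr, if_neg hl, if_neg hr]
      have hc := inCyc_compl hlr μ
      by_cases hm : InCyc l r μ <;> simp [hm, hc]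
  rw [hm, Algebra.algebraMap_eq_smul_one, smul_mul_assoc, smul_smul, one_mul, mul_right_comm,
    ← Finset.prod_mul_distrib]
  split_ifs with h
  · rw [h, cyc_succ (ne_add_one hN _)]
    simp only [Finset.prod_singleton, Finset.card_singleton, Nat.sub_self, pow_zero, mul_one]
    rw [smul_add, smul_smul, mul_comm _ v, D.row, zero_smul, add_zero, Algebra.algebraMap_eq_smul_one]
  · rw [prod_mul_pow_eq_zero (left_mem_cyc hx) (D.row (x l)) (card_cyc_ne_one hx h), zero_smul]

/-- The count of rectangles with transfer elements along a special circle squares to a constant. -/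
theorem rectMatrix_sq_eq (D : TurnData μ R L s u v τ) (hN : N ≠ 1) :
    rectMatrix (turnWeight u v μ R L s v v) * rectMatrix (turnWeight u v μ R L s v v) =
      algebraMap A M ((∑ t ∈ Finset.univ.filter (fun t => t ≠ μ ∧ t + 1 ≠ μ), ∏ q, u t q) +
        (∑ q, (∏ t, u t q) * s q) + τ) • (1 : Matrix (GridState N) (GridState N) M) := by
  ext z x
  have h2 : (2 : M) = 0 := by
    have := congrArg (algebraMap A M) D.two
    simpa only [map_ofNat, map_zero] using this
  rw [rectMatrix_sq _ h2 (fun x l r i j hlr hij hil hir hjl hjr => exchange x hlr hij hil hir hjl hjr)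
    (fun x p q r hpq hqr hpr => D.tripleCount_eq_zero x hpq hqr hpr), Matrix.smul_apply,
    Matrix.one_apply, smul_eq_mul, mul_ite, mul_one, mul_zero]
  refine if_congr eq_comm ?_ rfl
  have hc : ∀ l, (∑ r, if l ≠ r then turnWeight u v μ R L s v v (x * Equiv.swap l r) l r *
      turnWeight u v μ R L s v v x l r else 0) =
      (if l ≠ μ ∧ l + 1 ≠ μ then algebraMap A M (∏ q, u l q) else 0) +
      ((if l = μ then upPath R (x μ) N else 0) + if l + 1 = μ then downPath L (x μ) N else 0) := by
    intro l
    have hl1 := ne_add_one hN l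
    rw [Finset.sum_eq_single (l + 1)]
    · rw [if_pos hl1]
      by_cases hl : l = μ
      · subst hl
        rw [D.col_right x hl1]
        simp [hl1.symm]
      by_cases hr : l + 1 = μ
      · subst hr
        rw [D.col_left x hl1]
        simp [hl1]
      rw [D.col_of_ne x hl1 hl hr]
      simp [hl, hr]
    · intro r _ hr
      split_ifs with hlr
      · by_cases hl : l = μ
        · subst hl
          rw [D.col_right x hlr, if_neg hr]
        by_cases hr' : r = μ
        · subst hr'
          rw [D.col_left x hlr, if_neg (Ne.symm hr)]
        rw [D.col_of_ne x hlr hl hr', if_neg hr]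
      · rfl
    · simp
  have hr : ∀ l, (∑ r, if l ≠ r then turnWeight u v μ R L s v v (x * Equiv.swap l r) r l *
      turnWeight u v μ R L s v v x l r else 0) = algebraMap A M ((∏ t, u t (x l)) * s (x l)) := by
    intro l
    have hx : x (x.symm (x l + 1)) = x l + 1 := by simp
    have hne : l ≠ x.symm (x l + 1) := fun e => ne_add_one hN (x l) (by rw [← hx, ← e])
    rw [Finset.sum_eq_single (x.symm (x l + 1))]
    · rw [if_pos hne, D.row_annulus x hne, if_pos hx]
    · intro r _ hr
      split_ifs with hlr
      · rw [D.row_annulus x hlr, if_neg fun e => hr (by rw [← e]; simp)]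
      · rfl
    · simp
  have hsum : ∑ l, ((if l = μ then upPath R (x μ) N else 0) +
      if l + 1 = μ then downPath L (x μ) N else 0) = algebraMap A M τ := by
    rw [Finset.sum_add_distrib, Finset.sum_ite_eq' Finset.univ]
    simp only [← eq_sub_iff_add_eq, Finset.sum_ite_eq', Finset.mem_univ, if_true, D.lap]
  rw [map_add, map_add, map_sum, map_sum, ← hsum, Finset.sum_filter, add_right_comm,
    ← Finset.sum_add_distrib, ← Equiv.sum_comp x fun q => algebraMap A M ((∏ t, u t q) * s q),
    ← Finset.sum_add_distrib]
  refine Finset.sum_congr rfl fun l _ => ?_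
  rw [← hc l, ← hr l, ← Finset.sum_add_distrib]
  refine Finset.sum_congr rfl fun r _ => ?_
  split_ifs
  · rw [add_mul]
  · rw [add_zero]

end TurnData

end TurnSquare

/-! ### Maslov gradings along rectangles -/

section Grading

variable {n : ℕ}

theorem neCount_image (f g : Fin n → ℤ × ℤ) (hf : Function.Injective f) (hg : Function.Injective g) :
    neCount (Finset.univ.image f) (Finset.univ.image g) =
      ∑ i, ∑ j, if (f i).1 < (g j).1 ∧ (f i).2 < (g j).2 then 1 else 0 := by
  rw [neCount, Finset.card_filter, Finset.sum_product, Finset.sum_image fun _ _ _ _ h => hf h]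
  push_cast
  refine Finset.sum_congr rfl fun i _ => ?_
  rw [Finset.sum_image fun _ _ _ _ h => hg h]

theorem maslovWrt_eq (σ : Equiv.Perm (Fin n)) (x : GridState n) :
    maslovWrt σ x = (∑ i, ∑ j, if i < j ∧ x i < x j then 1 else 0)
      - (∑ i, ∑ j, ((if i ≤ j ∧ x i ≤ σ j then 1 else 0) + if j < i ∧ σ j < x i then 1 else 0))
      + (∑ i, ∑ j, if i < j ∧ σ i < σ j then 1 else 0) + 1 := by
  have h1 : ∀ y : Equiv.Perm (Fin n), Function.Injective fun c : Fin n =>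
      ((2 * (c.val : ℤ), 2 * ((y c).val : ℤ)) : ℤ × ℤ) := by
    intro y i j h
    simp only [Prod.mk.injEq] at h
    ext
    omega
  have h2 : ∀ y : Equiv.Perm (Fin n), Function.Injective fun c : Fin n =>
      ((2 * (c.val : ℤ) + 1, 2 * ((y c).val : ℤ) + 1) : ℤ × ℤ) := by
    intro y i j h
    simp only [Prod.mk.injEq] at h
    ext
    omega
  rw [maslovWrt, statePoints, markPoints, neCount_image _ _ (h1 x) (h1 x),
    neCount_image _ _ (h1 x) (h2 σ), neCount_image _ _ (h2 σ) (h1 x),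
    neCount_image _ _ (h2 σ) (h2 σ)]
  simp only [Finset.sum_add_distrib]
  rw [Finset.sum_comm (f := fun i j => if j < i ∧ σ j < x i then (1 : ℤ) else 0)]
  have k1 : ∀ i j : Fin n, 2 * (i.val : ℤ) < 2 * (j.val : ℤ) ↔ i < j := fun i j => by
    rw [Fin.lt_def]; omega
  have k2 : ∀ i j : Fin n, 2 * (i.val : ℤ) < 2 * (j.val : ℤ) + 1 ↔ i ≤ j := fun i j => by
    rw [Fin.le_def]; omega
  have k3 : ∀ i j : Fin n, 2 * (i.val : ℤ) + 1 < 2 * (j.val : ℤ) ↔ i < j := fun i j => by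
    rw [Fin.lt_def]; omega
  have k4 : ∀ i j : Fin n, 2 * (i.val : ℤ) + 1 < 2 * (j.val : ℤ) + 1 ↔ i < j := fun i j => by
    rw [Fin.lt_def]; omega
  simp only [k1, k2, k3, k4]

/-- The number of the markings `(c, σ c)` in a rectangle starting at `x`. -/
def markCount (σ : Equiv.Perm (Fin n)) (x : GridState n) (l r : Fin n) : ℕ :=
  (Finset.univ.filter fun t => InCyc l r t ∧ InCyc (x l) (x r) (σ t)).card

theorem markCount_eq_sum (σ : Equiv.Perm (Fin n)) (x : GridState n) (l r : Fin n) :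
    (markCount σ x l r : ℤ) =
      ∑ t, if InCyc l r t ∧ InCyc (x l) (x r) (σ t) then 1 else 0 := by
  rw [markCount, Finset.card_filter]
  push_cast
  rfl

/-- The change of the Maslov grading along a rectangle that lies in the fundamental domain, by counting
pairs of points. -/
theorem maslovWrt_planar (σ : Equiv.Perm (Fin n)) (x : GridState n) {l r : Fin n} (hlr : l < r)
    (hx : x l < x r) : maslovWrt σ x - maslovWrt σ (x * Equiv.swap l r) =
      1 + 2 * interiorCount x (l, r) - 2 * markCount σ x l r := by
  have hne : l ≠ r := ne_of_lt hlr
  set y : GridState n := x * Equiv.swap l r with hy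
  have yl : y l = x r := by simp [hy]
  have yr : y r = x l := by simp [hy]
  have yt : ∀ t, t ≠ l → t ≠ r → y t = x t := fun t h1 h2 => by
    rw [hy, Equiv.Perm.mul_apply, Equiv.swap_apply_of_ne_of_ne h1 h2]
  have hNE : (∑ i, ∑ j, if i < j ∧ x i < x j then (1 : ℤ) else 0) -
      (∑ i, ∑ j, if i < j ∧ y i < y j then 1 else 0) = 1 + 2 * interiorCount x (l, r) := by
    rw [sum_pair_split _ (by simp) hne, sum_pair_split (fun i j => if i < j ∧ y i < y j then (1 : ℤ)
      else 0) (by simp) hne, interiorCount_eq_sum]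
    have hrest : (∑ i, ∑ j, if (i ≠ l ∧ i ≠ r) ∧ (j ≠ l ∧ j ≠ r) then
        (if i < j ∧ x i < x j then (1 : ℤ) else 0) else 0) =
        ∑ i, ∑ j, if (i ≠ l ∧ i ≠ r) ∧ (j ≠ l ∧ j ≠ r) then
        (if i < j ∧ y i < y j then (1 : ℤ) else 0) else 0 := by
      refine Finset.sum_congr rfl fun i _ => Finset.sum_congr rfl fun j _ => ?_
      by_cases h : (i ≠ l ∧ i ≠ r) ∧ (j ≠ l ∧ j ≠ r)
      · rw [if_pos h, if_pos h, yt i h.1.1 h.1.2, yt j h.2.1 h.2.2]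
      · rw [if_neg h, if_neg h]
    rw [hrest, yl, yr, if_pos ⟨hlr, hx⟩, if_neg (fun h => absurd h.1 (lt_asymm hlr)),
      if_neg (fun h => absurd h.2 (lt_asymm hx)), if_neg (fun h => absurd h.1 (lt_asymm hlr))]
    have hsum : ∀ t : Fin n, (if t ≠ l ∧ t ≠ r then (if l < t ∧ x l < x t then (1 : ℤ) else 0) +
        (if t < l ∧ x t < x l then 1 else 0) + ((if r < t ∧ x r < x t then 1 else 0) +
        if t < r ∧ x t < x r then 1 else 0) else 0) =
        (if t ≠ l ∧ t ≠ r then (if l < t ∧ x r < y t then (1 : ℤ) else 0) +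
        (if t < l ∧ y t < x r then 1 else 0) + ((if r < t ∧ x l < y t then 1 else 0) +
        if t < r ∧ y t < x l then 1 else 0) else 0) +
        2 * if t ≠ l ∧ InCyc l r t ∧ InCyc (x l) (x r) (x t) then 1 else 0 := by
      intro t
      by_cases htl : t = l
      · simp [htl]
      by_cases htr : t = r
      · simp [htr, not_inCyc_right]
      rw [yt t htl htr]
      have n1 : x t ≠ x l := x.injective.ne htl
      have n2 : x t ≠ x r := x.injective.ne htr
      have i1 : InCyc l r t ↔ l < t ∧ ¬ r < t := by
        rw [inCyc_iff, Fin.lt_def, Fin.lt_def]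
        rw [Fin.lt_def] at hlr
        rw [Fin.ext_iff] at htl htr
        omega
      have i2 : InCyc (x l) (x r) (x t) ↔ x l < x t ∧ ¬ x r < x t := by
        rw [inCyc_iff, Fin.lt_def, Fin.lt_def]
        rw [Fin.lt_def] at hx
        rw [Ne, Fin.ext_iff] at n1 n2
        omega
      have i3 : t < l ↔ ¬ l < t := by
        rw [not_lt, le_iff_lt_or_eq, or_iff_left htl]
      have i4 : t < r ↔ ¬ r < t := by
        rw [not_lt, le_iff_lt_or_eq, or_iff_left htr]
      have i5 : x t < x l ↔ ¬ x l < x t := by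
        rw [not_lt, le_iff_lt_or_eq, or_iff_left n1]
      have i6 : x t < x r ↔ ¬ x r < x t := by
        rw [not_lt, le_iff_lt_or_eq, or_iff_left n2]
      simp only [i1, i2, i3, i4, i5, i6]
      by_cases h1 : l < t <;> by_cases h2 : r < t <;> by_cases h3 : x l < x t <;>
        by_cases h4 : x r < x t <;> simp [h1, h2, h3, h4, htl, htr]
      all_goals first
        | exact absurd (hx.trans h4) h3
        | exact absurd (hlr.trans h2) h1
    rw [Finset.sum_congr rfl fun t _ => hsum t, Finset.sum_add_distrib, ← Finset.mul_sum]
    ring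
  have hC : (∑ i, ∑ j, ((if i ≤ j ∧ x i ≤ σ j then (1 : ℤ) else 0) +
        if j < i ∧ σ j < x i then 1 else 0)) -
      (∑ i, ∑ j, ((if i ≤ j ∧ y i ≤ σ j then (1 : ℤ) else 0) + if j < i ∧ σ j < y i then 1 else 0)) =
      2 * markCount σ x l r := by
    rw [← Finset.sum_sub_distrib, Finset.sum_eq_add l r hne ?_ (by simp) (by simp)]
    · rw [yl, yr, markCount_eq_sum, ← Finset.sum_sub_distrib, ← Finset.sum_sub_distrib,
        ← Finset.sum_add_distrib, Finset.mul_sum]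
      refine Finset.sum_congr rfl fun t _ => ?_
      have i1 : InCyc l r t ↔ l ≤ t ∧ ¬ r ≤ t := by
        rw [inCyc_iff, Fin.le_def, Fin.le_def]
        rw [Fin.lt_def] at hlr
        omega
      have i2 : InCyc (x l) (x r) (σ t) ↔ x l ≤ σ t ∧ ¬ x r ≤ σ t := by
        rw [inCyc_iff, Fin.le_def, Fin.le_def]
        rw [Fin.lt_def] at hx
        omega
      simp only [i1, i2, ← not_le]
      by_cases h1 : l ≤ t <;> by_cases h2 : r ≤ t <;> by_cases h3 : x l ≤ σ t <;>
        by_cases h4 : x r ≤ σ t <;> simp [h1, h2, h3, h4]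
      all_goals first
        | exact absurd (hx.le.trans h4) h3
        | exact absurd (hlr.le.trans h2) h1
    · intro t _ ht
      rw [yt t ht.1 ht.2, sub_self]
  rw [maslovWrt_eq, maslovWrt_eq]
  linear_combination hNE - hC

theorem markCount_add_col (σ : Equiv.Perm (Fin n)) (x : GridState n) {l r : Fin n} (h : l ≠ r) :
    markCount σ (x * Equiv.swap l r) l r + markCount σ x l r = (cyc l r).card := by
  rw [cyc, ← Finset.card_filter_add_card_filter_not (s := Finset.univ.filter (InCyc l r))
    (p := fun t => InCyc (x r) (x l) (σ t)), markCount, markCount, Finset.filter_filter,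
    Finset.filter_filter]
  simp [inCyc_compl (x.injective.ne h)]

theorem markCount_add_row (σ : Equiv.Perm (Fin n)) (x : GridState n) {l r : Fin n} (h : l ≠ r) :
    markCount σ (x * Equiv.swap l r) r l + markCount σ x l r = (cyc (x l) (x r)).card := by
  have h1 : (cyc (x l) (x r)).card =
      (Finset.univ.filter fun t => InCyc (x l) (x r) (σ t)).card := by
    rw [← Finset.card_map σ.symm.toEmbedding]
    congr 1
    ext t
    simp
  rw [h1, ← Finset.card_filter_add_card_filter_not (p := fun t => InCyc r l t), markCount, markCount,
    Finset.filter_filter, Finset.filter_filter]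
  simp [inCyc_compl h, and_comm]

/-- The change of the Maslov grading along a rectangle on the torus.  Rectangles that leave the
fundamental domain are reduced to planar ones: together with a planar one they fill an annulus. -/
theorem maslovWrt_rect (σ : Equiv.Perm (Fin n)) (x : GridState n) {l r : Fin n} (hlr : l ≠ r) :
    maslovWrt σ x - maslovWrt σ (x * Equiv.swap l r) =
      1 + 2 * interiorCount x (l, r) - 2 * markCount σ x l r := by
  have hinv : ∀ (x : GridState n) (l r : Fin n), x * Equiv.swap l r * Equiv.swap l r = x :=
    fun x l r => by rw [mul_assoc, Equiv.swap_mul_self, mul_one]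
  -- Column annuli and row annuli exchange the four kinds of rectangles.
  have hcol : ∀ (x : GridState n) {l r : Fin n}, l ≠ r →
      (maslovWrt σ (x * Equiv.swap l r) - maslovWrt σ x =
        1 + 2 * interiorCount (x * Equiv.swap l r) (l, r) -
          2 * markCount σ (x * Equiv.swap l r) l r) →
      maslovWrt σ x - maslovWrt σ (x * Equiv.swap l r) =
        1 + 2 * interiorCount x (l, r) - 2 * markCount σ x l r := by
    intro x l r h e
    have h1 := interiorCount_add_col x h
    have h2 := markCount_add_col σ x h
    have h3 : 0 < (cyc l r).card := Finset.card_pos.mpr ⟨l, left_mem_cyc h⟩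
    omega
  have hrow : ∀ (x : GridState n) {l r : Fin n}, l ≠ r →
      (maslovWrt σ (x * Equiv.swap l r) - maslovWrt σ x =
        1 + 2 * interiorCount (x * Equiv.swap l r) (r, l) -
          2 * markCount σ (x * Equiv.swap l r) r l) →
      maslovWrt σ x - maslovWrt σ (x * Equiv.swap l r) =
        1 + 2 * interiorCount x (l, r) - 2 * markCount σ x l r := by
    intro x l r h e
    have h1 := interiorCount_add_row x h
    have h2 := markCount_add_row σ x h
    have h3 : 0 < (cyc (x l) (x r)).card :=
      Finset.card_pos.mpr ⟨x l, left_mem_cyc (x.injective.ne h)⟩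
    omega
  have hlt : ∀ (x : GridState n) {l r : Fin n}, l < r → maslovWrt σ x - maslovWrt σ (x * Equiv.swap l r) =
      1 + 2 * interiorCount x (l, r) - 2 * markCount σ x l r := by
    intro x l r h
    rcases lt_or_gt_of_ne (x.injective.ne h.ne) with hx | hx
    · exact maslovWrt_planar σ x h hx
    · refine hcol x h.ne ?_
      have := maslovWrt_planar σ (x * Equiv.swap l r) h (by simpa using hx)
      rwa [hinv] at this
  rcases lt_or_gt_of_ne hlr with h | h
  · exact hlt x h
  · refine hrow x hlr ?_
    have := hlt (x * Equiv.swap l r) h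
    rwa [Equiv.swap_comm r l, hinv] at this

theorem maslovWrt_self (σ : Equiv.Perm (Fin n)) : maslovWrt σ σ = 1 - n := by
  rw [maslovWrt_eq]
  have h : ∀ i j, (if i ≤ j ∧ σ i ≤ σ j then (1 : ℤ) else 0) =
      (if i < j ∧ σ i < σ j then 1 else 0) + if i = j then 1 else 0 := by
    intro i j
    rcases lt_trichotomy i j with h | rfl | h
    · have := σ.injective.ne h.ne
      simp [h, h.le, h.ne, this.le_iff_lt]
    · simp
    · simp [h.not_ge, h.not_gt, h.ne']
  have h2 : (∑ i, ∑ j, if j < i ∧ σ j < σ i then (1 : ℤ) else 0) =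
      ∑ i, ∑ j, if i < j ∧ σ i < σ j then 1 else 0 := Finset.sum_comm
  simp only [h, Finset.sum_add_distrib, h2]
  simp
  ring

end Grading

/-! ### Bigradings and isomorphisms of homology -/

section Bigrading

open MvPolynomial

/-- The bidegrees of the variables: `(-2, -1)` for `V_i` and `(2, 0)` for `v`. -/
def varDegree (n : ℕ) : Option (Fin n) → ℤ × ℚ
  | none => (2, 0)
  | some _ => (-2, -1)

theorem weight_varDegree {n : ℕ} (k : Option (Fin n) →₀ ℕ) :
    Finsupp.weight (varDegree n) k =
      (-2 * ∑ i, (k (some i) : ℤ) + 2 * (k none : ℤ), -∑ i, (k (some i) : ℚ)) := by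
  rw [Finsupp.weight_eq_sum, Fintype.sum_option]
  ext
  · simp [varDegree, Prod.fst_sum, Finset.mul_sum, mul_comm, add_comm]
  · simp [varDegree, Prod.snd_sum]

namespace GridDiagram

variable {n : ℕ} (G : GridDiagram n)

/-- The bidegree of a grid state. -/
def bidegree (x : GridState n) : ℤ × ℚ := (G.maslov x, G.alexander x)

theorem homogeneousChain_iff {d : ℤ} {s : ℚ} {z : GC n} : G.HomogeneousChain d s z ↔
    ∀ x, IsWeightedHomogeneous (varDegree n) (z x) ((d, s) - G.bidegree x) := by
  refine forall_congr' fun x => forall_congr' fun k => ?_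
  rw [mem_support_iff, weight_varDegree]
  refine imp_congr_right fun _ => ?_
  rw [eq_sub_iff_add_eq, bidegree, Prod.mk_add_mk, Prod.mk.injEq]
  constructor <;> rintro ⟨h1, h2⟩ <;> constructor <;> linarith

/-- The component of bidegree `(d, s)` of a chain. -/
noncomputable def component (d : ℤ) (s : ℚ) : GC n →+ GC n where
  toFun z x := weightedHomogeneousComponent (varDegree n) ((d, s) - G.bidegree x) (z x)
  map_zero' := by ext; simp
  map_add' a b := by ext; simp

theorem component_homogeneous (d : ℤ) (s : ℚ) (z : GC n) :
    G.HomogeneousChain d s (G.component d s z) :=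
  G.homogeneousChain_iff.mpr fun _ => weightedHomogeneousComponent_isWeightedHomogeneous _ _

theorem component_of_homogeneous {d : ℤ} {s : ℚ} {z : GC n} (h : G.HomogeneousChain d s z) (d' : ℤ)
    (s' : ℚ) : G.component d' s' z = if (d', s') = (d, s) then z else 0 := by
  funext x
  change weightedHomogeneousComponent _ _ _ = _
  rw [weightedHomogeneousComponent_of_mem (G.homogeneousChain_iff.mp h x)]
  by_cases hd : (d', s') = (d, s)
  · rw [if_pos hd, if_pos (by rw [hd])]
  · rw [if_neg hd, if_neg fun e => hd (sub_left_inj.mp e)]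
    rfl

/-- A bihomogeneous additive map commutes with the selection of components. -/
theorem component_comm {m : ℕ} {G' : GridDiagram m} (f : GC n →+ GC m) (e : ℤ)
    (hf : ∀ d s z, G.HomogeneousChain d s z → G'.HomogeneousChain (d + e) s (f z)) (d : ℤ) (s : ℚ)
    (z : GC n) : G'.component (d + e) s (f z) = f (G.component d s z) := by
  suffices h : (G'.component (d + e) s).comp f = f.comp (G.component d s) from
    DFunLike.congr_fun h z
  refine AddMonoidHom.functions_ext _ _ _ fun x p => ?_
  refine MvPolynomial.induction_on' p (fun k a => ?_) fun p q hp hq => ?_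
  · set b := G.bidegree x + Finsupp.weight (varDegree n) k with hb
    have hz : G.HomogeneousChain b.1 b.2 (Pi.single x (monomial k a)) := by
      rw [homogeneousChain_iff]
      intro y
      rcases eq_or_ne y x with rfl | hy
      · rw [Pi.single_eq_same]
        exact isWeightedHomogeneous_monomial _ _ _ (by rw [hb, Prod.mk.eta]; abel)
      · rw [Pi.single_eq_of_ne hy]
        exact isWeightedHomogeneous_zero _ _ _
    rw [AddMonoidHom.comp_apply, AddMonoidHom.comp_apply, G.component_of_homogeneous hz,
      G'.component_of_homogeneous (hf _ _ _ hz)]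
    simp only [Prod.mk.injEq, add_left_inj]
    split_ifs <;> simp
  · simp only [Pi.single_add, map_add, hp, hq]

end GridDiagram

theorem isWeightedHomogeneous_rename {n m : ℕ} (f : Fin n → Fin m) {p : GridRing n} {d : ℤ × ℚ}
    (h : IsWeightedHomogeneous (varDegree n) p d) :
    IsWeightedHomogeneous (varDegree m) (rename (Option.map f) p) d := by
  have hw : varDegree m ∘ Option.map f = varDegree n := by
    funext i
    cases i <;> rfl
  induction h using IsWeightedHomogeneous.induction_on with
  | zero => rw [map_zero]; exact isWeightedHomogeneous_zero _ _ _
  | add p q _ _ hp hq => rw [map_add]; exact hp.add hq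
  | monomial k a hk =>
    rw [rename_monomial]
    refine isWeightedHomogeneous_monomial _ _ _ ?_
    rw [← hk, ← hw]
    exact Finsupp.linearCombination_mapDomain _ _ _

/-- The ring homomorphism that renumbers the variables `V_i` and keeps `v`. -/
noncomputable def renameHom {n m : ℕ} (f : Fin n → Fin m) : GridRing n →+* GridRing m :=
  (rename (Option.map f) : GridRing n →ₐ[ZMod 2] GridRing m).toRingHom

/-- The homology groups of two grid diagrams are isomorphic as bigraded groups, semilinearly with respect
to the renumbering `f` of the variables. -/
def GridIso {n m : ℕ} (G : GridDiagram n) (G' : GridDiagram m) (f : Fin n → Fin m) : Prop :=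
  ∃ φ : G.GH ≃+ G'.GH, (∀ (p : GridRing n) h, φ (p • h) = renameHom f p • φ h) ∧
    ∀ d s h, G.HomogeneousClass d s h ↔ G'.HomogeneousClass d s (φ h)

theorem GridIso.trans {n m k : ℕ} {G : GridDiagram n} {G' : GridDiagram m} {G'' : GridDiagram k}
    {f : Fin n → Fin m} {g : Fin m → Fin k} (h : GridIso G G' f) (h' : GridIso G' G'' g) :
    GridIso G G'' (g ∘ f) := by
  obtain ⟨φ, h1, h2⟩ := h
  obtain ⟨ψ, h3, h4⟩ := h'
  refine ⟨φ.trans ψ, fun p h => ?_, fun d s h => (h2 d s h).trans (h4 d s _)⟩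
  rw [AddEquiv.trans_apply, h1, h3, AddEquiv.trans_apply]
  congr 1
  simp [renameHom, rename_rename]

theorem GridIso.symm {n : ℕ} {G G' : GridDiagram n} {σ : Equiv.Perm (Fin n)}
    (h : GridIso G G' σ) : GridIso G' G σ.symm := by
  obtain ⟨φ, h1, h2⟩ := h
  refine ⟨φ.symm, fun p h => ?_, fun d s h => ?_⟩
  · rw [AddEquiv.symm_apply_eq, h1, AddEquiv.apply_symm_apply]
    congr 1
    simp [renameHom, rename_rename]
  · rw [h2, AddEquiv.apply_symm_apply]

/-- A bihomogeneous chain map that is bijective on homology identifies the homogeneous classes, since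
the components of a preimage can be selected. -/
theorem GridIso.of_chainMap {n m : ℕ} {G : GridDiagram n} {G' : GridDiagram m} {f : Fin n → Fin m}
    (F : GC n →ₛₗ[renameHom f] GC m) (hF : ∀ z, F (G.diff z) = G'.diff (F z))
    (hd : ∀ d s z, G.HomogeneousChain d s z → G.HomogeneousChain (d + -1) s (G.diff z))
    (hd' : ∀ d s z, G'.HomogeneousChain d s z → G'.HomogeneousChain (d + -1) s (G'.diff z))
    (hhom : ∀ d s z, G.HomogeneousChain d s z → G'.HomogeneousChain d s (F z))
    (hinj : ∀ z, G.diff z = 0 → ∀ b, F z = G'.diff b → ∃ a, z = G.diff a)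
    (hsurj : ∀ z, G'.diff z = 0 → ∃ a b, G.diff a = 0 ∧ z = F a + G'.diff b) :
    GridIso G G' f := by
  set K : LinearMap.ker G.diff →ₛₗ[renameHom f] LinearMap.ker G'.diff :=
    { toFun := fun z => ⟨F z, by rw [LinearMap.mem_ker, ← hF, LinearMap.mem_ker.mp z.2, map_zero]⟩
      map_add' := fun a b => by ext1; simp
      map_smul' := fun p a => by ext1; simp } with hK
  have hle : (LinearMap.range G.diff).submoduleOf (LinearMap.ker G.diff) ≤
      ((LinearMap.range G'.diff).submoduleOf (LinearMap.ker G'.diff)).comap K := by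
    rintro z ⟨a, ha⟩
    exact ⟨F a, by rw [← hF, ha]; rfl⟩
  have hinj' : Function.Injective (Submodule.mapQ _ _ K hle) := by
    rw [injective_iff_map_eq_zero]
    intro h
    induction h using Submodule.Quotient.induction_on with | H z => ?_
    intro hz
    rw [Submodule.mapQ_apply, Submodule.Quotient.mk_eq_zero] at hz
    obtain ⟨b, hb⟩ := hz
    obtain ⟨a, ha⟩ := hinj z (LinearMap.mem_ker.mp z.2) b hb.symm
    rw [Submodule.Quotient.mk_eq_zero]
    exact ⟨a, ha.symm⟩
  have hsurj' : Function.Surjective (Submodule.mapQ _ _ K hle) := by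
    intro h
    induction h using Submodule.Quotient.induction_on with | H z => ?_
    obtain ⟨a, b, ha, hab⟩ := hsurj z (LinearMap.mem_ker.mp z.2)
    refine ⟨Submodule.Quotient.mk ⟨a, ha⟩, ?_⟩
    rw [Submodule.mapQ_apply, Submodule.Quotient.eq]
    refine ⟨-b, ?_⟩
    simp [hK, hab]
  refine ⟨AddEquiv.ofBijective (Submodule.mapQ _ _ K hle).toAddMonoidHom ⟨hinj', hsurj'⟩,
    fun p h => (Submodule.mapQ _ _ K hle).map_smulₛₗ p h, fun d s h => ⟨?_, ?_⟩⟩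
  · rintro ⟨z, hz, rfl⟩
    exact ⟨K z, hhom d s z hz, rfl⟩
  · rintro ⟨z', hz', hh⟩
    induction h using Submodule.Quotient.induction_on with | H z => ?_
    have hz : F z - z' ∈ LinearMap.range G'.diff := by
      have := (Submodule.Quotient.eq _).mp hh.symm
      exact this
    obtain ⟨b, hb⟩ := hz
    have e1 := G.component_comm (G' := G') F.toAddMonoidHom 0 (by simpa using hhom) d s z.1
    have e2 := G.component_comm (G' := G) G.diff.toAddMonoidHom (-1) hd d s z.1
    have e3 := G'.component_comm (G' := G') G'.diff.toAddMonoidHom (-1) hd' (d + 1) s b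
    simp only [LinearMap.toAddMonoidHom_coe, add_zero, add_neg_cancel_right, LinearMap.mem_ker.mp z.2,
      map_zero] at e1 e2 e3
    have hc : G.diff (G.component d s z) = 0 := e2.symm
    refine ⟨⟨G.component d s z, hc⟩, G.component_homogeneous d s z, hinj' ?_⟩
    rw [Submodule.mapQ_apply, Submodule.mapQ_apply, Submodule.Quotient.eq]
    refine ⟨G'.component (d + 1) s b - b, ?_⟩
    have e4 : F z.1 = z'.1 + G'.diff b := by rw [hb]; abel
    have e5 : F (G.component d s z) = z'.1 + G'.diff (G'.component (d + 1) s b) := by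
      rw [← e1, e4, map_add, e3, G'.component_of_homogeneous hz', if_pos rfl]
    simp [hK, e4, e5]

end Bigrading

/-! ### The differential -/

section Differential

open MvPolynomial

variable {N : ℕ} {A B : Type*} [CommRing A] [CommRing B]

theorem map_scal (f : A →+* B) (u : Fin N → Fin N → A) (v : A) (x : GridState N) (l r : Fin N) :
    f (scal u v x l r) = scal (fun t q => f (u t q)) (f v) x l r := by
  simp only [scal, map_mul, map_prod, map_pow]

theorem map_rectMatrix_scal (f : A →+* B) (u : Fin N → Fin N → A) (v : A) :
    (rectMatrix (scal u v)).map f = rectMatrix (scal (fun t q => f (u t q)) (f v)) := by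
  ext y x
  simp only [Matrix.map_apply, rectMatrix, map_sum, map_scal]

theorem sum_boole_mark {Γ : Type*} [AddCommMonoid Γ] (σ : Equiv.Perm (Fin N)) (x : GridState N)
    (l r : Fin N) (g : Γ) :
    ∑ t ∈ cyc l r, ∑ q ∈ cyc (x l) (x r), (if q = σ t then g else 0) = markCount σ x l r • g := by
  simp only [Finset.sum_ite_eq', mem_cyc]
  rw [← Finset.sum_filter, Finset.sum_const, markCount, cyc, Finset.filter_filter]

section Homogeneous

variable {ι Γ k : Type*} [AddCommGroup Γ] [CommRing k] {w : ι → Γ}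

/-- Since zero is homogeneous of every degree, the degrees `δ` of vanishing weights are free. -/
theorem isWeightedHomogeneous_scal {u : Fin N → Fin N → MvPolynomial ι k} {v : MvPolynomial ι k}
    {δ : Fin N → Fin N → Γ} {δv : Γ} (hu : ∀ t q, IsWeightedHomogeneous w (u t q) (δ t q))
    (hv : IsWeightedHomogeneous w v δv) (x : GridState N) (l r : Fin N) :
    IsWeightedHomogeneous w (scal u v x l r)
      (∑ t ∈ cyc l r, ∑ q ∈ cyc (x l) (x r), δ t q + interiorCount x (l, r) • δv) :=
  (IsWeightedHomogeneous.prod _ _ _ fun t _ =>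
    IsWeightedHomogeneous.prod _ _ _ fun q _ => hu t q).mul (hv.pow _)

/-- A rectangle count is homogeneous with respect to a grading `b` of the states, if the degrees of the
squares and of the interior points add up to the change of `b` along every rectangle, up to the constant
`c`. -/
theorem isWeightedHomogeneous_rectMatrix {u : Fin N → Fin N → MvPolynomial ι k}
    {v : MvPolynomial ι k} {δ : Fin N → Fin N → Γ} {δv : Γ}
    (hu : ∀ t q, IsWeightedHomogeneous w (u t q) (δ t q)) (hv : IsWeightedHomogeneous w v δv)
    (b : GridState N → Γ) (c : Γ)
    (hb : ∀ x l r, l ≠ r → b x - b (x * Equiv.swap l r) =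
      ∑ t ∈ cyc l r, ∑ q ∈ cyc (x l) (x r), δ t q + interiorCount x (l, r) • δv + c)
    (y x : GridState N) :
    IsWeightedHomogeneous w (rectMatrix (scal u v) y x) (b x - b y - c) := by
  refine IsWeightedHomogeneous.sum _ _ _ fun p hp => ?_
  obtain ⟨h, rfl⟩ := mem_rects.mp hp
  rw [hb x p.1 p.2 h, add_sub_cancel_right]
  exact isWeightedHomogeneous_scal hu hv x p.1 p.2

end Homogeneous

theorem two_eq_zero {ι : Type*} : (2 : MvPolynomial ι (ZMod 2)) = 0 := by
  have : (2 : ZMod 2) = 0 := by decide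
  rw [← map_ofNat (C : ZMod 2 →+* MvPolynomial ι (ZMod 2)) 2, this, map_zero]

namespace GridDiagram

variable {n : ℕ} (G : GridDiagram n)

/-- The weight of a square: `0` at the `X`-markings, `V c` at the `O`-marking of the column `c`, and `1`
at the empty squares. -/
def squareWeight (V : Fin n → A) (c q : Fin n) : A :=
  if q = G.X c then 0 else if q = G.O c then V c else 1

/-- The differential as a matrix, with the coefficients in any ring with a choice of elements for the
variables. -/
def boundary (V : Fin n → A) (v : A) : Matrix (GridState n) (GridState n) A :=
  rectMatrix (scal (G.squareWeight V) v)

theorem map_boundary (f : A →+* B) (V : Fin n → A) (v : A) :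
    (G.boundary V v).map f = G.boundary (fun i => f (V i)) (f v) := by
  rw [boundary, map_rectMatrix_scal, boundary]
  congr 2
  funext c q
  simp only [squareWeight, apply_ite f, map_zero, map_one]

theorem scal_squareWeight (V : Fin n → A) (v : A) (x : GridState n) (p : Fin n × Fin n) :
    scal (G.squareWeight V) v x p.1 p.2 =
      if G.AvoidsX x p then (∏ i, V i ^ G.countO x p i) * v ^ interiorCount x p else 0 := by
  split_ifs with h
  · rw [scal]
    congr 1
    rw [cyc, Finset.prod_filter]
    refine Finset.prod_congr rfl fun t _ => ?_
    by_cases ht : InCyc p.1 p.2 t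
    · rw [if_pos ht]
      have h1 : ∀ q ∈ cyc (x p.1) (x p.2), G.squareWeight V t q =
          if q = G.O t then V t else 1 := fun q hq =>
        if_neg fun e : q = G.X t => h t ⟨ht, e ▸ mem_cyc.mp hq⟩
      rw [Finset.prod_congr rfl h1, Finset.prod_ite_eq']
      simp [countO, HasSquare, ht, mem_cyc]
    · simp [countO, HasSquare, ht]
  · rw [AvoidsX] at h
    push Not at h
    obtain ⟨t, h1, h2⟩ := h
    have h3 : ∏ q ∈ cyc (x p.1) (x p.2), G.squareWeight V t q = 0 :=
      Finset.prod_eq_zero (mem_cyc.mpr h2) (if_pos rfl)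
    rw [scal, Finset.prod_eq_zero (mem_cyc.mpr h1) h3, zero_mul]

theorem diff_apply (z : GC n) :
    G.diff z = (G.boundary (fun i => MvPolynomial.X (some i)) (MvPolynomial.X none)).mulVec z := by
  funext y
  simp only [diff, Fintype.linearCombination_apply, Finset.sum_apply, Pi.smul_apply, smul_eq_mul,
    Matrix.mulVec, dotProduct, boundary, rectMatrix]
  refine Finset.sum_congr rfl fun x _ => ?_
  rw [mul_comm, Finset.sum_filter]
  congr 1
  refine Finset.sum_congr rfl fun p _ => ?_
  rw [scal_squareWeight]

theorem prod_squareWeight_col (V : Fin n → A) (t : Fin n) : ∏ q, G.squareWeight V t q = 0 :=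
  Finset.prod_eq_zero (Finset.mem_univ (G.X t)) (if_pos rfl)

theorem prod_squareWeight_row (V : Fin n → A) (q : Fin n) : ∏ t, G.squareWeight V t q = 0 :=
  Finset.prod_eq_zero (Finset.mem_univ (G.X.symm q)) (if_pos (by simp))

/-- Every row and every column contains an `X`-marking, so that all annuli have weight `0`. -/
theorem boundary_sq (V : Fin n → A) (v : A) (h2 : (2 : A) = 0) :
    G.boundary V v * G.boundary V v = 0 := by
  rcases n with - | n
  · ext y x
    refine (Matrix.mul_apply).trans (Finset.sum_eq_zero fun z _ => ?_)
    rw [boundary, rectMatrix, Finset.sum_eq_zero, zero_mul]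
    exact fun p => p.1.elim0
  have hN : n + 1 ≠ 1 := by
    intro h
    obtain rfl : n = 0 := by omega
    exact G.disjoint 0 (Subsingleton.elim (α := Fin 1) _ _)
  rw [boundary, scal_sq hN _ _ h2]
  · simp [prod_squareWeight_col, prod_squareWeight_row]
  · intro t; rw [prod_squareWeight_col, mul_zero]
  · intro t; rw [prod_squareWeight_row, mul_zero]

theorem diff_comp_diff : G.diff ∘ₗ G.diff = 0 := by
  refine LinearMap.ext fun z => ?_
  rw [LinearMap.comp_apply, diff_apply, diff_apply, Matrix.mulVec_mulVec, boundary_sq _ _ _ two_eq_zero,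
    Matrix.zero_mulVec, LinearMap.zero_apply]

theorem bidegree_sub (x : GridState n) {l r : Fin n} (h : l ≠ r) :
    G.bidegree x - G.bidegree (x * Equiv.swap l r) =
      ((1 + 2 * interiorCount x (l, r) - 2 * markCount G.O x l r : ℤ),
        (markCount G.X x l r : ℚ) - markCount G.O x l r) := by
  have h1 := maslovWrt_rect G.O x h
  have h2 := congrArg (Int.cast : ℤ → ℚ) h1
  have h3 := congrArg (Int.cast : ℤ → ℚ) (maslovWrt_rect G.X x h)
  push_cast at h2 h3
  ext
  · exact h1
  · simp only [bidegree, alexander, Prod.snd_sub]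
    linarith

/-- The bidegree by which a square contributes to the bidegree of a rectangle. -/
def squareDegree (c q : Fin n) : ℤ × ℚ :=
  (if q = G.O c then (-2, -1) else 0) + if q = G.X c then (0, 1) else 0

theorem sum_squareDegree (x : GridState n) (l r : Fin n) :
    ∑ t ∈ cyc l r, ∑ q ∈ cyc (x l) (x r), G.squareDegree t q =
      ((-2 * markCount G.O x l r : ℤ), (markCount G.X x l r : ℚ) - markCount G.O x l r) := by
  simp only [squareDegree, Finset.sum_add_distrib, sum_boole_mark]
  ext
  · simp [mul_comm]
  · simp
    ring

theorem bidegree_sub_eq (x : GridState n) {l r : Fin n} (h : l ≠ r) :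
    G.bidegree x - G.bidegree (x * Equiv.swap l r) =
      ∑ t ∈ cyc l r, ∑ q ∈ cyc (x l) (x r), G.squareDegree t q +
        interiorCount x (l, r) • ((2, 0) : ℤ × ℚ) + (1, 0) := by
  rw [bidegree_sub _ _ h, sum_squareDegree]
  ext
  · simp
    ring
  · simp

theorem squareWeight_homogeneous (c q : Fin n) : IsWeightedHomogeneous (varDegree n)
    (G.squareWeight (fun i => MvPolynomial.X (some i)) c q : GridRing n) (G.squareDegree c q) := by
  rw [squareWeight, squareDegree]
  split_ifs with h1 h2
  · exact isWeightedHomogeneous_zero _ _ _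
  · exact isWeightedHomogeneous_zero _ _ _
  · rw [add_zero]; exact isWeightedHomogeneous_X _ _ _
  · rw [add_zero]; exact isWeightedHomogeneous_one _ _

theorem homogeneousChain_mulVec {m : ℕ} {M : Matrix (GridState n) (GridState n) (GridRing m)}
    {z : GridState n → GridRing m} {b b' : GridState n → ℤ × ℚ} {d e : ℤ × ℚ}
    (hM : ∀ y x, IsWeightedHomogeneous (varDegree m) (M y x) (b x - b' y + e))
    (hz : ∀ x, IsWeightedHomogeneous (varDegree m) (z x) (d - b x)) (y : GridState n) :
    IsWeightedHomogeneous (varDegree m) (M.mulVec z y) (d + e - b' y) := by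
  refine IsWeightedHomogeneous.sum _ _ _ fun x _ => ?_
  have := (hM y x).mul (hz x)
  rwa [show b x - b' y + e + (d - b x) = d + e - b' y by abel] at this

theorem diff_homogeneous (d : ℤ) (s : ℚ) (z : GC n) (hz : G.HomogeneousChain d s z) :
    G.HomogeneousChain (d + -1) s (G.diff z) := by
  rw [homogeneousChain_iff] at hz ⊢
  intro y
  rw [diff_apply]
  have hM : ∀ y x, IsWeightedHomogeneous (varDegree n)
      (G.boundary (fun i => MvPolynomial.X (some i)) (MvPolynomial.X none) y x : GridRing n)
      (G.bidegree x - G.bidegree y + (-1, 0)) := by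
    intro y x
    have := isWeightedHomogeneous_rectMatrix G.squareWeight_homogeneous
      (isWeightedHomogeneous_X (ZMod 2) (varDegree n) none) G.bidegree (1, 0)
      (fun x l r h => G.bidegree_sub_eq x h) y x
    rwa [sub_eq_add_neg _ ((1, 0) : ℤ × ℚ), Prod.neg_mk, neg_zero] at this
  simpa using homogeneousChain_mulVec hM hz y

end GridDiagram

end Differential

/-! ### An acyclicity criterion -/

section Perturbation

open MvPolynomial

variable {σ τ Γ : Type*} [AddCommMonoid Γ]

theorem isWeightedHomogeneous_eval₂Hom {k : Type*} [CommRing k] {w : σ → Γ} {w' : τ → Γ}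
    {g : σ → MvPolynomial τ k} (hg : ∀ i, IsWeightedHomogeneous w' (g i) (w i))
    {p : MvPolynomial σ k} {d : Γ} (h : IsWeightedHomogeneous w p d) :
    IsWeightedHomogeneous w' (eval₂Hom C g p) d := by
  induction h using IsWeightedHomogeneous.induction_on with
  | zero => rw [map_zero]; exact isWeightedHomogeneous_zero _ _ _
  | add p q _ _ hp hq => rw [map_add]; exact hp.add hq
  | monomial k a hk =>
    rw [eval₂Hom_monomial, ← hk, Finsupp.weight_apply, Finsupp.prod, Finsupp.sum]
    exact (IsWeightedHomogeneous.prod _ _ _ fun i _ => (hg i).pow _).C_mul a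

/-- The substitution of `0` for the additional variable `none`. -/
noncomputable def dropHom : MvPolynomial (Option σ) (ZMod 2) →+* MvPolynomial σ (ZMod 2) :=
  eval₂Hom C fun i => i.elim 0 X

/-- The substitution of the infinitesimal `ε` for the additional variable `none` and of `0` for the
other ones. -/
noncomputable def dualHom : MvPolynomial (Option σ) (ZMod 2) →+* DualNumber (ZMod 2) :=
  eval₂Hom (algebraMap (ZMod 2) (DualNumber (ZMod 2))) fun i => i.elim DualNumber.eps 0

/-- The degrees `-2` of the additional variable and `2` of the other ones. -/
def dualDegree : Option σ → ℤ := fun i => i.elim (-2) 2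

theorem fst_dualHom (p : MvPolynomial (Option σ) (ZMod 2)) :
    (dualHom p).fst = constantCoeff (dropHom p) := by
  have : (TrivSqZeroExt.fstHom (ZMod 2) (ZMod 2) (ZMod 2)).toRingHom.comp dualHom =
      (constantCoeff : MvPolynomial σ (ZMod 2) →+* ZMod 2).comp dropHom := by
    refine MvPolynomial.ringHom_ext (fun r => ?_) fun i => ?_
    · simp [dualHom, dropHom]
    · cases i <;> simp [dualHom, dropHom]
  exact DFunLike.congr_fun this p

theorem snd_dualHom_eq_zero {p : MvPolynomial (Option σ) (ZMod 2)} {d : ℤ}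
    (h : IsWeightedHomogeneous dualDegree p d) (hd : d ≠ -2) : (dualHom p).snd = 0 := by
  induction h using IsWeightedHomogeneous.induction_on with
  | zero => simp
  | add p q _ _ hp hq => simp [hp, hq]
  | monomial k a hk =>
    suffices hs : (k.prod fun i m => (i.elim DualNumber.eps 0 : DualNumber (ZMod 2)) ^ m).snd = 0 by
      rw [dualHom, eval₂Hom_monomial, TrivSqZeroExt.algebraMap_eq_inl, TrivSqZeroExt.snd_mul, hs]
      simp
    by_cases hs : ∃ i, k (some i) ≠ 0
    · obtain ⟨i, hi⟩ := hs
      rw [Finsupp.prod, Finset.prod_eq_zero (Finsupp.mem_support_iff.mpr hi)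
        (by simp [hi]), TrivSqZeroExt.snd_zero]
    · push Not at hs
      obtain ⟨m, rfl⟩ : ∃ m, k = Finsupp.single none m := by
        refine ⟨k none, ?_⟩
        ext i
        cases i <;> simp [hs]
      rw [Finsupp.prod_single_index (h := fun (i : Option σ) m =>
        (i.elim DualNumber.eps 0 : DualNumber (ZMod 2)) ^ m) (pow_zero _)]
      rw [Finsupp.weight_single] at hk
      change (DualNumber.eps ^ m).snd = 0
      rcases m with - | - | m
      · simp
      · exact absurd hk.symm (by simpa [dualDegree] using hd)
      · rw [pow_succ, pow_succ, mul_assoc, DualNumber.eps_mul_eps, mul_zero, TrivSqZeroExt.snd_zero]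

theorem isWeightedHomogeneous_dropHom {p : MvPolynomial (Option σ) (ZMod 2)} {d : ℤ}
    (h : IsWeightedHomogeneous dualDegree p d) :
    IsWeightedHomogeneous (fun _ => (2 : ℤ)) (dropHom p) d := by
  refine isWeightedHomogeneous_eval₂Hom (fun i => ?_) h
  cases i
  · exact isWeightedHomogeneous_zero _ _ _
  · exact isWeightedHomogeneous_X _ _ _

variable {T : Type*} [Fintype T] [DecidableEq T]

/-- An acyclicity criterion.  If a differential `E` with an additional variable squares to the
infinitesimal `ε` when the other variables are killed, then the coefficient of `ε` is a contraction
of `E` modulo all variables.  By homogeneity the contraction identity holds up to terms that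
increase `f` strictly; so it can be corrected step by step. -/
theorem exists_eq_mulVec_of_dual (E : Matrix T T (MvPolynomial (Option σ) (ZMod 2))) (f : T → ℤ)
    (hE : ∀ y x, IsWeightedHomogeneous dualDegree (E y x) (f y - f x - 1))
    (hD : E.map dropHom * E.map dropHom = 0)
    (hε : E.map dualHom * E.map dualHom = (DualNumber.eps : DualNumber (ZMod 2)) • 1)
    (z : T → MvPolynomial σ (ZMod 2)) (hz : (E.map dropHom).mulVec z = 0) :
    ∃ b, z = (E.map dropHom).mulVec b := by
  -- The coefficient `K` of `ε` is a constant matrix.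
  set D := E.map dropHom with hDdef
  set K : Matrix T T (MvPolynomial σ (ZMod 2)) := fun y x => C (dualHom (E y x)).snd with hK
  have hDh : ∀ y x, IsWeightedHomogeneous (fun _ => (2 : ℤ)) (D y x) (f y - f x - 1) := fun y x =>
    isWeightedHomogeneous_dropHom (hE y x)
  have hKh : ∀ y x, IsWeightedHomogeneous (fun _ => (2 : ℤ)) (K y x) (f y - f x + 1) := by
    intro y x
    by_cases h : f y - f x - 1 = -2
    · rw [show f y - f x + 1 = 0 by omega]
      exact isWeightedHomogeneous_C _ _
    · rw [hK]
      simp only [snd_dualHom_eq_zero (hE y x) h, map_zero]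
      exact isWeightedHomogeneous_zero _ _ _
  have hNh : ∀ y x, IsWeightedHomogeneous (fun _ => (2 : ℤ)) ((D * K + K * D - 1) y x)
      (f y - f x) := by
    intro y x
    rw [Matrix.sub_apply, Matrix.add_apply, Matrix.mul_apply, Matrix.mul_apply]
    refine ((IsWeightedHomogeneous.sum _ _ _ fun t _ => ?_).add
      (IsWeightedHomogeneous.sum _ _ _ fun t _ => ?_)).sub ?_
    · have := (hDh y t).mul (hKh t x)
      rwa [show f y - f t - 1 + (f t - f x + 1) = f y - f x by ring] at this
    · have := (hKh y t).mul (hDh t x)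
      rwa [show f y - f t + 1 + (f t - f x - 1) = f y - f x by ring] at this
    · rw [Matrix.one_apply]
      split_ifs with h
      · rw [h, sub_self]
        exact isWeightedHomogeneous_one _ _
      · exact isWeightedHomogeneous_zero _ _ _
  have hN0 : ∀ y x, constantCoeff ((D * K + K * D - 1) y x) = 0 := by
    intro y x
    have h1 := congrArg TrivSqZeroExt.snd (congrFun (congrFun hε y) x)
    have h2 : constantCoeff ((1 : Matrix T T (MvPolynomial σ (ZMod 2))) y x) =
        (1 : Matrix T T (ZMod 2)) y x := by
      rw [Matrix.one_apply, Matrix.one_apply, apply_ite constantCoeff, map_one, map_zero]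
    rw [Matrix.sub_apply, map_sub, h2, sub_eq_zero, Matrix.add_apply, Matrix.mul_apply,
      Matrix.mul_apply, map_add, map_sum, map_sum, ← Finset.sum_add_distrib]
    rw [Matrix.mul_apply, TrivSqZeroExt.snd_sum] at h1
    refine Eq.trans (Finset.sum_congr rfl fun t _ => ?_) (h1.trans ?_)
    · simp only [map_mul, hK, constantCoeff_C, hDdef, Matrix.map_apply, ← fst_dualHom,
        TrivSqZeroExt.snd_mul, smul_eq_mul, MulOpposite.smul_eq_mul_unop, MulOpposite.unop_op]
    · rw [Matrix.smul_apply, Matrix.one_apply, Matrix.one_apply]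
      split_ifs <;> simp
  have hN : ∀ y x, (D * K + K * D - 1) y x ≠ 0 → f x < f y := by
    intro y x h
    obtain ⟨k, hk⟩ := ne_zero_iff.mp h
    have h1 := hNh y x hk
    have h2 : k ≠ 0 := by
      rintro rfl
      exact hk (hN0 y x)
    rw [Finsupp.weight_apply] at h1
    have h3 : 0 < k.sum fun i c => c • (2 : ℤ) := by
      refine Finset.sum_pos (fun i hi => ?_) (Finsupp.support_nonempty_iff.mpr h2)
      have := Nat.pos_of_ne_zero (Finsupp.mem_support_iff.mp hi)
      simp only [nsmul_eq_mul]
      positivity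
    omega
  -- The support of a cycle moves upwards with respect to `f` until it is empty.
  have key : ∀ (m : ℕ) (z : T → MvPolynomial σ (ZMod 2)), D.mulVec z = 0 →
      (∀ x, z x ≠ 0 → ∑ t, |f t| - m < f x) → ∃ b, z = D.mulVec b := by
    intro m
    induction m with
    | zero =>
      intro z _ hs
      refine ⟨0, ?_⟩
      rw [Matrix.mulVec_zero]
      funext x
      by_contra h
      have h1 := hs x h
      have h2 := Finset.single_le_sum (f := fun t => |f t|) (fun t _ => abs_nonneg _)
        (Finset.mem_univ x)
      have h3 := le_abs_self (f x)
      push_cast at h1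
      linarith
    | succ m ih =>
      intro z hz hs
      have e : (D * K + K * D - 1).mulVec z = D.mulVec (K.mulVec z) - z := by
        rw [Matrix.sub_mulVec, Matrix.add_mulVec, ← Matrix.mulVec_mulVec, ← Matrix.mulVec_mulVec, hz,
          Matrix.mulVec_zero, add_zero, Matrix.one_mulVec]
      obtain ⟨b, hb⟩ := ih ((D * K + K * D - 1).mulVec z) (by
        rw [e, Matrix.mulVec_sub, Matrix.mulVec_mulVec, hD, Matrix.zero_mulVec, hz, sub_zero]) (by
        intro y hy
        obtain ⟨x, -, hx⟩ := Finset.exists_ne_zero_of_sum_ne_zero hy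
        have h1 := hN y x (left_ne_zero_of_mul hx)
        have h2 := hs x (right_ne_zero_of_mul hx)
        push_cast at h2
        omega)
      refine ⟨K.mulVec z - b, ?_⟩
      rw [Matrix.mulVec_sub, ← hb, e, sub_sub_cancel]
  refine key (∑ t, |f t| + ∑ t, |f t| + 1).toNat z hz fun x _ => ?_
  have h2 := Finset.single_le_sum (f := fun t => |f t|) (fun t _ => abs_nonneg _) (Finset.mem_univ x)
  have h3 := neg_abs_le (f x)
  have h4 : 0 ≤ |f x| := abs_nonneg _
  omega

end Perturbation

/-! ### Pairs of differentials with common diagonal blocks -/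

section BlockAlgebra

variable {R R' V : Type*} [CommRing R] [CommRing R'] [AddCommGroup V] [Module R' V]

/-- Two differentials `D` and `E` on the sum of the images of a projection `p` and of `1 - p`, with the same
diagonal blocks.  The block of `D` from the image of `p` to that of `1 - p` vanishes, the opposite
block vanishes for `E`, and the two remaining off-diagonal blocks compose to the scalar `ω`. -/
structure BlockPair (D E p : V →ₗ[R'] V) (ω : R') : Prop where
  idem : ∀ z, p (p z) = p z
  lower : ∀ z, p (D (p z)) = D (p z)
  upper : ∀ z, p (E (z - p z)) = 0
  left : ∀ z, p (E (p z)) = D (p z)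
  right : ∀ z, E (z - p z) = D (z - p z) - p (D (z - p z))
  comp : ∀ z, p (D (E (p z) - p (E (p z)))) = ω • p z
  sq : ∀ z, D (D z) = 0
  sq' : ∀ z, E (E z) = 0

namespace BlockPair

variable {D E p : V →ₗ[R'] V} {ω : R'}

/-- On the image of `p`, the off-diagonal block of `E` is a homotopy from multiplication by `ω` to zero.
-/
theorem homotopy (h : BlockPair D E p ω) {z : V} (hz : p z = z) :
    D (E z - p (E z)) = ω • z - (E (D z) - p (E (D z))) := by
  have h1 := h.comp z
  have h2 := h.right (E z)
  have h3 := h.left z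
  rw [hz] at h1 h3
  rw [h1, map_sub E, h.sq', h3] at h2
  have h4 := h.upper (E z)
  rw [map_sub E, h.sq', h3, zero_sub, map_neg, neg_eq_zero] at h4
  rw [eq_sub_iff_add_eq] at h2
  rw [h4, sub_zero, h3, ← h2]
  abel

/-- If `E` is exact, every `D`-cycle is homologous to one that comes from the image of `p` and the
off-diagonal block of `E`. -/
theorem cycle (h : BlockPair D E p ω) (hex : ∀ z, E z = 0 → ∃ b, z = E b) {z : V} (hz : D z = 0) :
    ∃ i b c, p i = i ∧ p b = b ∧ D b = 0 ∧ D i = -(ω • b) ∧ z = i + (E b - p (E b)) + D c := by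
  have h1 : p (D z) = 0 := by rw [hz, map_zero]
  have hk : E (z - p z) = 0 := by
    rw [h.right, map_sub D, hz, map_sub p, map_zero, h.lower]
    abel
  obtain ⟨b, hb⟩ := hex _ hk
  have e1 : p (E b) = 0 := by rw [← hb, map_sub, h.idem, sub_self]
  have e2 : D (p b) = 0 := by
    have := h.upper b
    rw [map_sub, map_sub, e1, h.left, zero_sub, neg_eq_zero] at this
    exact this
  have e3 : p (E (p b)) = 0 := by rw [h.left, e2]
  have e4 := h.right b
  have hi : p (p z - p (D (b - p b))) = p z - p (D (b - p b)) := by rw [map_sub, h.idem, h.idem]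
  have e5 : z = p z - p (D (b - p b)) + (E (p b) - p (E (p b))) + D (b - p b) := by
    rw [e3, sub_zero]
    have : E b = E (p b) + E (b - p b) := by rw [← map_add, add_sub_cancel]
    rw [this, e4] at hb
    rw [← sub_eq_zero] at hb ⊢
    rw [← hb]
    abel
  refine ⟨_, p b, b - p b, hi, h.idem b, e2, ?_, e5⟩
  have e6 := h.homotopy (h.idem b)
  have e7 := congrArg D e5
  rw [e2, map_zero, map_zero, sub_self, sub_zero] at e6
  rw [hz, map_add, map_add, e6, h.sq, add_zero] at e7
  exact eq_neg_of_add_eq_zero_left e7.symm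

/-- If `E` is exact, a `D`-boundary in the image of `p` is a boundary within this image, up to a
multiple of `ω`. -/
theorem boundary (h : BlockPair D E p ω) (hex : ∀ z, E z = 0 → ∃ b, z = E b) {b : V}
    (hb : p (D b) = D b) : ∃ e f, p e = e ∧ p f = f ∧ D b = D f + ω • e := by
  have hk : E (b - p b) = 0 := by
    rw [h.right, map_sub D, map_sub p, hb, h.lower, sub_self]
  obtain ⟨c, hc⟩ := hex _ hk
  have e1 : p (E c) = 0 := by rw [← hc, map_sub, h.idem, sub_self]
  have e2 : D (p c) = 0 := by
    have := h.upper c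
    rw [map_sub, map_sub, e1, h.left, zero_sub, neg_eq_zero] at this
    exact this
  have e3 : p (E (p c)) = 0 := by rw [h.left, e2]
  have e4 := h.right c
  have e6 := h.homotopy (h.idem c)
  rw [e2, map_zero, map_zero, sub_self, sub_zero, e3, sub_zero] at e6
  refine ⟨p c, p b - p (D (c - p c)), h.idem c, by rw [map_sub, h.idem, h.idem], ?_⟩
  have e7 : b = p b - p (D (c - p c)) + E (p c) + D (c - p c) := by
    have : E c = E (p c) + E (c - p c) := by rw [← map_add, add_sub_cancel]
    rw [this, e4] at hc
    rw [← sub_eq_zero] at hc ⊢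
    rw [← hc]
    abel
  nth_rewrite 1 [e7]
  rw [map_add, map_add, h.sq, add_zero, e6]

end BlockPair

end BlockAlgebra

/-! ### Block pairs of matrices -/

section BlockMatrix

variable {R R' S T : Type*} [CommRing R] [CommRing R']

/-- The projection that keeps the coordinates in `P`. -/
def restrictTo (R' : Type*) [CommRing R'] (P : T → Prop) [DecidablePred P] :
    (T → R') →ₗ[R'] (T → R') where
  toFun z t := if P t then z t else 0
  map_add' a b := by
    funext t
    simp only [Pi.add_apply]
    split_ifs <;> simp
  map_smul' a b := by
    funext t
    simp only [Pi.smul_apply, RingHom.id_apply]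
    split_ifs <;> simp

theorem restrictTo_apply (P : T → Prop) [DecidablePred P] (z : T → R') (t : T) :
    restrictTo R' P z t = if P t then z t else 0 := rfl

variable [Fintype T]

/-- A pair of matrices with the vanishing and matching entries of a `BlockPair`, where the round trips
through the states outside of `P` add up to `ω`. -/
theorem blockPair_of_matrix [DecidableEq T] (D E : Matrix T T R') (P : T → Prop) [DecidablePred P] (ω : R')
    (h1 : ∀ y x, P x → ¬ P y → D y x = 0) (h2 : ∀ y x, ¬ P x → P y → E y x = 0)
    (h3 : ∀ y x, (P x ↔ P y) → E y x = D y x)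
    (hω : ∀ z x, P x → P z → ∑ y, (if P y then 0 else D z y * E y x) = if z = x then ω else 0)
    (hD : D * D = 0) (hE : E * E = 0) :
    BlockPair D.mulVecLin E.mulVecLin (restrictTo R' P) ω where
  idem z := by
    funext t
    simp only [restrictTo_apply]
    split_ifs <;> rfl
  lower z := by
    funext t
    simp only [restrictTo_apply, Matrix.mulVecLin_apply, Matrix.mulVec, dotProduct]
    split_ifs with h
    · rfl
    · refine (Finset.sum_eq_zero fun x _ => ?_).symm
      split_ifs with hx
      · rw [h1 t x hx h, zero_mul]
      · rw [mul_zero]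
  upper z := by
    funext t
    simp only [restrictTo_apply, Matrix.mulVecLin_apply, Matrix.mulVec, dotProduct, Pi.sub_apply,
      Pi.zero_apply]
    split_ifs with h
    · refine Finset.sum_eq_zero fun x _ => ?_
      split_ifs with hx
      · rw [sub_self, mul_zero]
      · rw [h2 t x hx h, zero_mul]
    · rfl
  left z := by
    funext t
    simp only [restrictTo_apply, Matrix.mulVecLin_apply, Matrix.mulVec, dotProduct]
    split_ifs with h
    · refine Finset.sum_congr rfl fun x _ => ?_
      split_ifs with hx
      · rw [h3 t x (iff_of_true hx h)]
      · rw [mul_zero, mul_zero]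
    · refine (Finset.sum_eq_zero fun x _ => ?_).symm
      split_ifs with hx
      · rw [h1 t x hx h, zero_mul]
      · rw [mul_zero]
  right z := by
    funext t
    simp only [restrictTo_apply, Matrix.mulVecLin_apply, Matrix.mulVec, dotProduct, Pi.sub_apply]
    split_ifs with h
    · rw [sub_self]
      refine Finset.sum_eq_zero fun x _ => ?_
      split_ifs with hx
      · rw [sub_self, mul_zero]
      · rw [h2 t x hx h, zero_mul]
    · rw [sub_zero]
      refine Finset.sum_congr rfl fun x _ => ?_
      split_ifs with hx
      · rw [sub_self, mul_zero, mul_zero]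
      · rw [h3 t x (iff_of_false hx h)]
  comp z := by
    funext t
    simp only [restrictTo_apply, Matrix.mulVecLin_apply, Matrix.mulVec, dotProduct, Pi.sub_apply,
      Pi.smul_apply]
    split_ifs with h
    · have e : ∀ y, D t y * (∑ x, E y x * (if P x then z x else 0) -
          if P y then ∑ x, E y x * (if P x then z x else 0) else 0) =
          ∑ x, (if P y then 0 else D t y * E y x) * if P x then z x else 0 := by
        intro y
        split_ifs with hy
        · simp
        · rw [sub_zero, Finset.mul_sum]
          exact Finset.sum_congr rfl fun x _ => by ring
      rw [Finset.sum_congr rfl fun y _ => e y, Finset.sum_comm, Finset.sum_eq_single t]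
      · rw [← Finset.sum_mul, hω t t h h, if_pos rfl, if_pos h, smul_eq_mul]
      · intro x _ hx
        rw [← Finset.sum_mul]
        split_ifs with hPx
        · rw [hω t x hPx h, if_neg hx.symm, zero_mul]
        · rw [mul_zero]
      · simp
    · rw [smul_zero]
  sq z := by rw [Matrix.mulVecLin_apply, Matrix.mulVecLin_apply, Matrix.mulVec_mulVec, hD,
    Matrix.zero_mulVec]
  sq' z := by rw [Matrix.mulVecLin_apply, Matrix.mulVecLin_apply, Matrix.mulVec_mulVec, hE,
    Matrix.zero_mulVec]

variable {e : S → T} {lam : R →+* R'} {P : T → Prop}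

omit [Fintype T] in
theorem extend_mem (hP : ∀ t, P t ↔ t ∈ Set.range e) [DecidablePred P]
    (a : S → R') : restrictTo R' P (Function.extend e a 0) = Function.extend e a 0 := by
  funext t
  rw [restrictTo_apply]
  split_ifs with h
  · rfl
  · rw [Function.extend_apply' _ _ _ fun ⟨s, hs⟩ => h ((hP t).mpr ⟨s, hs⟩), Pi.zero_apply]

omit [Fintype T] in
theorem eq_extend (he : Function.Injective e) (hP : ∀ t, P t ↔ t ∈ Set.range e) [DecidablePred P]
    {z : T → R'} (hz : restrictTo R' P z = z) : z = Function.extend e (z ∘ e) 0 := by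
  funext t
  by_cases h : P t
  · obtain ⟨s, rfl⟩ := (hP t).mp h
    rw [he.extend_apply, Function.comp_apply]
  · rw [Function.extend_apply' _ _ _ fun ⟨s, hs⟩ => h ((hP t).mpr ⟨s, hs⟩), Pi.zero_apply, ← hz,
      restrictTo_apply, if_neg h]

variable [Fintype S]

theorem mulVec_extend (he : Function.Injective e) (M : Matrix T T R') (a : S → R') (y : S) :
    M.mulVec (Function.extend e a 0) (e y) = ∑ x, M (e y) (e x) * a x := by
  refine (Fintype.sum_of_injective e he _ _ (fun t ht => ?_) fun s => ?_).symm
  · rw [Function.extend_apply' _ _ _ ht, Pi.zero_apply, mul_zero]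
  · rw [he.extend_apply]

/-- Extension of coefficients followed by extension by zero. -/
noncomputable def extendHom (e : S → T) (lam : R →+* R') : (S → R) →ₛₗ[lam] (T → R') where
  toFun a := Function.extend e (lam ∘ a) 0
  map_add' a b := by
    rw [← Function.extend_add, add_zero]
    congr 1
    funext s
    simp
  map_smul' r a := by
    rw [← Function.extend_smul, smul_zero]
    congr 1
    funext s
    simp

variable {D E : Matrix T T R'} {ω : R'} [DecidablePred P] {d : Matrix S S R}

/-- If the small operator is the block of `D` at the states `e`, extension by zero is a chain map. -/
theorem mulVec_extendHom (he : Function.Injective e) (hP : ∀ t, P t ↔ t ∈ Set.range e)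
    (h : BlockPair D.mulVecLin E.mulVecLin (restrictTo R' P) ω)
    (hd : ∀ y x, D (e y) (e x) = lam (d y x)) (a : S → R) :
    extendHom e lam (d.mulVec a) = D.mulVec (extendHom e lam a) := by
  have h1 := h.lower (extendHom e lam a)
  rw [show restrictTo R' P (extendHom e lam a) = extendHom e lam a from extend_mem hP _] at h1
  rw [Matrix.mulVecLin_apply] at h1
  rw [eq_extend he hP h1]
  change Function.extend e (lam ∘ d.mulVec a) 0 = _
  refine congrArg (fun g : S → R' => Function.extend e g (0 : T → R')) ?_
  funext y
  change _ = D.mulVec (Function.extend e (lam ∘ a) 0) (e y)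
  rw [mulVec_extend he]
  simp [Matrix.mulVec, dotProduct, hd]

variable {rho : R' →+* R} (hrho : ∀ p, rho (lam p) = p) (hdec : ∀ p, ∃ q, p = lam (rho p) + ω * q)
  (hω : rho ω = 0)

include hrho in
/-- The retraction `rho` turns the operator on the block into the small one. -/
theorem rho_mulVec (he : Function.Injective e) (hP : ∀ t, P t ↔ t ∈ Set.range e)
    (hd : ∀ y x, D (e y) (e x) = lam (d y x)) {z : T → R'} (hz : restrictTo R' P z = z) (y : S) :
    rho (D.mulVec z (e y)) = d.mulVec (fun s => rho (z (e s))) y := by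
  rw [eq_extend he hP hz, mulVec_extend he]
  simp [Matrix.mulVec, dotProduct, hd, hrho, he.extend_apply]

include hrho hω in
/-- A boundary that comes from the small complex bounds there: by `BlockPair.boundary` it does so modulo
`ω`, and the retraction `rho` kills `ω`. -/
theorem extendHom_injective_homology (he : Function.Injective e) (hP : ∀ t, P t ↔ t ∈ Set.range e)
    (h : BlockPair D.mulVecLin E.mulVecLin (restrictTo R' P) ω)
    (hd : ∀ y x, D (e y) (e x) = lam (d y x)) (hex : ∀ z, E.mulVec z = 0 → ∃ b, z = E.mulVec b)
    (z : S → R) (b : T → R') (hb : extendHom e lam z = D.mulVec b) : ∃ a, z = d.mulVec a := by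
  obtain ⟨g, f, -, hf, hD⟩ := h.boundary hex (b := b) (by
    rw [Matrix.mulVecLin_apply, ← hb]
    exact extend_mem hP _)
  refine ⟨fun s => rho (f (e s)), funext fun y => ?_⟩
  rw [← rho_mulVec hrho he hP hd hf]
  have h1 := congrArg rho (congrFun hD (e y))
  rw [Matrix.mulVecLin_apply, ← hb, Pi.add_apply, map_add, Pi.smul_apply, smul_eq_mul, map_mul, hω,
    zero_mul, add_zero] at h1
  rw [Matrix.mulVecLin_apply] at h1
  rw [← h1]
  change _ = rho (Function.extend e (lam ∘ z) 0 (e y))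
  rw [he.extend_apply, Function.comp_apply, hrho]

include hrho hdec hω in
/-- Every class comes from the small complex: modulo `ω` all coefficients come from the small ring, and
multiples of `ω` are removed by `BlockPair.homotopy`. -/
theorem extendHom_surjective_homology [IsDomain R'] (hω0 : ω ≠ 0) (he : Function.Injective e)
    (hP : ∀ t, P t ↔ t ∈ Set.range e)
    (h : BlockPair D.mulVecLin E.mulVecLin (restrictTo R' P) ω)
    (hd : ∀ y x, D (e y) (e x) = lam (d y x)) (hex : ∀ z, E.mulVec z = 0 → ∃ b, z = E.mulVec b)
    (z : T → R') (hz : D.mulVec z = 0) :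
    ∃ a b, d.mulVec a = 0 ∧ z = extendHom e lam a + D.mulVec b := by
  obtain ⟨i, b, c, hi, hb, hb0, hDi, hzi⟩ := h.cycle hex hz
  simp only [Matrix.mulVecLin_apply] at hb0 hDi hzi
  set a : S → R := fun s => rho (i (e s)) with ha
  have hda : d.mulVec a = 0 := by
    funext y
    rw [ha, ← rho_mulVec hrho he hP hd hi, hDi, Pi.neg_apply, map_neg, Pi.smul_apply, smul_eq_mul,
      map_mul, hω, zero_mul, neg_zero, Pi.zero_apply]
  choose q hq using fun s => hdec (i (e s))
  set j : T → R' := Function.extend e q 0 with hj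
  have hpj : restrictTo R' P j = j := extend_mem hP _
  have hij : i = extendHom e lam a + ω • j := by
    rw [eq_extend he hP hi]
    change _ = Function.extend e (lam ∘ a) 0 + ω • Function.extend e q 0
    rw [← Function.extend_smul, ← Function.extend_add, smul_zero, add_zero]
    congr 1
    funext s
    simp only [Function.comp_apply, Pi.add_apply, Pi.smul_apply, smul_eq_mul]
    exact hq s
  have hDj : D.mulVec j = -b := by
    have h1 := hDi
    rw [hij, Matrix.mulVec_add, ← mulVec_extendHom he hP h hd, hda, map_zero, zero_add,
      Matrix.mulVec_smul, ← smul_neg] at h1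
    exact smul_right_injective _ hω0 h1
  have hhom := h.homotopy hpj
  simp only [Matrix.mulVecLin_apply, hDj, map_neg] at hhom
  refine ⟨a, E.mulVec j - restrictTo R' P (E.mulVec j) + c, hda, ?_⟩
  rw [Matrix.mulVec_add, hhom, hzi, hij]
  abel

/-- The scalar `ω` kills the homology classes that come from the small complex. -/
theorem smul_extendHom_eq (he : Function.Injective e) (hP : ∀ t, P t ↔ t ∈ Set.range e)
    (h : BlockPair D.mulVecLin E.mulVecLin (restrictTo R' P) ω)
    (hd : ∀ y x, D (e y) (e x) = lam (d y x)) {a : S → R} (ha : d.mulVec a = 0) :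
    ∃ b, ω • extendHom e lam a = D.mulVec b := by
  have h1 := h.homotopy (z := extendHom e lam a) (extend_mem hP _)
  simp only [Matrix.mulVecLin_apply] at h1
  rw [← mulVec_extendHom he hP h hd, ha, map_zero, Matrix.mulVec_zero, map_zero, sub_zero,
    sub_zero] at h1
  exact ⟨_, h1.symm⟩

end BlockMatrix

/-! ### Weights around a lattice point -/

section Block

variable {N : ℕ} {A : Type*} [CommRing A]

theorem scal_eq_zero {u : Fin N → Fin N → A} {x : GridState N} {i j t q : Fin N} (v : A)
    (ht : InCyc i j t) (hq : InCyc (x i) (x j) q) (h : u t q = 0) : scal u v x i j = 0 := by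
  have h1 : ∏ q ∈ cyc (x i) (x j), u t q = 0 := Finset.prod_eq_zero (mem_cyc.mpr hq) h
  rw [scal, Finset.prod_eq_zero (mem_cyc.mpr ht) h1, zero_mul]

theorem scal_congr {u u' : Fin N → Fin N → A} {x : GridState N} {i j : Fin N} (v : A)
    (h : ∀ t q, InCyc i j t → InCyc (x i) (x j) q → u t q = u' t q) :
    scal u v x i j = scal u' v x i j := by
  rw [scal, scal]
  congr 1
  exact Finset.prod_congr rfl fun t ht => Finset.prod_congr rfl fun q hq =>
    h t q (mem_cyc.mp ht) (mem_cyc.mp hq)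

theorem rectMatrix_mul_swap {M : Type*} [Ring M] (w : GridState N → Fin N → Fin N → M)
    (x : GridState N) {i j : Fin N} (h : i ≠ j) :
    rectMatrix w (x * Equiv.swap i j) x = w x i j + w x j i := by
  have : rects x (x * Equiv.swap i j) = {(i, j), (j, i)} := by
    ext ⟨k, m⟩
    simp only [mem_rects, mul_right_inj, Finset.mem_insert, Finset.mem_singleton, Prod.mk.injEq]
    constructor
    · rintro ⟨hkm, e⟩
      have e1 := DFunLike.congr_fun e k
      rw [Equiv.swap_apply_left] at e1
      rcases eq_or_ne k i with rfl | hi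
      · rw [Equiv.swap_apply_left] at e1
        exact Or.inl ⟨rfl, e1⟩
      · rcases eq_or_ne k j with rfl | hj
        · rw [Equiv.swap_apply_right] at e1
          exact Or.inr ⟨rfl, e1⟩
        · rw [Equiv.swap_apply_of_ne_of_ne hi hj] at e1
          exact absurd e1.symm hkm
    · rintro (⟨rfl, rfl⟩ | ⟨rfl, rfl⟩)
      · exact ⟨h, rfl⟩
      · exact ⟨h.symm, Equiv.swap_comm _ _⟩
  rw [rectMatrix, this, Finset.sum_pair fun e => h (congrArg Prod.fst e)]

variable [NeZero N]

theorem not_inCyc_add_one_left (hN : N ≠ 1) (l j : Fin N) : ¬ InCyc (l + 1) j l := by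
  have h := NeZero.pos N
  have e : l - (l + 1) = -1 := by abel
  rw [InCyc, e, Fin.lt_def, not_lt]
  have : (j - (l + 1)).val < N := Fin.isLt _
  have h2 : (-1 : Fin N).val = N - 1 := by
    rw [Fin.val_neg', Fin.val_one', Nat.mod_eq_of_lt (by omega : 1 < N), Nat.mod_eq_of_lt (by omega)]
  omega

theorem inCyc_add_one_right (hN : N ≠ 1) {l i : Fin N} (h : i ≠ l + 1) : InCyc i (l + 1) l := by
  rw [← not_not (a := InCyc i (l + 1) l), ← inCyc_compl h]
  exact not_inCyc_add_one_left hN l i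

theorem inCyc_add_one_iff {l i j : Fin N} (hi : i ≠ l + 1) (hj : j ≠ l + 1) :
    InCyc i j (l + 1) ↔ InCyc i j l := by
  have h0 : l - i + 1 ≠ 0 := fun e => hi (by rw [← sub_eq_zero, ← neg_eq_zero, ← e]; abel)
  have h1 : j - i ≠ l - i + 1 := fun e => hj (by rw [← sub_eq_zero, ← sub_eq_zero.mpr e]; abel)
  have h2 : (l - i).val + 1 < N := by
    by_contra hc
    have hlt : (l - i).val < N := Fin.isLt _
    refine h0 (Fin.ext ?_)
    rw [Fin.val_add, Fin.val_one', Nat.add_mod_mod, show (l - i).val + 1 = N by omega, Nat.mod_self,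
      Fin.val_zero]
  have h3 : (l - i + 1).val = (l - i).val + 1 := by
    rw [Fin.val_add, Fin.val_one', Nat.add_mod_mod, Nat.mod_eq_of_lt h2]
  rw [Ne, Fin.ext_iff] at h1
  rw [InCyc, InCyc, show l + 1 - i = l - i + 1 by abel, Fin.lt_def, Fin.lt_def]
  omega

/-- The weight `w`, changed on the four squares around the lattice point `(l + 1, b + 1)`. -/
def blockWeight (l b : Fin N) (ne sw nw se : A) (w : Fin N → Fin N → A) (t q : Fin N) : A :=
  if t = l then if q = b then sw else if q = b + 1 then nw else w t q
  else if t = l + 1 then if q = b then se else if q = b + 1 then ne else w t q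
  else w t q

variable {l b : Fin N} {ne sw nw se : A} {w : Fin N → Fin N → A}

omit [CommRing A] in
theorem blockWeight_sw : blockWeight l b ne sw nw se w l b = sw := by simp [blockWeight]

omit [CommRing A] in
theorem blockWeight_ne (hN : N ≠ 1) : blockWeight l b ne sw nw se w (l + 1) (b + 1) = ne := by
  simp [blockWeight, (ne_add_one hN _).symm]

omit [CommRing A] in
theorem blockWeight_nw (hN : N ≠ 1) : blockWeight l b ne sw nw se w l (b + 1) = nw := by
  simp [blockWeight, (ne_add_one hN _).symm]

omit [CommRing A] in
theorem blockWeight_se (hN : N ≠ 1) : blockWeight l b ne sw nw se w (l + 1) b = se := by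
  simp [blockWeight, (ne_add_one hN _).symm]

omit [CommRing A] in
theorem blockWeight_col {t : Fin N} (h : t ≠ l) (h' : t ≠ l + 1) :
    blockWeight l b ne sw nw se w t = w t := by
  funext q
  simp [blockWeight, h, h']

omit [CommRing A] in
theorem blockWeight_row {q : Fin N} (h : q ≠ b) (h' : q ≠ b + 1) (t : Fin N) :
    blockWeight l b ne sw nw se w t q = w t q := by
  simp [blockWeight, h, h']

/-- Thin annuli on both sides of a circle: the sum over all annuli with a boundary on the circle `l + 1`
reduces to the two adjacent ones. -/
theorem sum_annuli (hN : 2 < N) {f : Fin N → A} (v : A) (hf : ∀ t, t ≠ l → t ≠ l + 1 → f t = 0) :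
    ∑ j, (if j = l + 1 then 0 else
      (∏ t ∈ cyc (l + 1) j, f t) * v ^ ((cyc (l + 1) j).card - 1) +
      (∏ t ∈ cyc j (l + 1), f t) * v ^ ((cyc j (l + 1)).card - 1)) = f (l + 1) + f l := by
  have hN1 : N ≠ 1 := by omega
  have h2 : l ≠ l + 1 + 1 := by
    intro e
    have : (1 + 1 : Fin N) = 0 := by
      rw [← sub_eq_zero.mpr e.symm]
      abel
    have := congrArg Fin.val this
    rw [Fin.val_add, Fin.val_one', Nat.mod_eq_of_lt (by omega : 1 < N), Nat.mod_eq_of_lt hN] at this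
    simp at this
  have e1 : ∀ j, j ≠ l + 1 → (∏ t ∈ cyc (l + 1) j, f t) * v ^ ((cyc (l + 1) j).card - 1) =
      if j = l + 1 + 1 then f (l + 1) else 0 := by
    intro j hj
    split_ifs with h
    · subst h
      rw [cyc_succ hj.symm]
      simp
    · rw [Finset.prod_eq_zero (succ_mem_cyc hj.symm h), zero_mul]
      exact hf _ h2.symm (ne_add_one hN1 _).symm
  have e2 : ∀ j, j ≠ l + 1 → (∏ t ∈ cyc j (l + 1), f t) * v ^ ((cyc j (l + 1)).card - 1) =
      if j = l then f l else 0 := by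
    intro j hj
    split_ifs with h
    · subst h
      rw [cyc_succ hj]
      simp
    · rw [Finset.prod_eq_zero (left_mem_cyc hj) (hf _ h hj), zero_mul]
  have e3 : ∀ j, (if j = l + 1 then 0 else
      (∏ t ∈ cyc (l + 1) j, f t) * v ^ ((cyc (l + 1) j).card - 1) +
      (∏ t ∈ cyc j (l + 1), f t) * v ^ ((cyc j (l + 1)).card - 1)) =
      (if j = l + 1 + 1 then f (l + 1) else 0) + if j = l then f l else 0 := by
    intro j
    by_cases h : j = l + 1
    · simp [h, ne_add_one hN1 (l + 1), (ne_add_one hN1 l).symm]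
    · rw [if_neg h, e1 j h, e2 j h]
  rw [Finset.sum_congr rfl fun j _ => e3 j, Finset.sum_add_distrib]
  simp

/-- The scalar `ω` of a block: the sum of the products of the weights in the four annuli that meet it. -/
def annulusSum (l b : Fin N) (u : Fin N → Fin N → A) : A :=
  (∏ q, u (l + 1) q + ∏ q, u l q) + (∏ t, u t (b + 1) + ∏ t, u t b)

variable {v : A}

/-- The round trips from a state through the lattice point `(l + 1, b + 1)` sweep out the annuli with a
boundary circle through this point; only the four thin ones count. -/
theorem sum_round_trips (hN : 2 < N) {u : Fin N → Fin N → A}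
    (hcol : ∀ t, t ≠ l → t ≠ l + 1 → ∏ q, u t q = 0) (hrow : ∀ q, q ≠ b → q ≠ b + 1 → ∏ t, u t q = 0)
    {x : GridState N} (hx : x (l + 1) = b + 1) :
    ∑ j, (if j = l + 1 then 0 else
      (scal u v (x * Equiv.swap (l + 1) j) (l + 1) j + scal u v (x * Equiv.swap (l + 1) j) j (l + 1)) *
      (scal u v x (l + 1) j + scal u v x j (l + 1))) = annulusSum l b u := by
  rw [annulusSum, ← sum_annuli hN v hcol, ← sum_annuli hN v hrow,
    ← Equiv.sum_comp x fun q => (if q = b + 1 then 0 else _ : A), ← Finset.sum_add_distrib]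
  refine Finset.sum_congr rfl fun j _ => ?_
  have hxj : x j = b + 1 ↔ j = l + 1 := by rw [← hx, x.injective.eq_iff]
  by_cases h : j = l + 1
  · simp [h, hx]
  · have h' := mt hxj.mp h
    rw [if_neg h, if_neg h, if_neg h', ← scal_mul_scal_col u v x (Ne.symm h),
      ← scal_mul_scal_col u v x h, ← hx, ← scal_mul_scal_row u v x (Ne.symm h),
      ← scal_mul_scal_row u v x h, Equiv.swap_comm j (l + 1)]
    ring

end Block

/-! ### Rectangles with a corner in the middle of a block -/

section BlockPair

variable {N : ℕ} [NeZero N] {A : Type*} [CommRing A] {l b : Fin N} {ne sw nw se : A}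
  {w : Fin N → Fin N → A} {v : A} {x : GridState N} {i j : Fin N}

theorem scal_blockWeight_congr {ne' sw' nw' se' : A}
    (h1 : InCyc i j (l + 1) → InCyc (x i) (x j) (b + 1) → ne = ne')
    (h2 : InCyc i j l → InCyc (x i) (x j) b → sw = sw')
    (h3 : InCyc i j l → InCyc (x i) (x j) (b + 1) → nw = nw')
    (h4 : InCyc i j (l + 1) → InCyc (x i) (x j) b → se = se') :
    scal (blockWeight l b ne sw nw se w) v x i j =
      scal (blockWeight l b ne' sw' nw' se' w) v x i j := by
  refine scal_congr v fun t q ht hq => ?_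
  rw [blockWeight, blockWeight]
  split_ifs with e1 e2 e3 e4 e5 e6 <;> subst_vars
  exacts [h2 ht hq, h3 ht hq, rfl, h4 ht hq, h1 ht hq, rfl, rfl]

section Corners

variable (hN : N ≠ 1) (hij : i ≠ j)

omit [NeZero N] in
theorem mul_swap_apply_of_ne {c : Fin N} (hi : i ≠ c) (hj : j ≠ c) : (x * Equiv.swap i j) c = x c := by
  rw [Equiv.Perm.mul_apply, Equiv.swap_apply_of_ne_of_ne hi.symm hj.symm]

include hij in
/-- A rectangle between two states through the lattice point does not have it as a corner, so
contains either all or none of the four squares around it. -/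
theorem corner_inner (hx : x (l + 1) = b + 1) (hy : (x * Equiv.swap i j) (l + 1) = b + 1) :
    (InCyc i j (l + 1) ↔ InCyc i j l) ∧ (InCyc (x i) (x j) (b + 1) ↔ InCyc (x i) (x j) b) := by
  have hi : i ≠ l + 1 := by
    rintro rfl
    rw [Equiv.Perm.mul_apply, Equiv.swap_apply_left, ← hx, x.injective.eq_iff] at hy
    exact hij hy.symm
  have hj : j ≠ l + 1 := by
    rintro rfl
    rw [Equiv.Perm.mul_apply, Equiv.swap_apply_right, ← hx, x.injective.eq_iff] at hy
    exact hij hy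
  exact ⟨inCyc_add_one_iff hi hj, inCyc_add_one_iff (hx ▸ x.injective.ne hi) (hx ▸ x.injective.ne hj)⟩

theorem corner_outer (hx : x (l + 1) ≠ b + 1) (hy : (x * Equiv.swap i j) (l + 1) ≠ b + 1) :
    (InCyc i j (l + 1) ↔ InCyc i j l) ∨ (InCyc (x i) (x j) (b + 1) ↔ InCyc (x i) (x j) b) := by
  rw [Equiv.Perm.mul_apply] at hy
  by_cases hi : i = l + 1
  · subst hi
    rw [Equiv.swap_apply_left] at hy
    exact Or.inr (inCyc_add_one_iff hx hy)
  · by_cases hj : j = l + 1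
    · subst hj
      rw [Equiv.swap_apply_right] at hy
      exact Or.inr (inCyc_add_one_iff hy hx)
    · exact Or.inl (inCyc_add_one_iff hi hj)

include hN hij in
/-- A rectangle that leaves the lattice point contains its north-east or its south-west square. -/
theorem corner_leave (hx : x (l + 1) = b + 1) (hy : (x * Equiv.swap i j) (l + 1) ≠ b + 1) :
    (InCyc i j (l + 1) ∧ ¬ InCyc i j l ∧ InCyc (x i) (x j) (b + 1) ∧ ¬ InCyc (x i) (x j) b) ∨
    (¬ InCyc i j (l + 1) ∧ InCyc i j l ∧ ¬ InCyc (x i) (x j) (b + 1) ∧ InCyc (x i) (x j) b) := by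
  have hxij := x.injective.ne hij
  by_cases hi : i = l + 1
  · subst hi
    rw [hx] at hxij ⊢
    exact Or.inl ⟨inCyc_left hij, not_inCyc_add_one_left hN _ _, inCyc_left hxij,
      not_inCyc_add_one_left hN _ _⟩
  · by_cases hj : j = l + 1
    · subst hj
      rw [hx] at hxij ⊢
      exact Or.inr ⟨not_inCyc_right _ _, inCyc_add_one_right hN hij, not_inCyc_right _ _,
        inCyc_add_one_right hN hxij⟩
    · rw [mul_swap_apply_of_ne hi hj] at hy
      exact absurd hx hy

include hN hij in
/-- A rectangle that arrives at the lattice point contains its south-east or its north-west square. -/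
theorem corner_arrive (hx : x (l + 1) ≠ b + 1) (hy : (x * Equiv.swap i j) (l + 1) = b + 1) :
    (InCyc i j (l + 1) ∧ ¬ InCyc i j l ∧ ¬ InCyc (x i) (x j) (b + 1) ∧ InCyc (x i) (x j) b) ∨
    (¬ InCyc i j (l + 1) ∧ InCyc i j l ∧ InCyc (x i) (x j) (b + 1) ∧ ¬ InCyc (x i) (x j) b) := by
  have hxij := x.injective.ne hij
  rw [Equiv.Perm.mul_apply] at hy
  by_cases hi : i = l + 1
  · subst hi
    rw [Equiv.swap_apply_left] at hy
    rw [hy] at hxij ⊢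
    exact Or.inl ⟨inCyc_left hij, not_inCyc_add_one_left hN _ _, not_inCyc_right _ _,
      inCyc_add_one_right hN hxij⟩
  · by_cases hj : j = l + 1
    · subst hj
      rw [Equiv.swap_apply_right] at hy
      rw [hy] at hxij ⊢
      exact Or.inr ⟨not_inCyc_right _ _, inCyc_add_one_right hN hij, inCyc_left hxij,
        not_inCyc_add_one_left hN _ _⟩
    · rw [Equiv.swap_apply_of_ne_of_ne (Ne.symm hi) (Ne.symm hj)] at hy
      exact absurd hy hx

end Corners

omit [NeZero N] in
/-- After a step away from the point `(c, q)`, only the opposite transposition leads back to it: the point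
in the row `q` has to return. -/
theorem eq_of_return {c q : Fin N} (hx : x c = q) {k : Fin N} (hk : k ≠ c)
    (hz : (x * Equiv.swap c k * Equiv.swap i j) c = q) :
    x * Equiv.swap c k * Equiv.swap i j = x := by
  have hs : ∀ m, (x * Equiv.swap c k) m = q ↔ m = k := by
    intro m
    rw [← hx, Equiv.Perm.mul_apply, x.injective.eq_iff, Equiv.swap_apply_eq_iff,
      Equiv.swap_apply_left]
  rw [Equiv.Perm.mul_apply, hs] at hz
  have hsw : Equiv.swap i j = Equiv.swap c k := by
    by_cases h1 : c = i
    · rw [← h1, Equiv.swap_apply_left] at hz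
      rw [← h1, hz]
    · by_cases h2 : c = j
      · rw [← h2, Equiv.swap_apply_right] at hz
        rw [← h2, hz, Equiv.swap_comm]
      · rw [Equiv.swap_apply_of_ne_of_ne h1 h2] at hz
        exact absurd hz.symm hk
  rw [hsw, mul_assoc, Equiv.swap_mul_self, mul_one]

set_option maxHeartbeats 1000000 in
/-- The count with blocked north-east and south-west squares maps the states through the middle of the
block to themselves, and the count with blocked north-west and south-east squares does so with the other
states. Both agree on rectangles that keep the middle of the block, and their off-diagonal composite
consists of round trips. -/
theorem blockPair_rectMatrix (hN : 2 < N) (hcol : ∀ t, t ≠ l → t ≠ l + 1 → ∏ q, w t q = 0)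
    (hrow : ∀ q, q ≠ b → q ≠ b + 1 → ∏ t, w t q = 0)
    (hD : rectMatrix (scal (blockWeight l b 0 0 nw se w) v) *
      rectMatrix (scal (blockWeight l b 0 0 nw se w) v) = 0)
    (hE : rectMatrix (scal (blockWeight l b ne sw 0 0 w) v) *
      rectMatrix (scal (blockWeight l b ne sw 0 0 w) v) = 0) :
    BlockPair (rectMatrix (scal (blockWeight l b 0 0 nw se w) v)).mulVecLin
      (rectMatrix (scal (blockWeight l b ne sw 0 0 w) v)).mulVecLin
      (restrictTo A fun x : GridState N => x (l + 1) = b + 1)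
      (annulusSum l b (blockWeight l b ne sw nw se w)) := by
  have hN1 : N ≠ 1 := by omega
  have hcol' : ∀ t, t ≠ l → t ≠ l + 1 → ∏ q, blockWeight l b ne sw nw se w t q = 0 := by
    intro t h h'
    rw [blockWeight_col h h', hcol t h h']
  have hrow' : ∀ q, q ≠ b → q ≠ b + 1 → ∏ t, blockWeight l b ne sw nw se w t q = 0 := by
    intro q h h'
    rw [Finset.prod_congr rfl fun t _ => blockWeight_row h h' t, hrow q h h']
  refine blockPair_of_matrix _ _ _ _ ?_ ?_ ?_ ?_ hD hE
  · intro y x hx hy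
    refine Finset.sum_eq_zero fun p hp => ?_
    obtain ⟨hne, rfl⟩ := mem_rects.mp hp
    rcases corner_leave hN1 hne hx hy with ⟨h1, -, h2, -⟩ | ⟨-, h1, -, h2⟩
    · exact scal_eq_zero v h1 h2 (blockWeight_ne hN1)
    · exact scal_eq_zero v h1 h2 blockWeight_sw
  · intro y x hx hy
    refine Finset.sum_eq_zero fun p hp => ?_
    obtain ⟨hne, rfl⟩ := mem_rects.mp hp
    rcases corner_arrive hN1 hne hx hy with ⟨h1, -, -, h2⟩ | ⟨-, h1, h2, -⟩
    · exact scal_eq_zero v h1 h2 (blockWeight_se hN1)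
    · exact scal_eq_zero v h1 h2 (blockWeight_nw hN1)
  · intro y x hxy
    refine Finset.sum_congr rfl fun p hp => ?_
    obtain ⟨hne, rfl⟩ := mem_rects.mp hp
    have key : (InCyc p.1 p.2 (l + 1) ↔ InCyc p.1 p.2 l) ∨
        (InCyc (x p.1) (x p.2) (b + 1) ↔ InCyc (x p.1) (x p.2) b) := by
      by_cases hx : x (l + 1) = b + 1
      · exact Or.inl (corner_inner hne hx (hxy.mp hx)).1
      · exact corner_outer hx (mt hxy.mpr hx)
    by_cases hc : (InCyc p.1 p.2 (l + 1) ∨ InCyc p.1 p.2 l) ∧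
        (InCyc (x p.1) (x p.2) (b + 1) ∨ InCyc (x p.1) (x p.2) b)
    · have hE0 : scal (blockWeight l b ne sw 0 0 w) v x p.1 p.2 = 0 := by
        have : (InCyc p.1 p.2 (l + 1) ∧ InCyc (x p.1) (x p.2) b) ∨
            (InCyc p.1 p.2 l ∧ InCyc (x p.1) (x p.2) (b + 1)) := by tauto
        rcases this with ⟨h1, h2⟩ | ⟨h1, h2⟩
        · exact scal_eq_zero v h1 h2 (blockWeight_se hN1)
        · exact scal_eq_zero v h1 h2 (blockWeight_nw hN1)
      have hD0 : scal (blockWeight l b 0 0 nw se w) v x p.1 p.2 = 0 := by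
        have : (InCyc p.1 p.2 (l + 1) ∧ InCyc (x p.1) (x p.2) (b + 1)) ∨
            (InCyc p.1 p.2 l ∧ InCyc (x p.1) (x p.2) b) := by tauto
        rcases this with ⟨h1, h2⟩ | ⟨h1, h2⟩
        · exact scal_eq_zero v h1 h2 (blockWeight_ne hN1)
        · exact scal_eq_zero v h1 h2 blockWeight_sw
      rw [hE0, hD0]
    · exact scal_blockWeight_congr (by tauto) (by tauto) (by tauto) (by tauto)
  · intro z x hx hz
    set D := rectMatrix (scal (blockWeight l b 0 0 nw se w) v) with hDdef
    set E := rectMatrix (scal (blockWeight l b ne sw 0 0 w) v) with hEdef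
    -- The states reached from `x` by moving its point at the centre of the block.
    have hsum : ∑ y : GridState N, (if y (l + 1) = b + 1 then 0 else D z y * E y x) =
        ∑ j : {j : Fin N // j ≠ l + 1}, D z (x * Equiv.swap (l + 1) j) * E (x * Equiv.swap (l + 1) j) x := by
      refine (Fintype.sum_of_injective (fun j : {j : Fin N // j ≠ l + 1} => x * Equiv.swap (l + 1) j)
        (fun j k e => ?_) _ _ (fun y hy => ?_) fun j => ?_).symm
      · have := DFunLike.congr_fun (mul_left_cancel e) (l + 1)
        rw [Equiv.swap_apply_left, Equiv.swap_apply_left] at this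
        exact Subtype.ext this
      · split_ifs with h
        · rfl
        · rw [show E y x = 0 from Finset.sum_eq_zero fun p hp => absurd ?_ hy, mul_zero]
          obtain ⟨hne, rfl⟩ := mem_rects.mp hp
          by_cases h1 : p.1 = l + 1
          · exact ⟨⟨p.2, h1 ▸ hne.symm⟩, congrArg (fun c => x * Equiv.swap c p.2) h1.symm⟩
          · by_cases h2 : p.2 = l + 1
            · exact ⟨⟨p.1, h1⟩, (congrArg (fun c => x * Equiv.swap c p.1) h2.symm).trans
              (by rw [Equiv.swap_comm])⟩
            · rw [mul_swap_apply_of_ne h1 h2] at h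
              exact absurd hx h
      · rw [if_neg]
        rw [Equiv.Perm.mul_apply, Equiv.swap_apply_left, ← hx, x.injective.eq_iff]
        exact j.2
    rw [hsum]
    split_ifs with hzx
    · subst hzx
      rw [← sum_round_trips (v := v) hN hcol' hrow' hx,
        Finset.sum_congr rfl (fun (j : Fin N) _ => ite_not (j = l + 1) _ _ |>.symm),
        ← Finset.sum_filter, Finset.sum_subtype (p := fun j => j ≠ l + 1) _ (by simp)]
      refine Finset.sum_congr rfl fun j _ => ?_
      have hj := j.2
      have hy : (z * Equiv.swap (l + 1) j.1) (l + 1) ≠ b + 1 := by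
        rw [Equiv.Perm.mul_apply, Equiv.swap_apply_left, ← hx, z.injective.ne_iff]
        exact hj
      have hback : z * Equiv.swap (l + 1) j.1 * Equiv.swap (l + 1) j.1 = z := by
        rw [mul_assoc, Equiv.swap_mul_self, mul_one]
      have hDz : D z (z * Equiv.swap (l + 1) j.1) =
          scal (blockWeight l b 0 0 nw se w) v (z * Equiv.swap (l + 1) j) (l + 1) j +
          scal (blockWeight l b 0 0 nw se w) v (z * Equiv.swap (l + 1) j) j (l + 1) := by
        have := rectMatrix_mul_swap (scal (blockWeight l b 0 0 nw se w) v)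
          (z * Equiv.swap (l + 1) j.1) (Ne.symm hj)
        rwa [hback] at this
      rw [hDz, hEdef, rectMatrix_mul_swap _ _ (Ne.symm hj)]
      have first : ∀ i k, i ≠ k → z * Equiv.swap i k = z * Equiv.swap (l + 1) j.1 →
          scal (blockWeight l b ne sw 0 0 w) v z i k =
          scal (blockWeight l b ne sw nw se w) v z i k := by
        intro i k hik e
        have := corner_leave hN1 hik hx (by rw [e]; exact hy)
        exact scal_blockWeight_congr (by tauto) (by tauto) (by tauto) (by tauto)
      have second : ∀ i k, i ≠ k → z * Equiv.swap (l + 1) j.1 * Equiv.swap i k = z →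
          scal (blockWeight l b 0 0 nw se w) v (z * Equiv.swap (l + 1) j.1) i k =
          scal (blockWeight l b ne sw nw se w) v (z * Equiv.swap (l + 1) j.1) i k := by
        intro i k hik e
        have := corner_arrive hN1 hik hy (by rw [e]; exact hx)
        exact scal_blockWeight_congr (by tauto) (by tauto) (by tauto) (by tauto)
      rw [first _ _ (Ne.symm hj) rfl, first _ _ hj (by rw [Equiv.swap_comm]),
        second _ _ (Ne.symm hj) hback, second _ _ hj (by rw [Equiv.swap_comm j.1, hback])]
    · refine Finset.sum_eq_zero fun j _ => ?_
      have hj := j.2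
      rw [show D z (x * Equiv.swap (l + 1) j.1) = 0 from Finset.sum_eq_zero fun p hp => ?_, zero_mul]
      obtain ⟨hne, rfl⟩ := mem_rects.mp hp
      exact absurd (eq_of_return hx hj hz) hzx

end BlockPair

/-! ### Blocks with an erased marking -/

section BlockAcyclic

open MvPolynomial

variable {N : ℕ} [NeZero N] {A : Type*} [CommRing A]

theorem map_blockWeight {B : Type*} [CommRing B] (f : A →+* B) (l b : Fin N) (ne sw nw se : A)
    (w : Fin N → Fin N → A) (t q : Fin N) : f (blockWeight l b ne sw nw se w t q) =
      blockWeight l b (f ne) (f sw) (f nw) (f se) (fun t q => f (w t q)) t q := by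
  simp only [blockWeight, apply_ite f]

namespace GridDiagram

omit [NeZero N] in
theorem map_squareWeight {B : Type*} [CommRing B] (G : GridDiagram N) (f : A →+* B) (V : Fin N → A)
    (t q : Fin N) : f (G.squareWeight V t q) = G.squareWeight (fun i => f (V i)) t q := by
  simp only [squareWeight, apply_ite f, map_zero, map_one]

/-- The `2 × 2` block of squares around the lattice point `(l + 1, b + 1)` contains `X`-markings in its
south-west and north-east squares and exactly one `O`-marking. -/
structure IsBlock (G : GridDiagram N) (l b : Fin N) : Prop where
  size : 2 < N
  X_sw : G.X l = b
  X_ne : G.X (l + 1) = b + 1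
  one_O : (G.O l = b + 1 ∧ G.O (l + 1) ≠ b) ∨ (G.O l ≠ b + 1 ∧ G.O (l + 1) = b)

variable {G : GridDiagram N} {l b : Fin N} (V : Fin N → A)

theorem blockWeight_squareWeight (hB : G.IsBlock l b) : blockWeight l b 0 0
    (G.squareWeight V l (b + 1)) (G.squareWeight V (l + 1) b) (G.squareWeight V) =
      G.squareWeight V := by
  funext t q
  rw [blockWeight]
  split_ifs with h1 h2 h3 h4 h5 h6
  · rw [h1, h2, squareWeight, if_pos hB.X_sw.symm]
  · rw [h1, h3]
  · rfl
  · rw [h4, h5]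
  · rw [h4, h6, squareWeight, if_pos hB.X_ne.symm]
  · rfl
  · rfl

/-- The blocked north-west and south-east squares meet all four annuli of the block, so that the
markings of the block are not needed. -/
theorem IsBlock.blockMatrix_sq (hB : G.IsBlock l b) (ne sw v : A) (h2 : (2 : A) = 0) :
    rectMatrix (scal (blockWeight l b ne sw 0 0 (G.squareWeight V)) v) *
      rectMatrix (scal (blockWeight l b ne sw 0 0 (G.squareWeight V)) v) = 0 := by
  have hN : N ≠ 1 := by have := hB.size; omega
  have hcol : ∀ t, ∏ q, blockWeight l b ne sw 0 0 (G.squareWeight V) t q = 0 := by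
    intro t
    by_cases h : t = l
    · exact Finset.prod_eq_zero (Finset.mem_univ (b + 1)) (h ▸ blockWeight_nw hN)
    by_cases h' : t = l + 1
    · exact Finset.prod_eq_zero (Finset.mem_univ b) (h' ▸ blockWeight_se hN)
    rw [blockWeight_col h h', prod_squareWeight_col]
  have hrow : ∀ q, ∏ t, blockWeight l b ne sw 0 0 (G.squareWeight V) t q = 0 := by
    intro q
    by_cases h : q = b
    · exact Finset.prod_eq_zero (Finset.mem_univ (l + 1)) (h ▸ blockWeight_se hN)
    by_cases h' : q = b + 1
    · exact Finset.prod_eq_zero (Finset.mem_univ l) (h' ▸ blockWeight_nw hN)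
    rw [Finset.prod_congr rfl fun t _ => blockWeight_row h h' t, prod_squareWeight_row]
  rw [scal_sq hN _ _ h2]
  · simp [hcol, hrow]
  · intro t; rw [hcol, mul_zero]
  · intro q; rw [hrow, mul_zero]

/-- If the `X`-marking in the north-east square is erased, the annuli through this square keep the weights
of their `O`-markings. -/
theorem IsBlock.annulusSum_ne (hB : G.IsBlock l b) : annulusSum l b (blockWeight l b 1 0
    (G.squareWeight V l (b + 1)) (G.squareWeight V (l + 1) b) (G.squareWeight V)) =
      V (l + 1) + V (G.O.symm (b + 1)) := by
  have hN : N ≠ 1 := by have := hB.size; omega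
  have hl := ne_add_one hN l
  have hb := ne_add_one hN b
  set u := blockWeight l b 1 0
    (G.squareWeight V l (b + 1)) (G.squareWeight V (l + 1) b) (G.squareWeight V) with hu
  have hsw : u l b = 0 := blockWeight_sw
  have hcol : ∀ q, u (l + 1) q = if q = G.O (l + 1) then V (l + 1) else 1 := by
    intro q
    have hO : G.O (l + 1) ≠ b + 1 := hB.X_ne ▸ G.disjoint (l + 1)
    by_cases h : q = b + 1
    · rw [h, hu, blockWeight_ne hN, if_neg hO.symm]
    · by_cases h' : q = b
      · rw [h', hu, blockWeight_se hN, squareWeight, if_neg (hB.X_ne ▸ hb)]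
      · rw [hu, blockWeight_row h' h, squareWeight, if_neg (hB.X_ne ▸ h)]
  have hrow : ∀ t, u t (b + 1) = if t = G.O.symm (b + 1) then V t else 1 := by
    intro t
    have hX : ∀ t, b + 1 = G.X t ↔ t = l + 1 := fun t => by
      rw [← hB.X_ne, G.X.injective.eq_iff, eq_comm]
    have hO : G.O (l + 1) ≠ b + 1 := hB.X_ne ▸ G.disjoint (l + 1)
    by_cases h : t = l + 1
    · rw [h, hu, blockWeight_ne hN, if_neg fun e => hO (by rw [e, Equiv.apply_symm_apply])]
    · have : u t (b + 1) = G.squareWeight V t (b + 1) := by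
        by_cases h' : t = l
        · rw [h', hu, blockWeight_nw hN]
        · rw [hu, blockWeight_col h' h]
      rw [this, squareWeight, if_neg (mt (hX t).mp h)]
      exact if_congr (by rw [Equiv.eq_symm_apply, eq_comm]) rfl rfl
  have hcol0 : ∏ q, u l q = 0 := Finset.prod_eq_zero (Finset.mem_univ b) hsw
  have hrow0 : ∏ t, u t b = 0 := Finset.prod_eq_zero (Finset.mem_univ l) hsw
  rw [annulusSum, hcol0, hrow0, Finset.prod_congr rfl fun q _ => hcol q,
    Finset.prod_congr rfl fun t _ => hrow t]
  simp

/-- The same for the `X`-marking in the south-west square. -/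
theorem IsBlock.annulusSum_sw (hB : G.IsBlock l b) : annulusSum l b (blockWeight l b 0 1
    (G.squareWeight V l (b + 1)) (G.squareWeight V (l + 1) b) (G.squareWeight V)) =
      V l + V (G.O.symm b) := by
  have hN : N ≠ 1 := by have := hB.size; omega
  have hl := ne_add_one hN l
  have hb := ne_add_one hN b
  set u := blockWeight l b 0 1
    (G.squareWeight V l (b + 1)) (G.squareWeight V (l + 1) b) (G.squareWeight V) with hu
  have hne : u (l + 1) (b + 1) = 0 := blockWeight_ne hN
  have hcol : ∀ q, u l q = if q = G.O l then V l else 1 := by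
    intro q
    have hO : G.O l ≠ b := hB.X_sw ▸ G.disjoint l
    by_cases h : q = b
    · rw [h, hu, blockWeight_sw, if_neg hO.symm]
    · by_cases h' : q = b + 1
      · rw [h', hu, blockWeight_nw hN, squareWeight, if_neg (hB.X_sw ▸ hb.symm)]
      · rw [hu, blockWeight_row h h', squareWeight, if_neg (hB.X_sw ▸ h)]
  have hrow : ∀ t, u t b = if t = G.O.symm b then V t else 1 := by
    intro t
    have hX : ∀ t, b = G.X t ↔ t = l := fun t => by
      rw [← hB.X_sw, G.X.injective.eq_iff, eq_comm]
    have hO : G.O l ≠ b := hB.X_sw ▸ G.disjoint l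
    by_cases h : t = l
    · rw [h, hu, blockWeight_sw, if_neg fun e => hO (by rw [e, Equiv.apply_symm_apply])]
    · have : u t b = G.squareWeight V t b := by
        by_cases h' : t = l + 1
        · rw [h', hu, blockWeight_se hN]
        · rw [hu, blockWeight_col h h']
      rw [this, squareWeight, if_neg (mt (hX t).mp h)]
      exact if_congr (by rw [Equiv.eq_symm_apply, eq_comm]) rfl rfl
  have hcol0 : ∏ q, u (l + 1) q = 0 := Finset.prod_eq_zero (Finset.mem_univ (b + 1)) hne
  have hrow0 : ∏ t, u t (b + 1) = 0 := Finset.prod_eq_zero (Finset.mem_univ (l + 1)) hne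
  rw [annulusSum, hcol0, hrow0, Finset.prod_congr rfl fun q _ => hcol q,
    Finset.prod_congr rfl fun t _ => hrow t]
  simp

/-- The degree of a square for the contraction argument: twice the number of `O`-markings minus four times
the number of `X`-markings, corrected by the change of the indicator of the lattice point in the
middle of the block. -/
def blockDegree (G : GridDiagram N) (l b t q : Fin N) : ℤ :=
  (if q = G.O t then 2 else 0) + (if q = G.X t then -4 else 0) +
    (((if t = l + 1 then if q = b + 1 then 4 else 0 else 0) +
      (if t = l then if q = b then 4 else 0 else 0)) -
    ((if t = l then if q = b + 1 then 4 else 0 else 0) +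
      (if t = l + 1 then if q = b then 4 else 0 else 0)))

omit [NeZero N] in
theorem sum_single_square (x : GridState N) (i j c r : Fin N) :
    ∑ t ∈ cyc i j, ∑ q ∈ cyc (x i) (x j), (if t = c then if q = r then (4 : ℤ) else 0 else 0) =
      if InCyc i j c ∧ InCyc (x i) (x j) r then 4 else 0 := by
  have : ∀ t, ∑ q ∈ cyc (x i) (x j), (if t = c then if q = r then (4 : ℤ) else 0 else 0) =
      if t = c then if InCyc (x i) (x j) r then 4 else 0 else 0 := by
    intro t
    by_cases h : t = c
    · simp [h, Finset.sum_ite_eq', mem_cyc]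
    · simp [h]
  rw [Finset.sum_congr rfl fun t _ => this t, Finset.sum_ite_eq', ite_and]
  simp only [mem_cyc]

/-- The function that controls the contraction of a block: `M_𝕆 - 2 M_𝕏`, corrected at the states
through the middle of the block such that the erased `X`-marking has degree `0` and the `O`-marking of
the block degree `-2`. -/
def blockHeight (G : GridDiagram N) (l b : Fin N) (x : GridState N) : ℤ :=
  maslovWrt G.O x - 2 * maslovWrt G.X x - if x (l + 1) = b + 1 then 4 else 0

theorem blockHeight_sub (hN : N ≠ 1) (x : GridState N) {i j : Fin N} (hij : i ≠ j) :
    -G.blockHeight l b x - -G.blockHeight l b (x * Equiv.swap i j) =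
      ∑ t ∈ cyc i j, ∑ q ∈ cyc (x i) (x j), G.blockDegree l b t q +
        interiorCount x (i, j) • (2 : ℤ) + 1 := by
  have h1 := maslovWrt_rect G.O x hij
  have h2 := maslovWrt_rect G.X x hij
  have h3 : (if x (l + 1) = b + 1 then (4 : ℤ) else 0) -
      (if (x * Equiv.swap i j) (l + 1) = b + 1 then 4 else 0) =
      ((if InCyc i j (l + 1) ∧ InCyc (x i) (x j) (b + 1) then (4 : ℤ) else 0) +
        if InCyc i j l ∧ InCyc (x i) (x j) b then 4 else 0) -
      ((if InCyc i j l ∧ InCyc (x i) (x j) (b + 1) then (4 : ℤ) else 0) +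
        if InCyc i j (l + 1) ∧ InCyc (x i) (x j) b then 4 else 0) := by
    by_cases hx : x (l + 1) = b + 1 <;> by_cases hy : (x * Equiv.swap i j) (l + 1) = b + 1
    all_goals simp only [hx, hy, if_true, if_false]
    · obtain ⟨e1, e2⟩ := corner_inner hij hx hy
      simp [e1, e2]
    · rcases corner_leave hN hij hx hy with ⟨e1, e2, e3, e4⟩ | ⟨e1, e2, e3, e4⟩ <;>
        simp [e1, e2, e3, e4]
    · rcases corner_arrive hN hij hx hy with ⟨e1, e2, e3, e4⟩ | ⟨e1, e2, e3, e4⟩ <;>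
        simp [e1, e2, e3, e4]
    · rcases corner_outer hx hy with e | e
      · simp [e]
      · simp only [e, sub_self]
        ring
  simp only [blockDegree, Finset.sum_add_distrib, Finset.sum_sub_distrib, sum_boole_mark,
    sum_single_square]
  rw [← h3, blockHeight, blockHeight]
  simp only [nsmul_eq_mul]
  linarith

theorem sum_annuli_eq (hN : N ≠ 1) {ne sw nw se : A} {w : Fin N → Fin N → A}
    (hcol : ∀ t, t ≠ l → t ≠ l + 1 → ∏ q, w t q = 0)
    (hrow : ∀ q, q ≠ b → q ≠ b + 1 → ∏ t, w t q = 0) :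
    (∑ t, ∏ q, blockWeight l b ne sw nw se w t q) + ∑ q, ∏ t, blockWeight l b ne sw nw se w t q =
      annulusSum l b (blockWeight l b ne sw nw se w) := by
  rw [annulusSum, Finset.sum_eq_add (l + 1) l (ne_add_one hN l).symm ?_ (by simp) (by simp),
    Finset.sum_eq_add (b + 1) b (ne_add_one hN b).symm ?_ (by simp) (by simp)]
  · intro q _ hq
    rw [Finset.prod_congr rfl fun t _ => blockWeight_row hq.2 hq.1 t, hrow q hq.2 hq.1]
  · intro t _ ht
    rw [blockWeight_col ht.2 ht.1, hcol t ht.2 ht.1]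

/-- With the weight `ε` on the `O`-marking of the block and all variables killed, only the thin annulus
through this marking and the erased `X`-marking has a weight. -/
theorem IsBlock.annulusSum_eps (hB : G.IsBlock l b) (ε : A) :
    annulusSum l b (blockWeight l b 1 0 (if G.O l = b + 1 then ε else 0)
      (if G.O (l + 1) = b then ε else 0) (G.squareWeight fun _ => (0 : A))) = ε := by
  have hN : N ≠ 1 := by have := hB.size; omega
  have hl := ne_add_one hN l
  have hb := ne_add_one hN b
  set u := blockWeight l b 1 0 (if G.O l = b + 1 then ε else 0)
      (if G.O (l + 1) = b then ε else 0) (G.squareWeight fun _ => (0 : A)) with hu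
  have hsw : u l b = 0 := blockWeight_sw
  have hne : u (l + 1) (b + 1) = 1 := blockWeight_ne hN
  have hnw : u l (b + 1) = if G.O l = b + 1 then ε else 0 := blockWeight_nw hN
  have hse : u (l + 1) b = if G.O (l + 1) = b then ε else 0 := blockWeight_se hN
  have hcol0 : ∏ q, u l q = 0 := Finset.prod_eq_zero (Finset.mem_univ b) hsw
  have hrow0 : ∏ t, u t b = 0 := Finset.prod_eq_zero (Finset.mem_univ l) hsw
  rw [annulusSum, hcol0, hrow0, add_zero, add_zero]
  rcases hB.one_O with ⟨h1, h2⟩ | ⟨h1, h2⟩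
  · rw [if_pos h1] at hnw
    rw [if_neg h2] at hse
    rw [Finset.prod_eq_zero (Finset.mem_univ b) hse, zero_add, Finset.prod_eq_single l, hnw]
    · intro t _ ht
      by_cases h : t = l + 1
      · rw [h, hne]
      · rw [hu, blockWeight_col ht h, squareWeight, if_neg, if_neg]
        · rw [← h1]; exact fun e => ht (G.O.injective e).symm
        · rw [← hB.X_ne]; exact fun e => h (G.X.injective e).symm
    · simp
  · rw [if_neg h1] at hnw
    rw [if_pos h2] at hse
    have hrow1 : ∏ t, u t (b + 1) = 0 := Finset.prod_eq_zero (Finset.mem_univ l) hnw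
    rw [hrow1, add_zero, Finset.prod_eq_single b, hse]
    · intro q _ hq
      by_cases h : q = b + 1
      · rw [h, hne]
      · rw [hu, blockWeight_row hq h, squareWeight, if_neg (hB.X_ne ▸ h), if_neg (h2 ▸ hq)]
    · simp

theorem IsBlock.blockWeight_homogeneous (hB : G.IsBlock l b) (t q : Fin N) :
    IsWeightedHomogeneous dualDegree (blockWeight l b 1 0
      (if G.O l = b + 1 then MvPolynomial.X none else 0)
      (if G.O (l + 1) = b then MvPolynomial.X none else 0)
      (G.squareWeight fun i => MvPolynomial.X (some (some i))) t q :
        MvPolynomial (Option (Option (Fin N))) (ZMod 2)) (G.blockDegree l b t q) := by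
  have hN : N ≠ 1 := by have := hB.size; omega
  have hl := ne_add_one hN l
  have hb := ne_add_one hN b
  have e1 := hB.X_sw
  have e2 := hB.X_ne
  rw [blockWeight]
  have hw : IsWeightedHomogeneous dualDegree
      (G.squareWeight (fun i => MvPolynomial.X (some (some i))) t q :
        MvPolynomial (Option (Option (Fin N))) (ZMod 2))
      ((if q = G.O t then 2 else 0) + if q = G.X t then -4 else 0) := by
    rw [squareWeight]
    split_ifs with h1 h2
    · exact isWeightedHomogeneous_zero _ _ _
    · exact isWeightedHomogeneous_zero _ _ _
    · exact isWeightedHomogeneous_X _ _ _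
    · exact isWeightedHomogeneous_one _ _
  by_cases h1 : t = l
  · rw [if_pos h1]
    by_cases h2 : q = b
    · rw [if_pos h2]
      exact isWeightedHomogeneous_zero _ _ _
    rw [if_neg h2]
    by_cases h3 : q = b + 1
    · rw [if_pos h3]
      split_ifs with h4
      · rw [show G.blockDegree l b t q = -2 by
          simp [blockDegree, h1, h3, h4, e1, hb.symm, hl]]
        exact isWeightedHomogeneous_X _ _ _
      · exact isWeightedHomogeneous_zero _ _ _
    · rw [if_neg h3]
      simpa [blockDegree, h1, h2, h3, hl] using h1 ▸ hw
  rw [if_neg h1]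
  by_cases h2 : t = l + 1
  · rw [if_pos h2]
    by_cases h3 : q = b
    · rw [if_pos h3]
      split_ifs with h4
      · rw [show G.blockDegree l b t q = -2 by
          simp [blockDegree, h2, h3, h4, e2, hb, hl.symm]]
        exact isWeightedHomogeneous_X _ _ _
      · exact isWeightedHomogeneous_zero _ _ _
    rw [if_neg h3]
    by_cases h4 : q = b + 1
    · have h5 : b + 1 ≠ G.O (l + 1) := e2 ▸ (G.disjoint (l + 1)).symm
      rw [if_pos h4, show G.blockDegree l b t q = 0 by
          simp [blockDegree, h2, h4, h5, e2, hb.symm, hl.symm]]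
      exact isWeightedHomogeneous_one _ _
    · rw [if_neg h4]
      simpa [blockDegree, h2, h3, h4, hl.symm] using h2 ▸ hw
  · rw [if_neg h2]
    simpa [blockDegree, h1, h2] using hw

/-- If the `X`-marking in the north-east square is erased and the other squares of the block are blocked,
the complex becomes acyclic: the rectangles through the `O`-marking of the block contract it. -/
theorem IsBlock.exact (hB : G.IsBlock l b) (z : GridState N → GridRing N)
    (hz : (rectMatrix (scal (blockWeight l b 1 0 0 0 (G.squareWeight fun i => MvPolynomial.X (some i)))
      (MvPolynomial.X none : GridRing N))).mulVec z = 0) :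
    ∃ c, z = (rectMatrix (scal (blockWeight l b 1 0 0 0
      (G.squareWeight fun i => MvPolynomial.X (some i)))
      (MvPolynomial.X none : GridRing N))).mulVec c := by
  have hN : N ≠ 1 := by have := hB.size; omega
  set W : Fin N → MvPolynomial (Option (Option (Fin N))) (ZMod 2) :=
    fun i => MvPolynomial.X (some (some i))
  set nw : MvPolynomial (Option (Option (Fin N))) (ZMod 2) :=
    if G.O l = b + 1 then MvPolynomial.X none else 0 with hnw
  set se : MvPolynomial (Option (Option (Fin N))) (ZMod 2) :=
    if G.O (l + 1) = b then MvPolynomial.X none else 0 with hse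
  set E := rectMatrix (scal (blockWeight l b 1 0 nw se (G.squareWeight W))
    (MvPolynomial.X (some none))) with hE
  have hdrop : E.map dropHom = rectMatrix (scal (blockWeight l b 1 0 0 0
      (G.squareWeight fun i => MvPolynomial.X (some i))) (MvPolynomial.X none : GridRing N)) := by
    rw [hE, map_rectMatrix_scal]
    simp only [map_blockWeight, map_squareWeight, hnw, hse, apply_ite dropHom]
    simp [dropHom, W]
  have hdual : E.map dualHom * E.map dualHom = (DualNumber.eps : DualNumber (ZMod 2)) • 1 := by
    have hv : dualHom (MvPolynomial.X (some none) : MvPolynomial (Option (Option (Fin N))) (ZMod 2)) =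
      0 := by simp [dualHom]
    have hW : ∀ i, dualHom (W i) = 0 := fun i => by simp [dualHom, W]
    have h2 : (2 : DualNumber (ZMod 2)) = 0 := TrivSqZeroExt.ext rfl rfl
    rw [hE, map_rectMatrix_scal, hv, scal_sq hN _ _ h2 (fun _ => zero_mul _) (fun _ => zero_mul _)]
    simp only [map_blockWeight, map_squareWeight, hW]
    congr 1
    rw [sum_annuli_eq hN (fun t _ _ => G.prod_squareWeight_col _ t)
      (fun q _ _ => G.prod_squareWeight_row _ q)]
    rw [← hB.annulusSum_eps DualNumber.eps, hnw, hse, apply_ite dualHom, apply_ite dualHom]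
    simp [dualHom]
  rw [← hdrop] at hz ⊢
  refine exists_eq_mulVec_of_dual E (G.blockHeight l b) ?_ ?_ hdual z hz
  · intro y x
    have := isWeightedHomogeneous_rectMatrix (w := dualDegree)
      (u := blockWeight l b 1 0 nw se (G.squareWeight W))
      (v := MvPolynomial.X (some none)) (δ := G.blockDegree l b) (δv := 2) ?_
      (isWeightedHomogeneous_X _ _ _) (fun x => -G.blockHeight l b x) 1
      (fun x i j h => blockHeight_sub hN x h) y x
    · rwa [show -G.blockHeight l b x - -G.blockHeight l b y - 1 =
        G.blockHeight l b y - G.blockHeight l b x - 1 by ring] at this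
    · exact hB.blockWeight_homogeneous
  · rw [hdrop]
    exact hB.blockMatrix_sq _ _ _ _ two_eq_zero

end GridDiagram

end BlockAcyclic

/-! ### Merging the columns and the rows of a block -/

section BlockRemoval

open MvPolynomial

variable {n : ℕ} {A : Type*} [CommRing A]

theorem exists_eq_of_ne {f : Fin n → Fin (n + 1)} (hf : Function.Injective f) {a : Fin (n + 1)}
    (ha : ∀ c, f c ≠ a) {t : Fin (n + 1)} (ht : t ≠ a) : ∃ c, f c = t := by
  have h1 : Finset.univ.image f ⊆ Finset.univ.erase a := fun s hs => by
    obtain ⟨c, -, rfl⟩ := Finset.mem_image.mp hs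
    exact Finset.mem_erase.mpr ⟨ha c, Finset.mem_univ _⟩
  have h2 : Finset.univ.image f = Finset.univ.erase a := Finset.eq_of_subset_of_card_le h1 (by
    rw [Finset.card_image_of_injective _ hf, Finset.card_erase_of_mem (Finset.mem_univ _)]
    simp)
  have h3 : t ∈ Finset.univ.image f := by
    rw [h2]
    exact Finset.mem_erase.mpr ⟨ht, Finset.mem_univ _⟩
  obtain ⟨c, -, hc⟩ := Finset.mem_image.mp h3
  exact ⟨c, hc⟩

theorem sum_eq_sum_add {M : Type*} [AddCommMonoid M] {f : Fin n → Fin (n + 1)}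
    (hf : Function.Injective f) {a : Fin (n + 1)} (ha : ∀ c, f c ≠ a) (g : Fin (n + 1) → M) :
    ∑ t, g t = ∑ c, g (f c) + g a := by
  have h : Finset.univ = insert a (Finset.univ.map ⟨f, hf⟩) := by
    ext t
    by_cases ht : t = a
    · simp [ht]
    · simpa [ht] using exists_eq_of_ne hf ha ht
  rw [h, Finset.sum_insert (by simpa using ha), Finset.sum_map, add_comm]
  rfl

namespace GridDiagram

/-- The diagram `G` arises from `G'` by merging the two columns and the two rows of the block of squares
around `(l + 1, b + 1)`.  The circles of `G` other than the two through this point are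
renumbered by `κ` and `η`, the squares by the retractions `π` and `ρ`.  The `O`-marking of `G`
in the column `c` becomes that of `G'` in the column `lam c`; the additional one, in the block, has
the column `a`. -/
structure IsBlockRemoval (G : GridDiagram n) (G' : GridDiagram (n + 1)) (l b a : Fin (n + 1))
    (κ η lam : Fin n → Fin (n + 1)) (π ρ : Fin (n + 1) → Fin n) : Prop where
  block : G'.IsBlock l b
  col : CycMap κ π
  row : CycMap η ρ
  col_ne : ∀ c, κ c ≠ l + 1
  row_ne : ∀ r, η r ≠ b + 1
  X_proj : ∀ t, ρ (G'.X t) = G.X (π t)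
  lam_ne : ∀ c, lam c ≠ a
  lam_proj : ∀ c, π (lam c) = c
  O_proj : ∀ c, ρ (G'.O (lam c)) = G.O c
  add : (a = l ∧ G'.O l = b + 1) ∨ (a = l + 1 ∧ G'.O (l + 1) = b)

namespace IsBlockRemoval

variable {G : GridDiagram n} {G' : GridDiagram (n + 1)} {l b a : Fin (n + 1)}
  {κ η lam : Fin n → Fin (n + 1)} {π ρ : Fin (n + 1) → Fin n}
  (S : G.IsBlockRemoval G' l b a κ η lam π ρ)

include S

theorem lam_injective : Function.Injective lam := Function.LeftInverse.injective S.lam_proj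

theorem col_proj {t : Fin (n + 1)} (h : t ≠ l + 1) : κ (π t) = t := by
  obtain ⟨c, rfl⟩ := exists_eq_of_ne S.col.injective S.col_ne h
  rw [S.col.retr]

theorem proj_add_one : π (l + 1) = π l := by
  by_contra h
  have h1 := inCyc_add_one_iff (S.col_ne (π l)) (S.col_ne (π (l + 1)))
  rw [S.col.inCyc, S.col.inCyc] at h1
  exact not_inCyc_right _ _ (h1.mpr (inCyc_left (Ne.symm h)))

theorem row_proj_add_one : ρ (b + 1) = ρ b := by
  rw [← S.block.X_ne, S.X_proj, S.proj_add_one, ← S.X_proj, S.block.X_sw]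

theorem O_add : ρ (G'.O a) = G.X (π a) := by
  rw [← S.X_proj]
  rcases S.add with ⟨h1, h2⟩ | ⟨h1, h2⟩
  · rw [h1, h2, S.block.X_sw, S.row_proj_add_one]
  · rw [h1, h2, S.block.X_ne, S.row_proj_add_one]

theorem row_proj {q : Fin (n + 1)} (h : q ≠ b + 1) : η (ρ q) = q := by
  obtain ⟨c, rfl⟩ := exists_eq_of_ne S.row.injective S.row_ne h
  rw [S.row.retr]

theorem embed_injective (x : GridState n) :
    Function.Injective fun t => if t = l + 1 then b + 1 else η (x (π t)) := by
  intro t s h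
  simp only at h
  split_ifs at h with h1 h2 h2
  · rw [h1, h2]
  · exact absurd h.symm (S.row_ne _)
  · exact absurd h (S.row_ne _)
  · rw [← S.col_proj h1, ← S.col_proj h2, x.injective (S.row.injective h)]

/-- The grid state of `G'` that extends a grid state of `G` by the point in the middle of the block. -/
noncomputable def embed (x : GridState n) : GridState (n + 1) :=
  Equiv.ofBijective _ (Finite.injective_iff_bijective.mp (S.embed_injective x))

theorem embed_centre (x : GridState n) : S.embed x (l + 1) = b + 1 := if_pos rfl

theorem embed_col (x : GridState n) (c : Fin n) : S.embed x (κ c) = η (x c) := by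
  refine (if_neg (S.col_ne c)).trans ?_
  rw [S.col.retr]

theorem eq_embed {x' : GridState (n + 1)} {x : GridState n} (h : x' (l + 1) = b + 1)
    (h' : ∀ c, ρ (x' (κ c)) = x c) : x' = S.embed x := by
  ext1 t
  by_cases ht : t = l + 1
  · rw [ht, h, embed_centre]
  · obtain ⟨c, rfl⟩ := exists_eq_of_ne S.col.injective S.col_ne ht
    rw [embed_col, ← h', S.row_proj]
    rw [← h]
    exact x'.injective.ne ht

theorem embed_inj : Function.Injective S.embed := by
  intro x y h
  ext1 c
  have := DFunLike.congr_fun h (κ c)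
  rw [embed_col, embed_col] at this
  exact S.row.injective this

theorem mem_range_embed (x' : GridState (n + 1)) : x' (l + 1) = b + 1 ↔ x' ∈ Set.range S.embed := by
  constructor
  · intro h
    have hinj : Function.Injective fun c => ρ (x' (κ c)) := by
      intro c d hcd
      have e : ∀ c, η (ρ (x' (κ c))) = x' (κ c) := fun c => S.row_proj (by
        rw [← h]
        exact x'.injective.ne (S.col_ne c))
      have := congrArg η hcd
      simp only [e] at this
      exact S.col.injective (x'.injective this)
    exact ⟨Equiv.ofBijective _ (Finite.injective_iff_bijective.mp hinj),
      (S.eq_embed h fun c => rfl).symm⟩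
  · rintro ⟨x, rfl⟩
    exact S.embed_centre x

theorem embed_mul_swap (x : GridState n) (i j : Fin n) :
    S.embed (x * Equiv.swap i j) = S.embed x * Equiv.swap (κ i) (κ j) := by
  refine (S.eq_embed ?_ fun c => ?_).symm
  · rw [mul_swap_apply_of_ne (S.col_ne i) (S.col_ne j), embed_centre]
  · rw [Equiv.Perm.mul_apply, Equiv.Perm.mul_apply, ← S.col.injective.map_swap, embed_col, S.row.retr]

/-- The box weights of `G'` in the coarse grid of `G` are the weights of `G`. The factor `v` of the
middle of the block does not matter, since it lies in a box with `X`-markings. -/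
theorem boxWeight_eq (V : Fin (n + 1) → A) (v : A) (x : GridState n) :
    boxWeight κ π ρ (G'.squareWeight V) v (S.embed x) = G.squareWeight fun c => V (lam c) := by
  funext i j
  rw [boxWeight, squareWeight]
  by_cases hX : j = G.X i
  · rw [if_pos hX]
    have h1 : ∏ q ∈ Finset.univ.filter (fun q => ρ q = j), G'.squareWeight V (κ i) q = 0 :=
      Finset.prod_eq_zero (i := G'.X (κ i)) (by simp [S.X_proj, S.col.retr, hX]) (if_pos rfl)
    rw [Finset.prod_eq_zero (i := κ i) (by simp [S.col.retr]) h1, zero_mul]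
  rw [if_neg hX]
  have hcard : (Finset.univ.filter fun t => (t ∉ Set.range κ ∧ π t = i) ∧
      ρ (S.embed x t) = j).card = 0 := by
    rw [Finset.card_eq_zero, Finset.filter_eq_empty_iff]
    rintro t - ⟨⟨h1, h2⟩, h3⟩
    have ht : t = l + 1 := by
      by_contra h
      obtain ⟨c, hc⟩ := exists_eq_of_ne S.col.injective S.col_ne h
      exact h1 ⟨c, hc⟩
    rw [ht, embed_centre, ← S.block.X_ne, S.X_proj, ← ht, h2] at h3
    exact hX h3.symm
  rw [hcard, pow_zero, mul_one]
  have hcol : ∀ t, π t = i → ∏ q ∈ Finset.univ.filter (fun q => ρ q = j), G'.squareWeight V t q =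
      if ρ (G'.O t) = j then V t else 1 := by
    intro t ht
    have h1 : ∀ q ∈ Finset.univ.filter (fun q => ρ q = j), G'.squareWeight V t q =
        if q = G'.O t then V t else 1 := by
      intro q hq
      refine if_neg fun e => hX ?_
      rw [Finset.mem_filter] at hq
      rw [← hq.2, e, S.X_proj, ht]
    rw [Finset.prod_congr rfl h1, Finset.prod_ite_eq']
    simp
  rw [Finset.prod_congr rfl fun t ht => hcol t (Finset.mem_filter.mp ht).2,
    Finset.prod_eq_single (lam i)]
  · exact if_congr (by rw [S.O_proj, eq_comm]) rfl rfl
  · intro t ht hne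
    rw [Finset.mem_filter] at ht
    refine if_neg fun e => ?_
    have hta : t = a := by
      by_contra h
      obtain ⟨c, rfl⟩ := exists_eq_of_ne S.lam_injective S.lam_ne h
      rw [S.lam_proj] at ht
      exact hne (by rw [ht.2])
    rw [hta, S.O_add, ← hta, ht.2] at e
    exact hX e.symm
  · simp [S.lam_proj]

/-- The differential of `G'` on the states through the middle of the block is that of `G`, with the
variables renumbered by `lam`. -/
theorem boundary_embed (V : Fin (n + 1) → A) (v : A) (y x : GridState n) :
    G'.boundary V v (S.embed y) (S.embed x) = G.boundary (fun c => V (lam c)) v y x := by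
  symm
  refine Finset.sum_nbij (fun p => (κ p.1, κ p.2)) (fun p hp => ?_) (fun p _ q _ h => ?_)
    (fun p hp => ?_) fun p hp => ?_
  · rw [mem_rects] at hp ⊢
    rw [← embed_mul_swap, hp.2]
    exact ⟨S.col.injective.ne hp.1, rfl⟩
  · rw [Prod.mk.injEq] at h
    exact Prod.ext (S.col.injective h.1) (S.col.injective h.2)
  · rw [Finset.mem_coe, mem_rects] at hp
    have hc : (S.embed x * Equiv.swap p.1 p.2) (l + 1) = b + 1 := by rw [hp.2, embed_centre]
    have h1 : p.1 ≠ l + 1 := by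
      intro e
      rw [Equiv.Perm.mul_apply, ← e, Equiv.swap_apply_left, ← S.embed_centre x,
        (S.embed x).injective.eq_iff] at hc
      exact hp.1 (e.trans hc.symm)
    have h2 : p.2 ≠ l + 1 := by
      intro e
      rw [Equiv.Perm.mul_apply, ← e, Equiv.swap_apply_right, ← S.embed_centre x,
        (S.embed x).injective.eq_iff] at hc
      exact hp.1 (hc.trans e.symm)
    refine ⟨(π p.1, π p.2), ?_, Prod.ext (S.col_proj h1) (S.col_proj h2)⟩
    rw [Finset.mem_coe, mem_rects]
    refine ⟨fun e => hp.1 ?_, S.embed_inj ?_⟩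
    · rw [← S.col_proj h1, ← S.col_proj h2]
      exact congrArg κ e
    · rw [embed_mul_swap, S.col_proj h1, S.col_proj h2, hp.2]
  · rw [scal_coarse S.col S.row _ v (S.embed x) x (S.embed_col x), S.boxWeight_eq]

end IsBlockRemoval

end GridDiagram

end BlockRemoval

/-! ### Invariance under the removal of a block -/

section BlockTheorem

open MvPolynomial

variable {n : ℕ}

namespace GridDiagram

namespace IsBlockRemoval

variable {G : GridDiagram n} {G' : GridDiagram (n + 1)} {l b a : Fin (n + 1)}
  {κ η lam : Fin n → Fin (n + 1)} {π ρ : Fin (n + 1) → Fin n}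
  (S : G.IsBlockRemoval G' l b a κ η lam π ρ)

include S

theorem row_proj_centre : ρ (b + 1) = G.X (π (l + 1)) := by rw [← S.block.X_ne, S.X_proj]

/-- The contribution of the middle of the block to the counts for a rectangle. -/
theorem interiorCount_embed (x : GridState n) (i j : Fin n) :
    interiorCount (S.embed x) (κ i, κ j) = interiorCount x (i, j) +
      if InCyc i j (π (l + 1)) ∧ InCyc (x i) (x j) (G.X (π (l + 1))) then 1 else 0 := by
  rw [interiorCount, interiorCount, Finset.card_filter, Finset.card_filter,
    sum_eq_sum_add S.col.injective S.col_ne]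
  congr 1
  · refine Finset.sum_congr rfl fun c _ => if_congr ?_ rfl rfl
    simp only [S.embed_col, S.col.inCyc, S.row.inCyc, S.col.retr, S.row.retr,
      S.col.injective.ne_iff, S.row.injective.ne_iff]
  · refine if_congr ?_ rfl rfl
    simp only [S.embed_col, S.embed_centre, S.col.inCyc, S.row.inCyc, S.row_proj_centre]
    have h1 := S.col_ne i
    have h2 := S.row_ne (x i)
    tauto

theorem markCount_X_embed (x : GridState n) (i j : Fin n) :
    markCount G'.X (S.embed x) (κ i) (κ j) = markCount G.X x i j +
      if InCyc i j (π (l + 1)) ∧ InCyc (x i) (x j) (G.X (π (l + 1))) then 1 else 0 := by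
  rw [markCount, markCount, Finset.card_filter, Finset.card_filter,
    sum_eq_sum_add S.col.injective S.col_ne]
  congr 1
  · refine Finset.sum_congr rfl fun c _ => if_congr ?_ rfl rfl
    simp only [S.embed_col, S.col.inCyc, S.row.inCyc, S.col.retr, S.X_proj]
  · refine if_congr ?_ rfl rfl
    simp only [S.embed_col, S.col.inCyc, S.row.inCyc, S.X_proj]

theorem markCount_O_embed (x : GridState n) (i j : Fin n) :
    markCount G'.O (S.embed x) (κ i) (κ j) = markCount G.O x i j +
      if InCyc i j (π (l + 1)) ∧ InCyc (x i) (x j) (G.X (π (l + 1))) then 1 else 0 := by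
  have ha : π a = π (l + 1) := by
    rcases S.add with h | h
    · rw [h.1, S.proj_add_one]
    · rw [h.1]
  rw [markCount, markCount, Finset.card_filter, Finset.card_filter,
    sum_eq_sum_add S.lam_injective S.lam_ne]
  congr 1
  · refine Finset.sum_congr rfl fun c _ => if_congr ?_ rfl rfl
    simp only [S.embed_col, S.col.inCyc, S.row.inCyc, S.lam_proj, S.O_proj]
  · refine if_congr ?_ rfl rfl
    simp only [S.embed_col, S.col.inCyc, S.row.inCyc, S.O_add, ha]

omit S in
/-- A function on the states that does not change under transpositions is constant. -/
theorem eq_of_mul_swap_eq {f : GridState n → ℤ} (h : ∀ x i j, i ≠ j → f (x * Equiv.swap i j) = f x)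
    (x y : GridState n) : f x = f y := by
  have key : ∀ σ : Equiv.Perm (Fin n), f σ = f 1 := by
    intro σ
    induction σ using Equiv.Perm.swap_induction_on' with
    | one => rfl
    | mul_swap σ i j hij ih => rw [h σ i j hij, ih]
  rw [key x, key y]

theorem lam_proj_of_ne {t : Fin (n + 1)} (h : t ≠ a) : lam (π t) = t := by
  obtain ⟨c, rfl⟩ := exists_eq_of_ne S.lam_injective S.lam_ne h
  rw [S.lam_proj]

theorem O_proj_of_ne {t : Fin (n + 1)} (h : t ≠ a) : ρ (G'.O t) = G.O (π t) := by
  rw [← S.O_proj, S.lam_proj_of_ne h]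

/-- The embedded state of the `O`-markings of `G` arises from that of the `O`-markings of `G'` by an
empty rectangle of width or height one with a single `O`-marking. -/
theorem exists_thin_rectangle : ∃ i j, i ≠ j ∧ G'.O * Equiv.swap i j = S.embed G.O ∧
    interiorCount G'.O (i, j) = 0 ∧ markCount G'.O G'.O i j = 1 := by
  have hN : n + 1 ≠ 1 := by have := S.block.size; omega
  have hl := ne_add_one hN l
  have hb := ne_add_one hN b
  have hthin : ∀ {c t : Fin (n + 1)}, InCyc c (c + 1) t ↔ t = c := fun {c t} => by
    rw [← mem_cyc, cyc_succ (ne_add_one hN c), Finset.mem_singleton]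
  rcases S.add with ⟨ha, hO⟩ | ⟨ha, hO⟩
  · have hO' : G'.O (l + 1) ≠ b + 1 := by
      rw [← hO]
      exact G'.O.injective.ne hl.symm
    refine ⟨l, l + 1, hl, S.eq_embed ?_ fun c => ?_, ?_, ?_⟩
    · simpa using hO
    · by_cases hc : κ c = l
      · rw [hc, Equiv.Perm.mul_apply, Equiv.swap_apply_left, S.O_proj_of_ne (by rw [ha]; exact hl.symm),
          S.proj_add_one, ← hc, S.col.retr]
      · rw [mul_swap_apply_of_ne (Ne.symm hc) (S.col_ne c).symm, S.O_proj_of_ne (by rwa [ha]),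
          S.col.retr]
    · rw [interiorCount, Finset.card_eq_zero, Finset.filter_eq_empty_iff]
      rintro t - ⟨⟨h1, h2⟩, -⟩
      exact h1 (hthin.mp h2)
    · rw [markCount, Finset.card_eq_one]
      refine ⟨l, ?_⟩
      ext t
      simp only [Finset.mem_filter, Finset.mem_univ, true_and, hthin, Finset.mem_singleton]
      refine ⟨fun h => h.1, ?_⟩
      rintro rfl
      rw [hO]
      exact ⟨rfl, inCyc_left hO'.symm⟩
  · set m := G'.O.symm (b + 1) with hm
    have hOm : G'.O m = b + 1 := by rw [hm, Equiv.apply_symm_apply]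
    have hml : m ≠ l + 1 := by
      intro e
      rw [e, hO] at hOm
      exact hb hOm
    refine ⟨l + 1, m, hml.symm, S.eq_embed ?_ fun c => ?_, ?_, ?_⟩
    · rw [Equiv.Perm.mul_apply, Equiv.swap_apply_left, hOm]
    · by_cases hc : κ c = m
      · rw [hc, Equiv.Perm.mul_apply, Equiv.swap_apply_right, hO, ← S.row_proj_add_one, ← hOm,
          S.O_proj_of_ne (by rwa [ha]), ← hc, S.col.retr]
      · rw [mul_swap_apply_of_ne (S.col_ne c).symm (Ne.symm hc),
          S.O_proj_of_ne (by rw [ha]; exact S.col_ne c), S.col.retr]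
    · rw [interiorCount, Finset.card_eq_zero, Finset.filter_eq_empty_iff]
      rintro t - ⟨-, h1, h2⟩
      rw [hO, hOm, hthin] at h2
      exact h1 (h2.trans hO.symm)
    · rw [markCount, Finset.card_eq_one]
      refine ⟨l + 1, ?_⟩
      ext t
      simp only [Finset.mem_filter, Finset.mem_univ, true_and, hO, hOm, hthin, Finset.mem_singleton]
      rw [← hO, G'.O.injective.eq_iff]
      refine ⟨fun h => h.2, ?_⟩
      rintro rfl
      exact ⟨inCyc_left hml.symm, rfl⟩

theorem maslov_O_embed (x : GridState n) : maslovWrt G'.O (S.embed x) = maslovWrt G.O x := by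
  have hconst := eq_of_mul_swap_eq (f := fun x => maslovWrt G'.O (S.embed x) - maslovWrt G.O x)
    (fun x i j hij => ?_) x G.O
  · -- The embedded state `O` differs from `G'.O` by one thin rectangle.
    obtain ⟨i, j, hij, he, h0, h1⟩ := S.exists_thin_rectangle
    have h2 := maslovWrt_rect G'.O G'.O hij
    rw [he, h0, h1, maslovWrt_self] at h2
    rw [maslovWrt_self] at hconst
    push_cast at h2
    linarith
  · have h1 := maslovWrt_rect G.O x hij
    have h2 := maslovWrt_rect G'.O (S.embed x) (S.col.injective.ne hij)
    rw [S.interiorCount_embed, S.markCount_O_embed, ← S.embed_mul_swap] at h2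
    push_cast at h2
    linarith

/-- The states of the `X`-markings correspond, since the north-east `X`-marking has its corner in the
middle of the block. -/
theorem maslov_X_embed (x : GridState n) : maslovWrt G'.X (S.embed x) = maslovWrt G.X x - 1 := by
  have hconst := eq_of_mul_swap_eq (f := fun x => maslovWrt G'.X (S.embed x) - maslovWrt G.X x)
    (fun x i j hij => ?_) x G.X
  · have he : G'.X = S.embed G.X := S.eq_embed S.block.X_ne fun c => by rw [S.X_proj, S.col.retr]
    rw [← he, maslovWrt_self, maslovWrt_self] at hconst
    push_cast at hconst
    linarith
  · have h1 := maslovWrt_rect G.X x hij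
    have h2 := maslovWrt_rect G'.X (S.embed x) (S.col.injective.ne hij)
    rw [S.interiorCount_embed, S.markCount_X_embed, ← S.embed_mul_swap] at h2
    push_cast at h2
    linarith

theorem bidegree_embed (x : GridState n) : G'.bidegree (S.embed x) = G.bidegree x := by
  rw [bidegree, bidegree, maslov, maslov, alexander, alexander, S.maslov_O_embed, S.maslov_X_embed]
  push_cast
  congr 1
  ring

omit S in
theorem dvd_sub_renameHom {m k : ℕ} (f : Fin m → Fin k) (g : Fin k → Fin m) {ω : GridRing k}
    (h : ∀ t, ω ∣ MvPolynomial.X (some t) - MvPolynomial.X (some (f (g t)))) (p : GridRing k) :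
    ω ∣ p - renameHom f (renameHom g p) := by
  induction p using MvPolynomial.induction_on with
  | C r => simp [renameHom]
  | add p q hp hq =>
    rw [map_add, map_add, add_sub_add_comm]
    exact dvd_add hp hq
  | mul_X p i hp =>
    rw [map_mul, map_mul, show ∀ p q r s : GridRing k, p * q - r * s = (p - r) * q + r * (q - s) by
      intros; ring]
    refine dvd_add (hp.mul_right _) (Dvd.dvd.mul_left ?_ _)
    cases i with
    | none => simp [renameHom]
    | some t => simpa [renameHom] using h t

/-- One of the two variables in `ω` is the additional one. -/
theorem exists_other : ∃ c, (MvPolynomial.X (some (l + 1)) + MvPolynomial.X (some (G'.O.symm (b + 1))) :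
    GridRing (n + 1)) = MvPolynomial.X (some a) + MvPolynomial.X (some (lam c)) := by
  have hN : n + 1 ≠ 1 := by have := S.block.size; omega
  rcases S.add with ⟨ha, hO⟩ | ⟨ha, hO⟩
  · refine ⟨π (l + 1), ?_⟩
    rw [S.lam_proj_of_ne (by rw [ha]; exact (ne_add_one hN l).symm), ← hO, Equiv.symm_apply_apply, ha]
    exact add_comm _ _
  · refine ⟨π (G'.O.symm (b + 1)), ?_⟩
    rw [S.lam_proj_of_ne, ha]
    rintro e
    rw [Equiv.symm_apply_eq, ha, hO] at e
    exact ne_add_one hN b e.symm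

/-- Removing a block with two `X`-markings does not change the homology, and on the homology the variables
of the `O`-markings in the two columns and in the two rows of the block act in the same way. -/
theorem gridIso : GridIso G G' lam ∧ ∀ h : G'.GH,
    (MvPolynomial.X (some (l + 1)) + MvPolynomial.X (some (G'.O.symm (b + 1))) :
      GridRing (n + 1)) • h = 0 ∧
    (MvPolynomial.X (some l) + MvPolynomial.X (some (G'.O.symm b)) : GridRing (n + 1)) • h = 0 := by
  set V : Fin (n + 1) → GridRing (n + 1) := fun i => MvPolynomial.X (some i) with hV
  set v : GridRing (n + 1) := MvPolynomial.X none with hv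
  set D := G'.boundary V v with hD
  have hDsq : D * D = 0 := G'.boundary_sq V v two_eq_zero
  have hDblock : D = rectMatrix (scal (blockWeight l b 0 0 (G'.squareWeight V l (b + 1))
      (G'.squareWeight V (l + 1) b) (G'.squareWeight V)) v) := by
    rw [blockWeight_squareWeight V S.block]
    rfl
  have hpair : ∀ ne sw : GridRing (n + 1), BlockPair D.mulVecLin
      (rectMatrix (scal (blockWeight l b ne sw 0 0 (G'.squareWeight V)) v)).mulVecLin
      (restrictTo _ fun x : GridState (n + 1) => x (l + 1) = b + 1) (annulusSum l b
        (blockWeight l b ne sw (G'.squareWeight V l (b + 1)) (G'.squareWeight V (l + 1) b)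
          (G'.squareWeight V))) := by
    intro ne sw
    rw [hDblock]
    refine blockPair_rectMatrix S.block.size (fun t _ _ => G'.prod_squareWeight_col V t)
      (fun q _ _ => G'.prod_squareWeight_row V q) ?_ (S.block.blockMatrix_sq V ne sw v two_eq_zero)
    rw [← hDblock, hDsq]
  have hNE := hpair 1 0
  have hSW := hpair 0 1
  rw [S.block.annulusSum_ne] at hNE
  rw [S.block.annulusSum_sw] at hSW
  have hP := S.mem_range_embed
  have hd : ∀ y x, D (S.embed y) (S.embed x) = renameHom lam
      (G.boundary (fun i => MvPolynomial.X (some i)) (MvPolynomial.X none) y x) := by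
    intro y x
    rw [hD, S.boundary_embed, ← Matrix.map_apply (f := renameHom lam), map_boundary]
    simp [renameHom, hV, hv]
  obtain ⟨c, hc⟩ := S.exists_other
  set ω : GridRing (n + 1) := V (l + 1) + V (G'.O.symm (b + 1)) with hω
  change ω = _ at hc
  -- The retraction that replaces the additional variable by the other variable of `ω`.
  set τ : Fin (n + 1) → Fin n := fun t => if t = a then c else π t with hτ
  have hτa : τ a = c := if_pos rfl
  have hτlam : ∀ k, τ (lam k) = k := fun k => (if_neg (S.lam_ne k)).trans (S.lam_proj k)
  have hrho : ∀ p, renameHom τ (renameHom lam p) = p := by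
    intro p
    have : Option.map τ ∘ Option.map lam = id := by
      funext i
      cases i <;> simp [hτlam]
    simp [renameHom, rename_rename, this]
  have hdec : ∀ p, ∃ q, p = renameHom lam (renameHom τ p) + ω * q := by
    intro p
    have ht : ∀ t, ω ∣ MvPolynomial.X (some t) - MvPolynomial.X (some (lam (τ t))) := by
      intro t
      by_cases ht : t = a
      · rw [ht, hτa, hc]
        refine ⟨1, ?_⟩
        linear_combination -MvPolynomial.X (some (lam c)) * two_eq_zero (ι := Option (Fin (n + 1)))
      · rw [show τ t = π t from if_neg ht, S.lam_proj_of_ne ht, sub_self]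
        exact dvd_zero _
    obtain ⟨q, hq⟩ := dvd_sub_renameHom lam τ ht p
    exact ⟨q, by rw [← hq]; ring⟩
  have hrω : renameHom τ ω = 0 := by
    rw [hc, map_add]
    simp only [renameHom, AlgHom.toRingHom_eq_coe, RingHom.coe_coe, rename_X, Option.map_some, hτa, hτlam]
    rw [← two_mul, two_eq_zero, zero_mul]
  have hω0 : ω ≠ 0 := by
    intro h
    rw [hc] at h
    have h1 : (MvPolynomial.X (some a) : GridRing (n + 1)) = MvPolynomial.X (some (lam c)) := by
      linear_combination h - MvPolynomial.X (some (lam c)) * two_eq_zero (ι := Option (Fin (n + 1)))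
    exact S.lam_ne c (Option.some.inj (MvPolynomial.X_injective h1)).symm
  have hsurj : ∀ z, G'.diff z = 0 → ∃ z' b', G.diff z' = 0 ∧
      z = extendHom S.embed (renameHom lam) z' + G'.diff b' := by
    intro z hz
    rw [diff_apply] at hz
    obtain ⟨z', b', h1, h2⟩ := extendHom_surjective_homology hrho hdec hrω hω0 S.embed_inj hP hNE hd
      S.block.exact z hz
    exact ⟨z', b', by rw [diff_apply, h1], by rw [diff_apply, h2]⟩
  refine ⟨GridIso.of_chainMap (extendHom S.embed (renameHom lam)) (fun z => ?_) G.diff_homogeneous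
    G'.diff_homogeneous (fun d s z hz => ?_) (fun z hz b' hb' => ?_) hsurj, fun h => ?_⟩
  · rw [diff_apply, diff_apply]
    exact mulVec_extendHom S.embed_inj hP hNE hd z
  · rw [homogeneousChain_iff] at hz ⊢
    intro x'
    change IsWeightedHomogeneous _ (Function.extend S.embed _ 0 x') _
    by_cases hx : x' ∈ Set.range S.embed
    · obtain ⟨x, rfl⟩ := hx
      rw [S.embed_inj.extend_apply, S.bidegree_embed]
      exact isWeightedHomogeneous_rename lam (hz x)
    · rw [Function.extend_apply' _ _ _ hx]
      exact isWeightedHomogeneous_zero _ _ _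
  · rw [diff_apply] at hb'
    obtain ⟨z', h⟩ := extendHom_injective_homology hrho hrω S.embed_inj hP hNE hd S.block.exact z b' hb'
    exact ⟨z', by rw [diff_apply, h]⟩
  · have key : ∀ {E : Matrix (GridState (n + 1)) (GridState (n + 1)) (GridRing (n + 1))}
        {ω' : GridRing (n + 1)}, BlockPair D.mulVecLin E.mulVecLin
          (restrictTo _ fun x : GridState (n + 1) => x (l + 1) = b + 1) ω' → ω' • h = 0 := by
      intro E ω' hE
      induction h using Submodule.Quotient.induction_on with | H z => ?_
      obtain ⟨z', b', h1, h2⟩ := hsurj z z.2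
      rw [diff_apply] at h1
      obtain ⟨c', hc'⟩ := smul_extendHom_eq S.embed_inj hP hE hd h1
      rw [← Submodule.Quotient.mk_smul, Submodule.Quotient.mk_eq_zero]
      refine ⟨c' + ω' • b', ?_⟩
      rw [map_add, map_smul, diff_apply, ← hc']
      change _ = ω' • (z : GC (n + 1))
      rw [h2, smul_add]
    exact ⟨key hNE, key hSW⟩

end IsBlockRemoval

end GridDiagram

end BlockTheorem

/-! ### Transfer elements of a commutation -/

section Commutation

variable {N : ℕ} [NeZero N] {A B : Type*} [CommRing A] [CommRing B]

/-- The transfer elements for the commutation of two adjacent columns with the weights `p` (left) and `k`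
(right).  The first index is the order before, the second one that after the commutation.  The two orders
are linked at the upper square `g + 1` of the pair of markings in the left column, and by `ε` at the
lower square `g`. -/
def pairUp (k p : Fin N → A) (g : Fin N) (ε : A) (q : Fin N) : Matrix (Fin 2) (Fin 2) A :=
  !![k q, if q = g then ε else 0; if q = g + 1 then 1 else 0, p q]

/-- The adjugates of the elements `pairUp`. -/
def pairDown (k p : Fin N → A) (g : Fin N) (ε : A) (q : Fin N) : Matrix (Fin 2) (Fin 2) A :=
  !![p q, -(if q = g then ε else 0); -(if q = g + 1 then 1 else 0), k q]

variable {k p : Fin N → A} {g : Fin N} {ε : A}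

theorem pairDown_eq (q : Fin N) : pairDown k p g ε q = (pairUp k p g ε q).adjugate := by
  rw [pairUp, pairDown, Matrix.adjugate_fin_two_of]

theorem det_pairUp (hN : N ≠ 1) (q : Fin N) : (pairUp k p g ε q).det = k q * p q := by
  have := ne_add_one hN g
  rw [pairUp, Matrix.det_fin_two_of]
  split_ifs with h1 h2
  · exact absurd (h1.symm.trans h2) this
  all_goals ring

theorem pairUp_mul_pairDown (hN : N ≠ 1) (q : Fin N) : pairUp k p g ε q * pairDown k p g ε q =
    algebraMap A (Matrix (Fin 2) (Fin 2) A) (k q * p q) := by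
  rw [pairDown_eq, Matrix.mul_adjugate, det_pairUp hN, Algebra.algebraMap_eq_smul_one]

theorem pairDown_mul_pairUp (hN : N ≠ 1) (q : Fin N) : pairDown k p g ε q * pairUp k p g ε q =
    algebraMap A (Matrix (Fin 2) (Fin 2) A) (k q * p q) := by
  rw [pairDown_eq, Matrix.adjugate_mul, det_pairUp hN, Algebra.algebraMap_eq_smul_one]

theorem downPath_pairDown (q : Fin N) (m : ℕ) :
    downPath (pairDown k p g ε) q m = (upPath (pairUp k p g ε) q m).adjugate := by
  induction m generalizing q with
  | zero => exact Matrix.adjugate_one.symm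
  | succ m ih => rw [downPath, upPath, Matrix.adjugate_mul_distrib, ih, pairDown_eq]

theorem add_adjugate_fin_two (M : Matrix (Fin 2) (Fin 2) A) :
    M + M.adjugate = algebraMap A (Matrix (Fin 2) (Fin 2) A) M.trace := by
  ext i j
  rw [Matrix.adjugate_fin_two, Matrix.trace_fin_two, Matrix.algebraMap_matrix_apply]
  fin_cases i <;> fin_cases j <;> simp [add_comm]

/-- The trace of a full turn does not depend on the starting point, by cyclicity of the trace. -/
theorem trace_upPath_lap (R : Fin N → Matrix (Fin 2) (Fin 2) A) (q : Fin N) :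
    (upPath R (q + 1) N).trace = (upPath R q N).trace := by
  obtain ⟨m, hm⟩ := Nat.exists_eq_succ_of_ne_zero (NeZero.ne N)
  have h1 : ∀ k, k = m + 1 → upPath R q k = upPath R (q + 1) m * R q := by rintro _ rfl; rfl
  have h2 : ∀ k, k = m + 1 → upPath R (q + 1) k = R (q + 1 + Fin.ofNat N m) * upPath R (q + 1) m := by
    rintro _ rfl
    rw [upPath_add]
    simp [upPath]
  have h3 : ∀ k, k = N → q + Fin.ofNat N k = q := by
    rintro _ rfl
    exact add_ofNat_self q
  rw [h1 N hm, h2 N hm, add_one_add_ofNat, h3 _ hm.symm, Matrix.trace_mul_comm]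

theorem trace_upPath_const (R : Fin N → Matrix (Fin 2) (Fin 2) A) (q q' : Fin N) :
    (upPath R q N).trace = (upPath R q' N).trace := by
  have : ∀ m : ℕ, (upPath R (q' + Fin.ofNat N m) N).trace = (upPath R q' N).trace := by
    intro m
    induction m with
    | zero => rw [Fin.ofNat_zero, add_zero]
    | succ m ih => rw [← add_one_add_ofNat, add_right_comm, trace_upPath_lap, ih]
  rw [← this (q - q').val, add_ofNat_val_sub]

theorem upPath_pairUp (q : Fin N) (m : ℕ)
    (h : ∀ i < m, q + Fin.ofNat N i ≠ g ∧ q + Fin.ofNat N i ≠ g + 1) :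
    upPath (pairUp k p g ε) q m = !![∏ i ∈ Finset.range m, k (q + Fin.ofNat N i), 0; 0,
      ∏ i ∈ Finset.range m, p (q + Fin.ofNat N i)] := by
  induction m generalizing q with
  | zero => simp [upPath, Matrix.one_fin_two]
  | succ m ih =>
    have h0 := h 0 (Nat.succ_pos m)
    rw [Fin.ofNat_zero, add_zero] at h0
    rw [upPath, ih (q + 1) fun i hi => by rw [add_one_add_ofNat]; exact h (i + 1) (by omega), pairUp,
      if_neg h0.1, if_neg h0.2, Finset.prod_range_succ', Finset.prod_range_succ']
    simp only [add_one_add_ofNat, Fin.ofNat_zero, add_zero, Matrix.mul_fin_two, mul_zero, zero_mul,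
      zero_add]

@[to_additive]
theorem prod_range_add_ofNat {Γ : Type*} [CommMonoid Γ] (f : Fin N → Γ) (q : Fin N) :
    ∏ i ∈ Finset.range N, f (q + Fin.ofNat N i) = ∏ t, f t := by
  rw [← Equiv.prod_comp (Equiv.addLeft q) f, Finset.prod_range]
  exact Finset.prod_congr rfl fun i _ => by simp

/-- The trace of a full turn: the two diagonal paths vanish, since they pass an `X`-marking, and the
path through both links contributes `ε`. -/
theorem upPath_add_downPath_pairUp (hN : N ≠ 1) (hk : ∏ q, k q = 0) (hp : p g * p (g + 1) = 0)
    (h1 : ∀ q, q ≠ g → q ≠ g + 1 → p q = 1) (q : Fin N) :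
    upPath (pairUp k p g ε) q N + downPath (pairDown k p g ε) q N =
      algebraMap A (Matrix (Fin 2) (Fin 2) A) ε := by
  rw [downPath_pairDown, add_adjugate_fin_two, trace_upPath_const _ _ g]
  congr 1
  obtain ⟨m, hm⟩ : ∃ m, N = m + 2 := ⟨N - 2, by have := NeZero.ne N; omega⟩
  have hne : ∀ i < m, g + 1 + 1 + Fin.ofNat N i ≠ g ∧ g + 1 + 1 + Fin.ofNat N i ≠ g + 1 := by
    intro i hi
    have hv : (Fin.ofNat N (i + 1)).val = i + 1 := Nat.mod_eq_of_lt (by omega)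
    have hv' : (Fin.ofNat N (i + 1 + 1)).val = i + 1 + 1 := Nat.mod_eq_of_lt (by omega)
    constructor <;> intro e
    · rw [add_one_add_ofNat, add_one_add_ofNat, add_eq_left] at e
      rw [e, Fin.val_zero] at hv'
      omega
    · rw [add_one_add_ofNat, add_eq_left] at e
      rw [e, Fin.val_zero] at hv
      omega
  have h2 : ∀ n, n = m + 2 → upPath (pairUp k p g ε) g n =
      upPath (pairUp k p g ε) (g + 1 + 1) m * pairUp k p g ε (g + 1) * pairUp k p g ε g := by
    rintro _ rfl; rfl
  have hk' : (∏ i ∈ Finset.range m, k (g + 1 + 1 + Fin.ofNat N i)) * (k (g + 1) * k g) = 0 := by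
    rw [← hk, ← prod_range_add_ofNat k g]
    have : ∀ n, n = m + 2 → ∏ i ∈ Finset.range n, k (g + Fin.ofNat N i) =
        (∏ i ∈ Finset.range m, k (g + 1 + 1 + Fin.ofNat N i)) * (k (g + 1) * k g) := by
      rintro _ rfl
      rw [Finset.prod_range_succ', Finset.prod_range_succ']
      simp only [add_one_add_ofNat, Fin.ofNat_zero, add_zero, zero_add, mul_assoc]
      rw [← add_zero (g + 1), ← Fin.ofNat_zero, add_one_add_ofNat, zero_add]
    rw [this N hm]
  have hp' : ∏ i ∈ Finset.range m, p (g + 1 + 1 + Fin.ofNat N i) = 1 :=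
    Finset.prod_eq_one fun i hi => h1 _ (hne i (Finset.mem_range.mp hi)).1
      (hne i (Finset.mem_range.mp hi)).2
  have hg := ne_add_one hN g
  rw [h2 N hm, upPath_pairUp _ _ hne, hp', pairUp, pairUp, if_neg hg.symm, if_pos rfl, if_pos rfl,
    if_neg hg]
  simp only [Matrix.mul_fin_two, Matrix.trace_fin_two_of]
  linear_combination hk' + hp

end Commutation

section CommutationData

variable {N : ℕ} [NeZero N] {A B : Type*} [CommRing A] [CommRing B]

namespace GridDiagram

/-- The column `m` of the diagram carries its two markings in the adjacent rows `g` and `g + 1`. -/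
structure IsPairColumn (G : GridDiagram N) (m g : Fin N) : Prop where
  size : N ≠ 1
  marks : (G.O m = g ∧ G.X m = g + 1) ∨ (G.O m = g + 1 ∧ G.X m = g)

/-- The weights of the squares outside of the two columns `m` and `m + 1`. -/
def outerWeight (G : GridDiagram N) (m : Fin N) (V : Fin N → A) (t q : Fin N) : A :=
  if t = m ∨ t = m + 1 then 1 else G.squareWeight V t q

/-- The matrix that counts the rectangles in the diagram, in the diagram with the columns `m` and `m + 1`
interchanged, and the transitions between the two.  An entry is a `2 × 2` matrix, in which the
index `0` stands for the diagram and `1` for the interchanged one. -/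
noncomputable def exchangeMatrix (G : GridDiagram N) (m g : Fin N) (V : Fin N → A) (v ε : A) :
    Matrix (GridState N) (GridState N) (Matrix (Fin 2) (Fin 2) A) :=
  rectMatrix (turnWeight (G.outerWeight m V) v (m + 1)
    (pairUp (G.squareWeight V (m + 1)) (G.squareWeight V m) g ε)
    (pairDown (G.squareWeight V (m + 1)) (G.squareWeight V m) g ε)
    (fun q => G.squareWeight V (m + 1) q * G.squareWeight V m q) v v)

variable {G : GridDiagram N} {m g : Fin N}

theorem prod_outerWeight_mul (hm : m ≠ m + 1) (V : Fin N → A) (q : Fin N) :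
    (∏ t, G.outerWeight m V t q) * (G.squareWeight V (m + 1) q * G.squareWeight V m q) = 0 := by
  have h : ∀ t ∈ (Finset.univ.erase (m + 1)).erase m, G.outerWeight m V t q = G.squareWeight V t q :=
    fun t ht => if_neg (not_or.mpr ⟨(Finset.mem_erase.mp ht).1,
      (Finset.mem_erase.mp (Finset.mem_erase.mp ht).2).1⟩)
  rw [← G.prod_squareWeight_row V q, ← Finset.mul_prod_erase _ _ (Finset.mem_univ (m + 1)),
    ← Finset.mul_prod_erase _ (fun t => G.squareWeight V t q) (Finset.mem_univ (m + 1)),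
    ← Finset.mul_prod_erase _ _ (Finset.mem_erase.mpr ⟨hm, Finset.mem_univ m⟩),
    ← Finset.mul_prod_erase _ (fun t => G.squareWeight V t q)
      (Finset.mem_erase.mpr ⟨hm, Finset.mem_univ m⟩),
    Finset.prod_congr rfl h, outerWeight, outerWeight, if_pos (Or.inr rfl), if_pos (Or.inl rfl)]
  ring

theorem IsPairColumn.squareWeight_eq_one (h : G.IsPairColumn m g) (V : Fin N → A) (q : Fin N)
    (h1 : q ≠ g) (h2 : q ≠ g + 1) : G.squareWeight V m q = 1 := by
  rcases h.marks with ⟨e1, e2⟩ | ⟨e1, e2⟩ <;> simp [squareWeight, e1, e2, h1, h2]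

theorem IsPairColumn.squareWeight_mul (h : G.IsPairColumn m g) (V : Fin N → A) :
    G.squareWeight V m g * G.squareWeight V m (g + 1) = 0 := by
  rcases h.marks with ⟨e1, e2⟩ | ⟨e1, e2⟩ <;> simp [squareWeight, e2]

/-- The transfer elements have determinants `k q * p q`, the weights of the pairs of squares in the two
columns, and a full turn has trace `ε`. -/
theorem IsPairColumn.turnData (h : G.IsPairColumn m g) (V : Fin N → A) (v ε : A) (h2 : (2 : A) = 0)
    (hε : v * ε = 0) : TurnData (m + 1)
      (pairUp (G.squareWeight V (m + 1)) (G.squareWeight V m) g ε)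
      (pairDown (G.squareWeight V (m + 1)) (G.squareWeight V m) g ε)
      (fun q => G.squareWeight V (m + 1) q * G.squareWeight V m q) (G.outerWeight m V) v ε where
  two := h2
  mul_down := pairUp_mul_pairDown h.size
  mul_up := pairDown_mul_pairUp h.size
  right q := if_pos (Or.inr rfl)
  left t ht q := if_pos (Or.inl (add_right_cancel ht))
  lap := upPath_add_downPath_pairUp h.size (G.prod_squareWeight_col V _) (h.squareWeight_mul V)
    (h.squareWeight_eq_one V)
  mul_trace := hε
  mul_det := by rw [Finset.prod_mul_distrib, prod_squareWeight_col, zero_mul, mul_zero]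
  col t h1 h2 := by
    have : ∀ q, G.outerWeight m V t q = G.squareWeight V t q := fun q =>
      if_neg (not_or.mpr ⟨fun e => h2 (by rw [e]), h1⟩)
    rw [Finset.prod_congr rfl fun q _ => this q, prod_squareWeight_col, mul_zero]
  row q := by rw [prod_outerWeight_mul (ne_add_one h.size m), mul_zero]

/-- All thin annuli contain an `X`-marking; only the trace `ε` of a full turn remains. -/
theorem IsPairColumn.exchangeMatrix_sq (h : G.IsPairColumn m g) (V : Fin N → A) (v ε : A)
    (h2 : (2 : A) = 0) (hε : v * ε = 0) : G.exchangeMatrix m g V v ε * G.exchangeMatrix m g V v ε =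
      algebraMap A (Matrix (Fin 2) (Fin 2) A) ε • 1 := by
  rw [exchangeMatrix, (h.turnData V v ε h2 hε).rectMatrix_sq_eq h.size]
  congr 2
  rw [Finset.sum_eq_zero, Finset.sum_eq_zero, zero_add, zero_add]
  · exact fun q _ => prod_outerWeight_mul (ne_add_one h.size m) V q
  · intro t ht
    have ht' := (Finset.mem_filter.mp ht).2
    have : ∀ q, G.outerWeight m V t q = G.squareWeight V t q := fun q =>
      if_neg (not_or.mpr ⟨fun e => ht'.2 (by rw [e]), ht'.1⟩)
    rw [Finset.prod_congr rfl fun q _ => this q, prod_squareWeight_col]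

end GridDiagram

end CommutationData

/-! ### Degrees of the transfer elements -/

section CommutationDegrees

open MvPolynomial

variable {N : ℕ} [NeZero N]

@[to_additive]
theorem prod_range_val_sub {Γ : Type*} [CommMonoid Γ] (f : Fin N → Γ) (p q : Fin N) :
    ∏ i ∈ Finset.range (q - p).val, f (p + Fin.ofNat N i) = ∏ t ∈ cyc p q, f t := by
  refine Finset.prod_nbij (fun i => p + Fin.ofNat N i) (fun i hi => ?_) (fun i hi j hj h => ?_)
    (fun t ht => ?_) fun _ _ => rfl
  · rw [Finset.mem_range] at hi
    rw [mem_cyc, InCyc, add_sub_cancel_left, Fin.lt_def]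
    exact (Nat.mod_le _ _).trans_lt hi
  · have hi' := (Finset.mem_range.mp hi).trans (q - p).isLt
    have hj' := (Finset.mem_range.mp hj).trans (q - p).isLt
    have := congrArg Fin.val (add_left_cancel h)
    simpa [Nat.mod_eq_of_lt hi', Nat.mod_eq_of_lt hj'] using this
  · exact ⟨(t - p).val, Finset.mem_coe.mpr (Finset.mem_range.mpr (mem_cyc.mp ht)), add_ofNat_val_sub p t⟩

variable {ι Γ k : Type*} [AddCommGroup Γ] [CommRing k] {w : ι → Γ}

/-- The entries of a `2 × 2` matrix are homogeneous of degree `d`, when the index `1` is shifted by `δ` at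
the source and by `δ'` at the target. -/
def IsShiftHomogeneous (w : ι → Γ) (M : Matrix (Fin 2) (Fin 2) (MvPolynomial ι k)) (d δ δ' : Γ) : Prop :=
  ∀ i j : Fin 2, IsWeightedHomogeneous w (M i j) (d + (j.val • δ - i.val • δ'))

namespace IsShiftHomogeneous

variable {M M' : Matrix (Fin 2) (Fin 2) (MvPolynomial ι k)} {d d' δ δ' δ'' : Γ}

theorem mul (h : IsShiftHomogeneous w M d δ' δ'') (h' : IsShiftHomogeneous w M' d' δ δ') :
    IsShiftHomogeneous w (M * M') (d + d') δ δ'' := by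
  intro i j
  refine IsWeightedHomogeneous.sum _ _ _ fun l _ => ?_
  have := (h i l).mul (h' l j)
  rwa [show d + (l.val • δ' - i.val • δ'') + (d' + (j.val • δ - l.val • δ')) =
    d + d' + (j.val • δ - i.val • δ'') by abel] at this

theorem add (h : IsShiftHomogeneous w M d δ δ') (h' : IsShiftHomogeneous w M' d δ δ') :
    IsShiftHomogeneous w (M + M') d δ δ' := fun i j => (h i j).add (h' i j)

theorem zero : IsShiftHomogeneous w (0 : Matrix (Fin 2) (Fin 2) (MvPolynomial ι k)) d δ δ' :=
  fun _ _ => isWeightedHomogeneous_zero _ _ _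

theorem smul {a : MvPolynomial ι k} (ha : IsWeightedHomogeneous w a d')
    (h : IsShiftHomogeneous w M d δ δ') : IsShiftHomogeneous w (a • M) (d' + d) δ δ' := by
  intro i j
  rw [add_assoc]
  exact ha.mul (h i j)

theorem scalar {a : MvPolynomial ι k} (ha : IsWeightedHomogeneous w a d) :
    IsShiftHomogeneous w (algebraMap _ (Matrix (Fin 2) (Fin 2) (MvPolynomial ι k)) a) d δ δ := by
  intro i j
  rw [Matrix.algebraMap_matrix_apply]
  split_ifs with h
  · rw [h, sub_self, add_zero]
    exact ha
  · exact isWeightedHomogeneous_zero _ _ _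

theorem one : IsShiftHomogeneous w (1 : Matrix (Fin 2) (Fin 2) (MvPolynomial ι k)) 0 δ δ := by
  rw [← map_one (algebraMap (MvPolynomial ι k) _)]
  exact scalar (isWeightedHomogeneous_one _ _)

theorem up {R : Fin N → Matrix (Fin 2) (Fin 2) (MvPolynomial ι k)} {κ δ : Fin N → Γ}
    (h : ∀ q, IsShiftHomogeneous w (R q) (κ q) (δ q) (δ (q + 1))) (p : Fin N) (m : ℕ) :
    IsShiftHomogeneous w (upPath R p m) (∑ i ∈ Finset.range m, κ (p + Fin.ofNat N i)) (δ p)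
      (δ (p + Fin.ofNat N m)) := by
  induction m generalizing p with
  | zero => rw [Fin.ofNat_zero, add_zero]; exact one
  | succ m ih =>
    have := (ih (p + 1)).mul (h p)
    simp only [add_one_add_ofNat] at this
    rw [Finset.sum_range_succ', Fin.ofNat_zero, add_zero]
    exact this

theorem down {L : Fin N → Matrix (Fin 2) (Fin 2) (MvPolynomial ι k)} {κ δ : Fin N → Γ}
    (h : ∀ q, IsShiftHomogeneous w (L q) (κ q) (δ (q + 1)) (δ q)) (p : Fin N) (m : ℕ) :
    IsShiftHomogeneous w (downPath L p m) (∑ i ∈ Finset.range m, κ (p + Fin.ofNat N i))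
      (δ (p + Fin.ofNat N m)) (δ p) := by
  induction m generalizing p with
  | zero => rw [Fin.ofNat_zero, add_zero]; exact one
  | succ m ih =>
    have := (h p).mul (ih (p + 1))
    simp only [add_one_add_ofNat] at this
    rw [Finset.sum_range_succ', Fin.ofNat_zero, add_zero, add_comm (∑ i ∈ _, _)]
    exact this

/-- The tall terms of the weights do not change the degree. -/
theorem upPath_add_tall {R : Fin N → Matrix (Fin 2) (Fin 2) (MvPolynomial ι k)} {κ δ : Fin N → Γ}
    (h : ∀ q, IsShiftHomogeneous w (R q) (κ q) (δ q) (δ (q + 1))) {v : MvPolynomial ι k} {dv : Γ}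
    (hv : IsWeightedHomogeneous w v dv) (h0 : dv + ∑ q, κ q = 0) (p q : Fin N) (P : Prop)
    [Decidable P] : IsShiftHomogeneous w (upPath R p (q - p).val +
      if P then v • upPath R p ((q - p).val + N) else 0) (∑ t ∈ cyc p q, κ t) (δ p) (δ q) := by
  have h1 := up h p (q - p).val
  have h2 := up h p N
  rw [sum_range_val_sub, add_ofNat_val_sub] at h1
  rw [sum_range_add_ofNat, add_ofNat_self] at h2
  refine h1.add ?_
  split_ifs
  · have := smul hv (h1.mul h2)
    rwa [← upPath_add_lap, add_left_comm, h0, add_zero] at this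
  · exact zero

/-- The same for downward paths. -/
theorem down_add_tall {L : Fin N → Matrix (Fin 2) (Fin 2) (MvPolynomial ι k)} {κ δ : Fin N → Γ}
    (h : ∀ q, IsShiftHomogeneous w (L q) (κ q) (δ (q + 1)) (δ q)) {v : MvPolynomial ι k} {dv : Γ}
    (hv : IsWeightedHomogeneous w v dv) (h0 : dv + ∑ q, κ q = 0) (p q : Fin N) (P : Prop)
    [Decidable P] : IsShiftHomogeneous w (downPath L p (q - p).val +
      if P then v • downPath L p ((q - p).val + N) else 0) (∑ t ∈ cyc p q, κ t) (δ q) (δ p) := by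
  have h1 := down h p (q - p).val
  have h2 := down h p N
  rw [sum_range_val_sub, add_ofNat_val_sub] at h1
  rw [sum_range_add_ofNat, add_ofNat_self] at h2
  refine h1.add ?_
  split_ifs
  · have := smul hv (h2.mul h1)
    rwa [← downPath_add_lap, ← add_assoc, h0, zero_add] at this
  · exact zero

end IsShiftHomogeneous

/-- The degree of a square, if the `O`-markings have the degree `dO` and the `X`-markings `dX`. -/
def GridDiagram.markDegree (G : GridDiagram N) (dO dX : Γ) (t q : Fin N) : Γ :=
  (if q = G.O t then dO else 0) + if q = G.X t then dX else 0

/-- The degree of the passage from the diagram to the one with the columns `m` and `m + 1` interchanged,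
at a state that meets the circle between these columns at the height `q`. -/
def GridDiagram.passDegree (G : GridDiagram N) (m : Fin N) (dO dX : Γ) (q : Fin N) : Γ :=
  (if InCyc q (G.O (m + 1)) (G.O m) then dO else 0) +
    if InCyc q (G.X (m + 1)) (G.X m) then dX else 0

theorem ite_inCyc_add_ite (hN : N ≠ 1) {K P : Fin N} (h : K ≠ P) (q : Fin N) (d : Γ) :
    (if q = K then d else 0) + (if InCyc q K P then d else 0) =
      (if q = P then d else 0) + if InCyc (q + 1) K P then d else 0 := by
  have h1 := ne_add_one hN q
  by_cases hK : q = K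
  · subst hK
    have h2 : ¬ InCyc q q P := by simp [InCyc]
    have h3 : InCyc (q + 1) q P := by
      rw [inCyc_compl h1, ← mem_cyc, cyc_succ h1, Finset.mem_singleton]
      exact h.symm
    rw [if_pos rfl, if_neg h2, if_neg h, if_pos h3]
    abel
  · have h2 : InCyc q K P ↔ P = q ∨ InCyc (q + 1) K P := by
      rw [← mem_cyc, (cyc_eq_insert hK).1, Finset.mem_insert, mem_cyc]
    rw [if_neg hK]
    by_cases hP : q = P
    · subst hP
      rw [if_pos (h2.mpr (Or.inl rfl)), if_pos rfl, if_neg (not_inCyc_add_one_left hN q K)]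
      abel
    · simp [h2, hP, Ne.symm hP]

namespace GridDiagram

variable {G : GridDiagram N} {m g : Fin N} {dO dX : Γ}

/-- Crossing a row changes the degree of the passage by the difference of the degrees of the two
squares; this makes the diagonal entries of `pairUp` homogeneous. -/
theorem markDegree_add_passDegree (hN : N ≠ 1) (q : Fin N) :
    G.markDegree dO dX (m + 1) q + G.passDegree m dO dX q =
      G.markDegree dO dX m q + G.passDegree m dO dX (q + 1) := by
  have hm := ne_add_one hN m
  have h1 := ite_inCyc_add_ite hN (G.O.injective.ne hm.symm) q dO
  have h2 := ite_inCyc_add_ite hN (G.X.injective.ne hm.symm) q dX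
  rw [markDegree, markDegree, passDegree, passDegree, add_add_add_comm, h1, h2, add_add_add_comm]

/-- At the upper square of the pair of markings the passage has the degree of the square; therefore the
link `1` of `pairUp` is homogeneous. -/
theorem IsPairColumn.passDegree_top (h : G.IsPairColumn m g) :
    G.passDegree m dO dX (g + 1) = G.markDegree dO dX m (g + 1) := by
  have hm := ne_add_one h.size m
  have hg := ne_add_one h.size g
  rw [passDegree, markDegree]
  rcases h.marks with ⟨e1, e2⟩ | ⟨e1, e2⟩
  · rw [e1, e2, if_neg (not_inCyc_add_one_left h.size _ _), if_neg hg.symm, if_pos rfl,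
      if_pos (inCyc_left (e2 ▸ G.X.injective.ne hm))]
  · rw [e1, e2, if_neg (not_inCyc_add_one_left h.size _ _), if_neg hg.symm, if_pos rfl,
      if_pos (inCyc_left (e1 ▸ G.O.injective.ne hm))]

theorem IsPairColumn.markDegree_add (h : G.IsPairColumn m g) :
    G.markDegree dO dX m g + G.markDegree dO dX m (g + 1) = dO + dX := by
  have hg := ne_add_one h.size g
  rw [markDegree, markDegree]
  rcases h.marks with ⟨e1, e2⟩ | ⟨e1, e2⟩ <;> rw [e1, e2, if_pos rfl, if_pos rfl, if_neg hg, if_neg hg.symm] <;>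
    abel

variable {V : Fin N → MvPolynomial ι k} {v ε : MvPolynomial ι k} {dv : Γ}

omit [NeZero N] in
theorem isWeightedHomogeneous_squareWeight (hV : ∀ i, IsWeightedHomogeneous w (V i) dO)
    (t q : Fin N) : IsWeightedHomogeneous w (G.squareWeight V t q) (G.markDegree dO dX t q) := by
  rw [squareWeight, markDegree]
  split_ifs with h1 h2
  · exact isWeightedHomogeneous_zero _ _ _
  · exact isWeightedHomogeneous_zero _ _ _
  · rw [add_zero]; exact hV t
  · rw [add_zero]; exact isWeightedHomogeneous_one _ _

omit [NeZero N] in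
theorem sum_markDegree (t : Fin N) : ∑ q, G.markDegree dO dX t q = dO + dX := by
  simp [markDegree, Finset.sum_add_distrib]

theorem IsPairColumn.pairUp_homogeneous (h : G.IsPairColumn m g)
    (hV : ∀ i, IsWeightedHomogeneous w (V i) dO) (hε : IsWeightedHomogeneous w ε (dO + dX))
    (q : Fin N) : IsShiftHomogeneous w (pairUp (G.squareWeight V (m + 1)) (G.squareWeight V m) g ε q)
      (G.markDegree dO dX (m + 1) q) (G.passDegree m dO dX q) (G.passDegree m dO dX (q + 1)) := by
  have hs := G.markDegree_add_passDegree (m := m) (dO := dO) (dX := dX) h.size q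
  have hg := ne_add_one h.size g
  have h1 := isWeightedHomogeneous_squareWeight (G := G) (dX := dX) hV (m + 1) q
  have h2 := isWeightedHomogeneous_squareWeight (G := G) (dX := dX) hV m q
  intro i j
  fin_cases i <;> fin_cases j <;> simp only [pairUp, Fin.zero_eta, Fin.mk_one, Matrix.of_apply,
    Matrix.cons_val_zero, Matrix.cons_val_one, zero_smul, one_smul, sub_zero,
    zero_sub, add_zero]
  · exact h1
  · split_ifs with e
    · rw [e] at hs ⊢
      rw [hs, h.passDegree_top, h.markDegree_add]
      exact hε
    · exact isWeightedHomogeneous_zero _ _ _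
  · split_ifs with e
    · rw [show G.markDegree dO dX (m + 1) q + -G.passDegree m dO dX (q + 1) = 0 by
        rw [← sub_eq_add_neg, sub_eq_zero, ← add_right_inj (G.passDegree m dO dX q), add_comm, hs, e,
          h.passDegree_top]]
      exact isWeightedHomogeneous_one _ _
    · exact isWeightedHomogeneous_zero _ _ _
  · rw [add_sub, hs, add_sub_cancel_right]
    exact h2

theorem IsPairColumn.pairDown_homogeneous (h : G.IsPairColumn m g)
    (hV : ∀ i, IsWeightedHomogeneous w (V i) dO) (hε : IsWeightedHomogeneous w ε (dO + dX))
    (q : Fin N) :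
    IsShiftHomogeneous w (pairDown (G.squareWeight V (m + 1)) (G.squareWeight V m) g ε q)
      (G.markDegree dO dX m q) (G.passDegree m dO dX (q + 1)) (G.passDegree m dO dX q) := by
  have hs := G.markDegree_add_passDegree (m := m) (dO := dO) (dX := dX) h.size q
  have hg := ne_add_one h.size g
  have h1 := isWeightedHomogeneous_squareWeight (G := G) (dX := dX) hV (m + 1) q
  have h2 := isWeightedHomogeneous_squareWeight (G := G) (dX := dX) hV m q
  intro i j
  fin_cases i <;> fin_cases j <;> simp only [pairDown, Fin.zero_eta, Fin.mk_one, Matrix.of_apply,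
    Matrix.cons_val_zero, Matrix.cons_val_one, zero_smul, one_smul, sub_zero,
    zero_sub, add_zero]
  · exact h2
  · split_ifs with e
    · rw [e, h.passDegree_top, h.markDegree_add]
      exact hε.neg
    · rw [neg_zero]; exact isWeightedHomogeneous_zero _ _ _
  · split_ifs with e
    · rw [e, h.passDegree_top, add_neg_cancel]
      exact (isWeightedHomogeneous_one _ _).neg
    · rw [neg_zero]; exact isWeightedHomogeneous_zero _ _ _
  · rw [add_sub, ← hs, add_sub_cancel_right]
    exact h1

end GridDiagram

end CommutationDegrees

/-! ### Gradings and the exchange of two columns -/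

section CommutationHomogeneous

open MvPolynomial

variable {N : ℕ} [NeZero N]

omit [NeZero N] in
@[to_additive]
theorem prod_eq_mul_two {Γ : Type*} [CommMonoid Γ] (F : Fin N → Γ) (s : Finset (Fin N)) {a b : Fin N}
    (hab : a ≠ b) : ∏ t ∈ s, F t = (∏ t ∈ s, if t = a ∨ t = b then 1 else F t) *
      ((if a ∈ s then F a else 1) * if b ∈ s then F b else 1) := by
  rw [← Finset.prod_ite_eq' s a F, ← Finset.prod_ite_eq' s b F, ← Finset.prod_mul_distrib,
    ← Finset.prod_mul_distrib]
  refine Finset.prod_congr rfl fun t _ => ?_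
  by_cases h1 : t = a
  · simp [h1, hab]
  · by_cases h2 : t = b
    · simp [h2, hab.symm]
    · simp [h1, h2]

theorem add_one_mem_cyc_iff {l r m : Fin N} (hl : l ≠ m + 1) (hr : r ≠ m + 1) :
    m + 1 ∈ cyc l r ↔ m ∈ cyc l r := by
  rw [mem_cyc, mem_cyc, inCyc_add_one_iff hl hr]

variable {ι Γ k : Type*} [AddCommGroup Γ] [CommRing k] {w : ι → Γ}

namespace GridDiagram

variable {G : GridDiagram N} {m g : Fin N} {dO dX dv : Γ} {V : Fin N → MvPolynomial ι k}
  {v ε : MvPolynomial ι k}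

theorem IsPairColumn.exchangeWeight_homogeneous (h : G.IsPairColumn m g)
    (hV : ∀ i, IsWeightedHomogeneous w (V i) dO) (hv : IsWeightedHomogeneous w v dv)
    (hε : IsWeightedHomogeneous w ε (dO + dX)) (h0 : dv + (dO + dX) = 0) (x : GridState N)
    {l r : Fin N} (hlr : l ≠ r) : IsShiftHomogeneous w
      (turnWeight (G.outerWeight m V) v (m + 1)
        (pairUp (G.squareWeight V (m + 1)) (G.squareWeight V m) g ε)
        (pairDown (G.squareWeight V (m + 1)) (G.squareWeight V m) g ε)
        (fun q => G.squareWeight V (m + 1) q * G.squareWeight V m q) v v x l r)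
      (∑ t ∈ cyc l r, ∑ q ∈ cyc (x l) (x r), G.markDegree dO dX t q + interiorCount x (l, r) • dv)
      (G.passDegree m dO dX (x (m + 1)))
      (G.passDegree m dO dX ((x * Equiv.swap l r) (m + 1))) := by
  have hm := ne_add_one h.size m
  have hs := isWeightedHomogeneous_scal (u := G.outerWeight m V)
    (δ := fun t q => if t = m ∨ t = m + 1 then 0 else G.markDegree dO dX t q) (by
      intro t q
      rw [outerWeight]
      split_ifs
      · exact isWeightedHomogeneous_one _ _
      · exact isWeightedHomogeneous_squareWeight hV t q) hv x l r
  have hF : ∀ t, ∑ q ∈ cyc (x l) (x r), (if t = m ∨ t = m + 1 then 0 else G.markDegree dO dX t q) =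
      if t = m ∨ t = m + 1 then 0 else ∑ q ∈ cyc (x l) (x r), G.markDegree dO dX t q := by
    intro t
    split_ifs <;> simp
  simp only [hF] at hs
  rw [sum_eq_add_two _ _ hm, add_right_comm, turnWeight]
  refine IsShiftHomogeneous.smul hs ?_
  rw [turn]
  have hsum : ∀ t, dv + ∑ q, G.markDegree dO dX t q = 0 := fun t => by rw [sum_markDegree, h0]
  by_cases hl : l = m + 1
  · subst hl
    rw [if_pos rfl, if_neg fun e => not_inCyc_add_one_left h.size m r (mem_cyc.mp e), zero_add,
      if_pos (mem_cyc.mpr (inCyc_left hlr)), Equiv.Perm.mul_apply, Equiv.swap_apply_left]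
    exact IsShiftHomogeneous.upPath_add_tall (h.pairUp_homogeneous hV hε) hv (hsum _) _ _ _
  rw [if_neg hl]
  by_cases hr : r = m + 1
  · subst hr
    rw [if_pos rfl, if_pos (mem_cyc.mpr (inCyc_add_one_right h.size hl)),
      if_neg fun e => not_inCyc_right _ _ (mem_cyc.mp e), add_zero, Equiv.Perm.mul_apply,
      Equiv.swap_apply_right]
    exact IsShiftHomogeneous.down_add_tall (h.pairDown_homogeneous hV hε) hv (hsum _) _ _ _
  rw [if_neg hr, Equiv.Perm.mul_apply, Equiv.swap_apply_of_ne_of_ne (Ne.symm hl) (Ne.symm hr)]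
  by_cases hc : InCyc l r (m + 1)
  · have hc' := mem_cyc.mpr hc
    rw [if_pos hc, if_pos hc', if_pos ((add_one_mem_cyc_iff hl hr).mp hc'),
      add_comm (∑ q ∈ _, _), ← Finset.sum_add_distrib]
    exact IsShiftHomogeneous.scalar (IsWeightedHomogeneous.prod _ _ _ fun q _ =>
      (isWeightedHomogeneous_squareWeight hV _ _).mul (isWeightedHomogeneous_squareWeight hV _ _))
  · have hc' : m + 1 ∉ cyc l r := fun e => hc (mem_cyc.mp e)
    rw [if_neg hc, if_neg hc', if_neg fun e => hc' ((add_one_mem_cyc_iff hl hr).mpr e),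
      add_zero]
    exact IsShiftHomogeneous.one

/-- If a grading `b` of the states changes along every rectangle by the degrees of its squares and of
its interior points, up to a constant `c`, then the exchange matrix is homogeneous for `b` on the states
of the diagram and `b` shifted by `passDegree` on the states of the interchanged diagram. -/
theorem IsPairColumn.exchangeMatrix_homogeneous (h : G.IsPairColumn m g)
    (hV : ∀ i, IsWeightedHomogeneous w (V i) dO) (hv : IsWeightedHomogeneous w v dv)
    (hε : IsWeightedHomogeneous w ε (dO + dX)) (h0 : dv + (dO + dX) = 0) (b : GridState N → Γ)
    (c : Γ) (hb : ∀ x l r, l ≠ r → b x - b (x * Equiv.swap l r) =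
      ∑ t ∈ cyc l r, ∑ q ∈ cyc (x l) (x r), G.markDegree dO dX t q +
        interiorCount x (l, r) • dv + c) (y x : GridState N) (i j : Fin 2) :
    IsWeightedHomogeneous w (G.exchangeMatrix m g V v ε y x i j)
      (b x + j.val • G.passDegree m dO dX (x (m + 1)) -
        (b y + i.val • G.passDegree m dO dX (y (m + 1))) - c) := by
  rw [exchangeMatrix, rectMatrix, Matrix.sum_apply]
  refine IsWeightedHomogeneous.sum _ _ _ fun p hp => ?_
  obtain ⟨hlr, rfl⟩ := mem_rects.mp hp
  have := h.exchangeWeight_homogeneous hV hv hε h0 x hlr i j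
  rwa [eq_sub_of_add_eq (hb x p.1 p.2 hlr).symm,
    show b x - b (x * Equiv.swap p.1 p.2) - c + (j.val • G.passDegree m dO dX (x (m + 1)) -
      i.val • G.passDegree m dO dX ((x * Equiv.swap p.1 p.2) (m + 1))) =
      b x + j.val • G.passDegree m dO dX (x (m + 1)) - (b (x * Equiv.swap p.1 p.2) +
        i.val • G.passDegree m dO dX ((x * Equiv.swap p.1 p.2) (m + 1))) - c by abel] at this

end GridDiagram

end CommutationHomogeneous

section ExchangeColumns

variable {n : ℕ}

theorem inCyc_exchange {K P : Fin n} (h : K ≠ P) (p q : Fin n) :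
    ((if InCyc p q K then 1 else 0) + if InCyc p K P then 1 else 0 : ℤ) =
      (if InCyc p q P then 1 else 0) + if InCyc q K P then 1 else 0 := by
  rw [Ne, Fin.ext_iff] at h
  simp only [inCyc_iff]
  split_ifs <;> omega

variable [NeZero n]

theorem markCount_mul_swap (hn : n ≠ 1) (σ : Equiv.Perm (Fin n)) (m : Fin n) (x : GridState n)
    {l r : Fin n} (h : l ≠ r) :
    (markCount σ x l r : ℤ) - markCount (σ * Equiv.swap m (m + 1)) x l r =
      (if InCyc ((x * Equiv.swap l r) (m + 1)) (σ (m + 1)) (σ m) then 1 else 0) -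
      if InCyc (x (m + 1)) (σ (m + 1)) (σ m) then 1 else 0 := by
  have hm := ne_add_one hn m
  have hσ := σ.injective.ne hm.symm
  have key : ∀ τ : Equiv.Perm (Fin n), (markCount τ x l r : ℤ) =
      ∑ t ∈ cyc l r, if InCyc (x l) (x r) (τ t) then 1 else 0 := by
    intro τ
    rw [markCount_eq_sum, cyc, Finset.sum_filter]
    refine Finset.sum_congr rfl fun t _ => ?_
    by_cases h1 : InCyc l r t <;> simp [h1]
  rw [key, key, sum_eq_add_two _ _ hm, sum_eq_add_two (fun t => if InCyc (x l) (x r)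
    ((σ * Equiv.swap m (m + 1)) t) then (1 : ℤ) else 0) _ hm]
  have hout : ∑ t ∈ cyc l r, (if t = m ∨ t = m + 1 then (0 : ℤ) else
      if InCyc (x l) (x r) ((σ * Equiv.swap m (m + 1)) t) then 1 else 0) =
      ∑ t ∈ cyc l r, (if t = m ∨ t = m + 1 then (0 : ℤ) else
      if InCyc (x l) (x r) (σ t) then 1 else 0) := by
    refine Finset.sum_congr rfl fun t _ => ?_
    by_cases ht : t = m ∨ t = m + 1
    · rw [if_pos ht, if_pos ht]
    · rw [not_or] at ht
      rw [Equiv.Perm.mul_apply, Equiv.swap_apply_of_ne_of_ne ht.1 ht.2]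
  rw [hout, add_sub_add_left_eq_sub]
  generalize hy : (x * Equiv.swap l r) (m + 1) = y
  rw [Equiv.Perm.mul_apply] at hy
  simp only [Equiv.Perm.mul_apply, Equiv.swap_apply_left, Equiv.swap_apply_right]
  by_cases hl : l = m + 1
  · subst hl
    have := inCyc_exchange hσ (x (m + 1)) (x r)
    rw [if_neg fun e => not_inCyc_add_one_left hn m r (mem_cyc.mp e),
      if_pos (mem_cyc.mpr (inCyc_left h)), if_neg fun e => not_inCyc_add_one_left hn m r (mem_cyc.mp e),
      if_pos (mem_cyc.mpr (inCyc_left h))]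
    rw [Equiv.swap_apply_left] at hy
    subst hy
    linarith
  by_cases hr : r = m + 1
  · subst hr
    have := inCyc_exchange hσ (x l) (x (m + 1))
    have h1 := mem_cyc.mpr (inCyc_add_one_right hn hl)
    rw [if_pos h1, if_neg fun e => not_inCyc_right _ _ (mem_cyc.mp e), if_pos h1,
      if_neg fun e => not_inCyc_right _ _ (mem_cyc.mp e)]
    rw [Equiv.swap_apply_right] at hy
    subst hy
    linarith
  rw [Equiv.swap_apply_of_ne_of_ne (Ne.symm hl) (Ne.symm hr)] at hy
  subst hy
  simp only [add_one_mem_cyc_iff hl hr]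
  split_ifs <;> ring

/-- The Maslov gradings before and after the exchange of two adjacent marks. -/
theorem maslovWrt_mul_swap (hn : n ≠ 1) (σ : Equiv.Perm (Fin n)) (m : Fin n) (x : GridState n) :
    maslovWrt (σ * Equiv.swap m (m + 1)) x =
      maslovWrt σ x + 1 - 2 * if InCyc (x (m + 1)) (σ (m + 1)) (σ m) then 1 else 0 := by
  have hm := ne_add_one hn m
  set f : GridState n → ℤ := fun x => maslovWrt (σ * Equiv.swap m (m + 1)) x - maslovWrt σ x +
    2 * if InCyc (x (m + 1)) (σ (m + 1)) (σ m) then 1 else 0 with hf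
  have h1 : ∀ x i j, i ≠ j → f (x * Equiv.swap i j) = f x := by
    intro x i j hij
    have h1 := maslovWrt_rect σ x hij
    have h2 := maslovWrt_rect (σ * Equiv.swap m (m + 1)) x hij
    have h3 := markCount_mul_swap hn σ m x hij
    simp only [hf]
    linarith
  -- The constant is determined at the state `σ`, which differs from the other marks by one thin rectangle.
  have h2 : f σ = 1 := by
    have e1 := maslovWrt_self σ
    have e2 := maslovWrt_self (σ * Equiv.swap m (m + 1))
    have e3 := maslovWrt_rect (σ * Equiv.swap m (m + 1)) (σ * Equiv.swap m (m + 1)) hm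
    have e4 : interiorCount (σ * Equiv.swap m (m + 1)) (m, m + 1) = 0 := by
      rw [interiorCount_eq, cyc_succ hm, Finset.card_eq_zero, Finset.filter_eq_empty_iff]
      intro t ht h
      exact h.1 (Finset.mem_singleton.mp ht)
    have e5 : markCount (σ * Equiv.swap m (m + 1)) (σ * Equiv.swap m (m + 1)) m (m + 1) = 1 := by
      rw [markCount, ← Finset.filter_filter, ← cyc, cyc_succ hm, Finset.filter_singleton,
        if_pos (inCyc_left ((σ * Equiv.swap m (m + 1)).injective.ne hm)), Finset.card_singleton]
    rw [mul_assoc, Equiv.swap_mul_self, mul_one, e4, e5] at e3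
    have e6 : ¬ InCyc (σ (m + 1)) (σ (m + 1)) (σ m) := by simp [InCyc]
    simp only [hf]
    rw [if_neg e6]
    push_cast at e3
    linarith
  have := GridDiagram.IsBlockRemoval.eq_of_mul_swap_eq h1 x σ
  rw [h2] at this
  simp only [hf] at this
  linarith

/-- The diagram with the columns `m` and `m + 1` interchanged. -/
def GridDiagram.exchangeColumns (G : GridDiagram n) (m : Fin n) : GridDiagram n where
  O := G.O * Equiv.swap m (m + 1)
  X := G.X * Equiv.swap m (m + 1)
  disjoint _ := G.disjoint _

/-- The shift by `passDegree` is the actual difference of the bidegrees, up to the bidegree `(1, 0)` by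
which the differential lowers it; so the transition map preserves the bidegree. -/
theorem GridDiagram.bidegree_exchangeColumns (G : GridDiagram n) (hn : n ≠ 1) (m : Fin n)
    (x : GridState n) : (G.exchangeColumns m).bidegree x =
      G.bidegree x + G.passDegree m (-2, -1) (0, 1) (x (m + 1)) + (1, 0) := by
  have h1 := maslovWrt_mul_swap hn G.O m x
  have h2 := congrArg (Int.cast : ℤ → ℚ) h1
  have h3 := congrArg (Int.cast : ℤ → ℚ) (maslovWrt_mul_swap hn G.X m x)
  push_cast at h2 h3
  ext
  · simp only [bidegree, maslov, exchangeColumns, passDegree, Prod.fst_add]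
    rw [h1]
    split_ifs <;> simp <;> ring
  · simp only [bidegree, alexander, exchangeColumns, passDegree, Prod.snd_add]
    rw [h2, h3]
    split_ifs <;> simp <;> ring

end ExchangeColumns

/-! ### Invariance under commutations -/

section CommutationIso

open MvPolynomial

variable {N : ℕ} [NeZero N] {A B : Type*} [CommRing A] [CommRing B]

theorem scal_update_two (u : Fin N → Fin N → A) (v : A) {m : Fin N} (hm : m ≠ m + 1)
    (f h : Fin N → A) (hu : ∀ t q, t = m ∨ t = m + 1 → u t q = 1) (x : GridState N) (l r : Fin N) :
    scal (Function.update (Function.update u (m + 1) f) m h) v x l r = scal u v x l r *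
      ((if m ∈ cyc l r then ∏ q ∈ cyc (x l) (x r), h q else 1) *
        if m + 1 ∈ cyc l r then ∏ q ∈ cyc (x l) (x r), f q else 1) := by
  rw [scal, scal, prod_eq_mul_two _ _ hm, prod_eq_mul_two (fun t => ∏ q ∈ _, u t q) _ hm]
  have h1 : ∀ t ∈ cyc l r, (if t = m ∨ t = m + 1 then 1 else ∏ q ∈ cyc (x l) (x r),
      Function.update (Function.update u (m + 1) f) m h t q) =
      if t = m ∨ t = m + 1 then 1 else ∏ q ∈ cyc (x l) (x r), u t q := by
    intro t _
    split_ifs with ht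
    · rfl
    · rw [not_or] at ht
      rw [Function.update_of_ne ht.1, Function.update_of_ne ht.2]
  rw [Finset.prod_congr rfl h1, Function.update_self, Function.update_of_ne hm.symm,
    Function.update_self, Finset.prod_congr rfl fun q _ => hu m q (Or.inl rfl),
    Finset.prod_congr rfl fun q _ => hu (m + 1) q (Or.inr rfl)]
  simp only [Finset.prod_const_one, ite_self, mul_one]
  ring

/-- A diagonal entry of the weights, when it multiplies along the paths: the entries of `R` are then the
weights of the column on the right of the special circle, and those of `L` belong to the column on its
left. -/
theorem turnWeight_apply_diag {u : Fin N → Fin N → A} {v : A} {m : Fin N} (hN : N ≠ 1)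
    {R L : Fin N → Matrix (Fin 2) (Fin 2) A} {s f h : Fin N → A} {i : Fin 2}
    (hR : ∀ p n, upPath R p n i i = ∏ j ∈ Finset.range n, f (p + Fin.ofNat N j))
    (hL : ∀ p n, downPath L p n i i = ∏ j ∈ Finset.range n, h (p + Fin.ofNat N j))
    (hf : ∏ q, f q = 0) (hh : ∏ q, h q = 0) (hs : ∀ q, s q = h q * f q)
    (hu : ∀ t q, t = m ∨ t = m + 1 → u t q = 1) (x : GridState N) {l r : Fin N} (hlr : l ≠ r) :
    turnWeight u v (m + 1) R L s v v x l r i i =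
      scal (Function.update (Function.update u (m + 1) f) m h) v x l r := by
  have hm := ne_add_one hN m
  rw [scal_update_two u v hm f h hu, turnWeight, Matrix.smul_apply, smul_eq_mul]
  congr 1
  have hf' : ∀ p n, ∏ j ∈ Finset.range (n + N), f (p + Fin.ofNat N j) = 0 := by
    intro p n
    rw [add_comm, Finset.prod_range_add, prod_range_add_ofNat, hf, zero_mul]
  have hh' : ∀ p n, ∏ j ∈ Finset.range (n + N), h (p + Fin.ofNat N j) = 0 := by
    intro p n
    rw [add_comm, Finset.prod_range_add, prod_range_add_ofNat, hh, zero_mul]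
  rw [turn]
  by_cases hl : l = m + 1
  · subst hl
    rw [if_pos rfl, if_neg fun e => not_inCyc_add_one_left hN m r (mem_cyc.mp e), one_mul,
      if_pos (mem_cyc.mpr (inCyc_left hlr)), Matrix.add_apply, hR, prod_range_val_sub]
    split_ifs
    · rw [Matrix.smul_apply, hR, hf', smul_zero, add_zero]
    · exact add_zero _
  rw [if_neg hl]
  by_cases hr : r = m + 1
  · subst hr
    rw [if_pos rfl, if_pos (mem_cyc.mpr (inCyc_add_one_right hN hl)),
      if_neg fun e => not_inCyc_right _ _ (mem_cyc.mp e), mul_one, Matrix.add_apply, hL,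
      prod_range_val_sub]
    split_ifs
    · rw [Matrix.smul_apply, hL, hh', smul_zero, add_zero]
    · exact add_zero _
  rw [if_neg hr]
  by_cases hc : InCyc l r (m + 1)
  · have hc' := mem_cyc.mpr hc
    rw [if_pos hc, if_pos hc', if_pos ((add_one_mem_cyc_iff hl hr).mp hc'),
      Matrix.algebraMap_matrix_apply, if_pos rfl, ← Finset.prod_mul_distrib]
    rw [Algebra.algebraMap_self_apply]
    exact Finset.prod_congr rfl fun q _ => hs q
  · have hc' : m + 1 ∉ cyc l r := fun e => hc (mem_cyc.mp e)
    rw [if_neg hc, if_neg hc', if_neg fun e => hc' ((add_one_mem_cyc_iff hl hr).mpr e), one_mul]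
    exact Matrix.one_apply_eq i

/-- For `ε = 0` the transfer elements are triangular. -/
theorem upPath_pairUp_zero (k p : Fin N → A) (g q : Fin N) (n : ℕ) :
    upPath (pairUp k p g 0) q n 0 0 = ∏ i ∈ Finset.range n, k (q + Fin.ofNat N i) ∧
    upPath (pairUp k p g 0) q n 0 1 = 0 ∧
    upPath (pairUp k p g 0) q n 1 1 = ∏ i ∈ Finset.range n, p (q + Fin.ofNat N i) := by
  induction n generalizing q with
  | zero => simp [upPath]
  | succ n ih =>
    obtain ⟨h1, h2, h3⟩ := ih (q + 1)
    simp only [add_one_add_ofNat] at h1 h3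
    rw [Finset.prod_range_succ', Finset.prod_range_succ', Fin.ofNat_zero, add_zero, upPath]
    simp only [Matrix.mul_apply, Fin.sum_univ_two, h1, h2, h3]
    simp [pairUp]

section Map

variable {M M' : Type*} [Ring M] [Ring M'] [Algebra A M] [Algebra B M'] (F : M →+* M') (f : A →+* B)

theorem map_upPath (R : Fin N → M) (p : Fin N) (n : ℕ) :
    F (upPath R p n) = upPath (fun q => F (R q)) p n := by
  induction n generalizing p with
  | zero => exact map_one F
  | succ n ih => rw [upPath, map_mul, ih, upPath]

theorem map_downPath (L : Fin N → M) (p : Fin N) (n : ℕ) :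
    F (downPath L p n) = downPath (fun q => F (L q)) p n := by
  induction n generalizing p with
  | zero => exact map_one F
  | succ n ih => rw [downPath, map_mul, ih, downPath]

theorem map_turnWeight (hF : ∀ a, F (algebraMap A M a) = algebraMap B M' (f a))
    (u : Fin N → Fin N → A) (v : A) (μ : Fin N) (R L : Fin N → M) (s : Fin N → A) (tR tL : A)
    (x : GridState N) (l r : Fin N) : F (turnWeight u v μ R L s tR tL x l r) =
      turnWeight (fun t q => f (u t q)) (f v) μ (fun q => F (R q)) (fun q => F (L q))
        (fun q => f (s q)) (f tR) (f tL) x l r := by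
  have hs : ∀ a b, F (a • b) = f a • F b := fun a b => by
    rw [Algebra.smul_def, map_mul, hF, ← Algebra.smul_def]
  rw [turnWeight, turnWeight, hs, map_scal, turn, turn]
  congr 1
  split_ifs <;> simp only [map_add, map_upPath, map_downPath, hs, hF, map_prod, map_one, map_zero]

end Map

namespace GridDiagram

variable {G : GridDiagram N} {m g : Fin N}

theorem map_exchangeMatrix_apply (f : A →+* B) (V : Fin N → A) (v ε : A) (y x : GridState N)
    (i j : Fin 2) : f (G.exchangeMatrix m g V v ε y x i j) =
      G.exchangeMatrix m g (fun t => f (V t)) (f v) (f ε) y x i j := by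
  have hsq : ∀ t q, f (G.squareWeight V t q) = G.squareWeight (fun t => f (V t)) t q := by
    intro t q
    simp only [squareWeight, apply_ite f, map_zero, map_one]
  have hout : ∀ t q, f (G.outerWeight m V t q) = G.outerWeight m (fun t => f (V t)) t q := by
    intro t q
    simp only [outerWeight, apply_ite f, map_one, hsq]
  have hup : ∀ q, (pairUp (G.squareWeight V (m + 1)) (G.squareWeight V m) g ε q).map f =
      pairUp (G.squareWeight (fun t => f (V t)) (m + 1)) (G.squareWeight (fun t => f (V t)) m) g (f ε)
        q := by
    intro q
    ext i j
    fin_cases i <;> fin_cases j <;> simp [pairUp, hsq, apply_ite f]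
  have hdown : ∀ q, (pairDown (G.squareWeight V (m + 1)) (G.squareWeight V m) g ε q).map f =
      pairDown (G.squareWeight (fun t => f (V t)) (m + 1)) (G.squareWeight (fun t => f (V t)) m) g
        (f ε) q := by
    intro q
    ext i j
    fin_cases i <;> fin_cases j <;> simp [pairDown, hsq, apply_ite f]
  rw [exchangeMatrix, exchangeMatrix, rectMatrix, rectMatrix, Matrix.sum_apply, Matrix.sum_apply, map_sum]
  refine Finset.sum_congr rfl fun p _ => ?_
  have := congrFun (congrFun (map_turnWeight f.mapMatrix f (fun a => by
    ext i j
    simp [Matrix.algebraMap_matrix_apply, apply_ite f])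
    (G.outerWeight m V) v (m + 1) (pairUp (G.squareWeight V (m + 1)) (G.squareWeight V m) g ε)
    (pairDown (G.squareWeight V (m + 1)) (G.squareWeight V m) g ε)
    (fun q => G.squareWeight V (m + 1) q * G.squareWeight V m q) v v x p.1 p.2) i) j
  simp only [RingHom.mapMatrix_apply, hup, hdown, hout, map_mul, hsq] at this
  exact this

theorem exchangeMatrix_zero_zero (hN : N ≠ 1) (V : Fin N → A) (v : A) (y x : GridState N) :
    G.exchangeMatrix m g V v 0 y x 0 0 = G.boundary V v y x := by
  have hm := ne_add_one hN m
  rw [exchangeMatrix, rectMatrix, Matrix.sum_apply, boundary, rectMatrix]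
  refine Finset.sum_congr rfl fun p hp => ?_
  refine (turnWeight_apply_diag hN (fun q n => (upPath_pairUp_zero _ _ _ q n).1) (fun q n => by
    rw [downPath_pairDown, Matrix.adjugate_fin_two]
    exact (upPath_pairUp_zero _ _ _ q n).2.2) (G.prod_squareWeight_col V _)
    (G.prod_squareWeight_col V _) (fun q => mul_comm _ _) (fun t q ht => if_pos ht) x
    (mem_rects.mp hp).1).trans ?_
  congr 1
  funext t
  by_cases h1 : t = m
  · rw [h1, Function.update_self]
  rw [Function.update_of_ne h1]
  by_cases h2 : t = m + 1
  · rw [h2, Function.update_self]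
  rw [Function.update_of_ne h2]
  funext q
  exact if_neg (not_or.mpr ⟨h1, h2⟩)

theorem squareWeight_exchangeColumns (V : Fin N → A) (t q : Fin N) :
    (G.exchangeColumns m).squareWeight (V ∘ Equiv.swap m (m + 1)) t q =
      G.squareWeight V (Equiv.swap m (m + 1) t) q := rfl

theorem exchangeMatrix_one_one (hN : N ≠ 1) (V : Fin N → A) (v : A) (y x : GridState N) :
    G.exchangeMatrix m g V v 0 y x 1 1 =
      (G.exchangeColumns m).boundary (V ∘ Equiv.swap m (m + 1)) v y x := by
  have hm := ne_add_one hN m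
  rw [exchangeMatrix, rectMatrix, Matrix.sum_apply, boundary, rectMatrix]
  refine Finset.sum_congr rfl fun p hp => ?_
  refine (turnWeight_apply_diag hN (fun q n => (upPath_pairUp_zero _ _ _ q n).2.2) (fun q n => by
    rw [downPath_pairDown, Matrix.adjugate_fin_two]
    exact (upPath_pairUp_zero _ _ _ q n).1) (G.prod_squareWeight_col V _)
    (G.prod_squareWeight_col V _) (fun q => rfl) (fun t q ht => if_pos ht) x
    (mem_rects.mp hp).1).trans ?_
  congr 1
  funext t q
  rw [squareWeight_exchangeColumns]
  by_cases h1 : t = m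
  · rw [h1, Function.update_self, Equiv.swap_apply_left]
  rw [Function.update_of_ne h1]
  by_cases h2 : t = m + 1
  · rw [h2, Function.update_self, Equiv.swap_apply_right]
  rw [Function.update_of_ne h2, Equiv.swap_apply_of_ne_of_ne h1 h2]
  exact if_neg (not_or.mpr ⟨h1, h2⟩)

/-- For `ε = 0` there are no transitions from the interchanged diagram back to the original one. -/
theorem exchangeMatrix_zero_one (V : Fin N → A) (v : A) (y x : GridState N) :
    G.exchangeMatrix m g V v 0 y x 0 1 = 0 := by
  rw [exchangeMatrix, rectMatrix, Matrix.sum_apply]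
  refine Finset.sum_eq_zero fun p _ => ?_
  have h1 : ∀ q n, upPath (pairUp (G.squareWeight V (m + 1)) (G.squareWeight V m) g 0) q n 0 1 = 0 :=
    fun q n => (upPath_pairUp_zero _ _ _ q n).2.1
  have h2 : ∀ q n, downPath (pairDown (G.squareWeight V (m + 1)) (G.squareWeight V m) g 0) q n 0 1 =
      0 := by
    intro q n
    rw [downPath_pairDown, Matrix.adjugate_fin_two]
    exact neg_eq_zero.mpr (h1 q n)
  rw [turnWeight, turn, Matrix.smul_apply]
  split_ifs <;> simp [h1, h2, Matrix.algebraMap_matrix_apply]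

/-- The mapping cone of the transition map `P` is acyclic: it is the exchange matrix for `ε = 0`, and
the exchange matrix squares to `ε`. -/
theorem IsPairColumn.exact (h : G.IsPairColumn m g) (a c : GC N) (D₁ D₂ P : Matrix (GridState N)
      (GridState N) (GridRing N))
    (hD₁ : D₁ = G.boundary (fun i => MvPolynomial.X (some i)) (MvPolynomial.X none))
    (hD₂ : D₂ = (G.exchangeColumns m).boundary
      ((fun i => MvPolynomial.X (some i)) ∘ Equiv.swap m (m + 1)) (MvPolynomial.X none))
    (hP : P = fun y x => G.exchangeMatrix m g (fun i => MvPolynomial.X (some i))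
      (MvPolynomial.X none) 0 y x 1 0)
    (ha : D₁.mulVec a = 0) (hc : P.mulVec a + D₂.mulVec c = 0) :
    ∃ a' c', a = D₁.mulVec a' ∧ c = P.mulVec a' + D₂.mulVec c' := by
  set E : Matrix (GridState N × Fin 2) (GridState N × Fin 2)
      (MvPolynomial (Option (Option (Fin N))) (ZMod 2)) :=
    Matrix.compRingEquiv (GridState N) (Fin 2) _ (G.exchangeMatrix m g
      (fun i => MvPolynomial.X (some (some i))) (MvPolynomial.X (some none)) (MvPolynomial.X none)) with hE
  have hmap : ∀ {S : Type} [CommRing S] (f : MvPolynomial (Option (Option (Fin N))) (ZMod 2) →+* S),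
      E.map f = Matrix.compRingEquiv (GridState N) (Fin 2) S (G.exchangeMatrix m g
        (fun i => f (MvPolynomial.X (some (some i)))) (f (MvPolynomial.X (some none)))
        (f (MvPolynomial.X none))) := by
    intro S _ f
    ext y x
    exact map_exchangeMatrix_apply f _ _ _ _ _ _ _
  have hdrop : E.map dropHom = Matrix.compRingEquiv (GridState N) (Fin 2) (GridRing N)
      (G.exchangeMatrix m g (fun i => MvPolynomial.X (some i)) (MvPolynomial.X none) 0) := by
    rw [hmap]
    simp [dropHom]
  have hentry : ∀ z : GridState N × Fin 2 → GridRing N, (E.map dropHom).mulVec z = fun y =>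
      if y.2 = 0 then D₁.mulVec (fun x => z (x, 0)) y.1 else
        P.mulVec (fun x => z (x, 0)) y.1 + D₂.mulVec (fun x => z (x, 1)) y.1 := by
    intro z
    funext y
    obtain ⟨y, i⟩ := y
    simp only [Matrix.mulVec, dotProduct, Fintype.sum_prod_type, Fin.sum_univ_two, hdrop,
      Matrix.compRingEquiv_apply, Matrix.comp_apply, hD₁, hD₂, hP,
      ← exchangeMatrix_one_one (g := g) h.size, ← exchangeMatrix_zero_zero (m := m) (g := g) h.size]
    fin_cases i
    · simp [exchangeMatrix_zero_one]
    · simp [Finset.sum_add_distrib]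
  have hsq : ∀ {S : Type} [CommRing S] (V : Fin N → S) (v ε : S), (2 : S) = 0 → v * ε = 0 →
      Matrix.compRingEquiv (GridState N) (Fin 2) S (G.exchangeMatrix m g V v ε) *
      Matrix.compRingEquiv (GridState N) (Fin 2) S (G.exchangeMatrix m g V v ε) = ε • 1 := by
    intro S _ V v ε h2 hε
    rw [← map_mul, h.exchangeMatrix_sq V v ε h2 hε]
    ext ⟨y, i⟩ ⟨x, j⟩
    rw [Matrix.compRingEquiv_apply, Matrix.comp_apply, Matrix.smul_apply, Matrix.smul_apply,
      Matrix.one_apply, Matrix.one_apply]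
    by_cases hyx : y = x <;> by_cases hij : i = j <;>
      simp [hyx, hij, Matrix.algebraMap_matrix_apply]
  set b : GridState N → ℤ := fun x => -maslovWrt G.O x + 2 * maslovWrt G.X x with hb
  suffices hz : ∃ z, (fun y => if y.2 = 0 then a y.1 else c y.1) = (E.map dropHom).mulVec z by
    obtain ⟨z, hz⟩ := hz
    rw [hentry] at hz
    refine ⟨fun x => z (x, 0), fun x => z (x, 1), ?_, ?_⟩
    · funext y
      exact congrFun hz (y, 0)
    · funext y
      exact congrFun hz (y, 1)
  refine exists_eq_mulVec_of_dual E
    (fun y => -(b y.1 + y.2.val • G.passDegree m (2 : ℤ) (-4) (y.1 (m + 1)))) ?_ ?_ ?_ _ ?_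
  · intro y x
    have := h.exchangeMatrix_homogeneous (w := dualDegree) (k := ZMod 2) (dO := (2 : ℤ)) (dX := -4)
      (dv := 2) (V := fun i => MvPolynomial.X (some (some i))) (v := MvPolynomial.X (some none))
      (ε := MvPolynomial.X none) (fun _ => isWeightedHomogeneous_X _ _ _)
      (isWeightedHomogeneous_X _ _ _) (isWeightedHomogeneous_X _ _ _) (by norm_num) b 1 (by
        intro x l r hlr
        have h1 := maslovWrt_rect G.O x hlr
        have h2 := maslovWrt_rect G.X x hlr
        simp only [hb, markDegree, Finset.sum_add_distrib, sum_boole_mark]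
        simp only [nsmul_eq_mul]
        linarith) y.1 x.1 y.2 x.2
    rwa [neg_sub_neg]
  · rw [hdrop, hsq _ _ _ two_eq_zero (mul_zero _), zero_smul]
  · rw [hmap, hsq _ _ _ (TrivSqZeroExt.ext rfl rfl)]
    · simp [dualHom]
    · simp [dualHom]
  · rw [hentry]
    funext y
    split_ifs
    · exact congrFun ha y.1
    · exact congrFun hc y.1

theorem _root_.mulVec_renameHom {n k : ℕ} {T T' : Type*} [Fintype T] (f : Fin n → Fin k)
    (D : Matrix T' T (GridRing n)) (z : T → GridRing n) :
    (fun y => renameHom f (D.mulVec z y)) = (D.map (renameHom f)).mulVec fun x => renameHom f (z x) := by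
  funext y
  simp [Matrix.mulVec, dotProduct, map_sum]

/-- Commutation: the homology does not change when a column with two vertically adjacent markings is
interchanged with the column on its right.  The other column is arbitrary. -/
theorem IsPairColumn.gridIso (h : G.IsPairColumn m g) :
    GridIso G (G.exchangeColumns m) (Equiv.swap m (m + 1)) := by
  set V : Fin N → GridRing N := fun i => MvPolynomial.X (some i) with hV
  set v : GridRing N := MvPolynomial.X none with hv
  set τ := Equiv.swap m (m + 1) with hτ
  set ρ := renameHom τ with hρ
  set D₁ := G.boundary V v with hD₁
  set D₂ := (G.exchangeColumns m).boundary (V ∘ τ) v with hD₂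
  set P : Matrix (GridState N) (GridState N) (GridRing N) :=
    fun y x => G.exchangeMatrix m g V v 0 y x 1 0 with hP
  have hρρ : ∀ p, ρ (ρ p) = p := by
    intro p
    simp only [hρ, renameHom, AlgHom.toRingHom_eq_coe, RingHom.coe_coe, rename_rename]
    rw [show Option.map τ ∘ Option.map τ = id by
      funext i
      cases i <;> simp [hτ]]
    exact rename_id_apply p
  have hinv : ∀ z : GC N, (fun x => ρ (ρ (z x))) = z := fun z => funext fun x => hρρ _
  have hρV : ∀ i, ρ (V i) = V (τ i) := fun i => by simp [hρ, hV, renameHom]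
  have hρv : ρ v = v := by simp [hρ, hv, renameHom]
  have hD₂' : D₂.map ρ = (G.exchangeColumns m).boundary V v := by
    rw [hD₂, map_boundary, hρv]
    congr 1
    funext i
    rw [Function.comp_apply, hρV, hτ, Equiv.swap_apply_self]
  have h2 : ∀ z : GC N, z + z = 0 := fun z => by
    funext y
    exact CharTwo.add_self_eq_zero (z y)
  have hPD : ∀ z : GC N, P.mulVec (D₁.mulVec z) + D₂.mulVec (P.mulVec z) = 0 := by
    intro z
    have hsq := h.exchangeMatrix_sq V v 0 two_eq_zero (mul_zero _)
    rw [map_zero, zero_smul] at hsq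
    rw [Matrix.mulVec_mulVec, Matrix.mulVec_mulVec, ← Matrix.add_mulVec]
    have : P * D₁ + D₂ * P = 0 := by
      ext1 y x
      have := congrFun (congrFun (congrFun (congrFun hsq y) x) 1) 0
      rw [Matrix.mul_apply, Matrix.sum_apply] at this
      simp only [Matrix.mul_apply, Fin.sum_univ_two, exchangeMatrix_one_one h.size,
        exchangeMatrix_zero_zero h.size, Finset.sum_add_distrib] at this
      rw [Matrix.add_apply, Matrix.mul_apply, Matrix.mul_apply]
      exact this
    rw [this, Matrix.zero_mulVec]
  set F : GC N →ₛₗ[ρ] GC N :=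
    { toFun := fun z x => ρ (P.mulVec z x)
      map_add' := fun a b => by funext x; simp [Matrix.mulVec_add]
      map_smul' := fun p a => by funext x; simp [Matrix.mulVec_smul] } with hF
  have hF' : ∀ z, F z = fun x => ρ (P.mulVec z x) := fun _ => rfl
  have hd : ∀ z, (G.exchangeColumns m).diff z = fun x => ρ (D₂.mulVec (fun x => ρ (z x)) x) := by
    intro z
    rw [diff_apply, mulVec_renameHom, hinv, hD₂']
  refine GridIso.of_chainMap F (fun z => ?_) G.diff_homogeneous (G.exchangeColumns m).diff_homogeneous
    (fun d s z hz => ?_) (fun z hz b hb => ?_) (fun z hz => ?_)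
  · rw [hd, hF', hF', hinv, diff_apply]
    funext x
    congr 1
    exact CharTwo.add_eq_zero.mp (congrFun (hPD z) x)
  · rw [homogeneousChain_iff] at hz ⊢
    intro y
    refine isWeightedHomogeneous_rename τ ?_
    have := homogeneousChain_mulVec (M := P) (b := G.bidegree)
      (b' := (G.exchangeColumns m).bidegree) (d := (d, s)) (e := 0) (fun y x => ?_) hz y
    · rwa [add_zero] at this
    · have := h.exchangeMatrix_homogeneous (w := varDegree N) (dO := (-2, -1)) (dX := (0, 1))
        (dv := (2, 0)) (V := V) (v := v) (ε := 0) (fun _ => isWeightedHomogeneous_X _ _ _)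
        (isWeightedHomogeneous_X _ _ _) (isWeightedHomogeneous_zero _ _ _) (by norm_num) G.bidegree
        (1, 0) (fun x l r hlr => G.bidegree_sub_eq x hlr) y x 1 0
      rw [bidegree_exchangeColumns _ h.size]
      simpa [sub_add_eq_sub_sub] using this
  · rw [diff_apply] at hz
    rw [hd, hF'] at hb
    have hb' : P.mulVec z = D₂.mulVec fun x => ρ (b x) := by
      funext x
      rw [← hρρ (P.mulVec z x), congrFun hb x, hρρ]
    obtain ⟨a', -, ha, -⟩ := h.exact z (fun x => ρ (b x)) D₁ D₂ P hD₁ hD₂ hP hz (by rw [hb', h2])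
    exact ⟨a', by rw [diff_apply]; exact ha⟩
  · have hz' : D₂.mulVec (fun x => ρ (z x)) = 0 := by
      rw [hd] at hz
      funext x
      rw [← hρρ (D₂.mulVec _ x), congrFun hz x, Pi.zero_apply, map_zero]
    obtain ⟨a, c, ha, hc⟩ := h.exact 0 (fun x => ρ (z x)) D₁ D₂ P hD₁ hD₂ hP (Matrix.mulVec_zero _)
      (by rw [Matrix.mulVec_zero, zero_add, hz'])
    refine ⟨a, fun x => ρ (c x), by rw [diff_apply]; exact ha.symm, ?_⟩
    rw [hd, hF', hinv]
    funext x
    rw [Pi.add_apply, ← map_add, ← Pi.add_apply, ← hc, hρρ]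

end GridDiagram

end CommutationIso

/-! ### Cyclic embeddings -/

section CyclicEmbedding

variable {n : ℕ}

/-- The injection `κ` of cyclically ordered sets preserves the cyclic order and misses exactly the
point `a`. -/
structure IsCyclicEmbedding (κ : Fin n → Fin (n + 1)) (a : Fin (n + 1)) : Prop where
  ne : ∀ c, κ c ≠ a
  inCyc : ∀ i j k, InCyc (κ i) (κ j) (κ k) ↔ InCyc i j k

theorem inCyc_congr {m k : ℕ} {i j c : Fin m} {i' j' c' : Fin k} (h1 : i' ≤ c' ↔ i ≤ c)
    (h2 : c' < j' ↔ c < j) (h3 : j' < i' ↔ j < i) : InCyc i' j' c' ↔ InCyc i j c := by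
  simp only [Fin.le_def, Fin.lt_def] at h1 h2 h3
  rw [inCyc_iff, inCyc_iff, h1, h2, h3]

theorem isCyclicEmbedding_succAbove (a : Fin (n + 1)) : IsCyclicEmbedding a.succAbove a where
  ne := Fin.succAbove_ne a
  inCyc _ _ _ := inCyc_congr Fin.succAbove_le_succAbove_iff Fin.succAbove_lt_succAbove_iff
    Fin.succAbove_lt_succAbove_iff

theorem inCyc_sub [NeZero n] (a i j c : Fin n) : InCyc (i - a) (j - a) (c - a) ↔ InCyc i j c := by
  rw [InCyc, InCyc, sub_sub_sub_cancel_right, sub_sub_sub_cancel_right]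

theorem inCyc_finRotate_pow (s : ℕ) (i j c : Fin n) : InCyc ((finRotate n ^ s) i) ((finRotate n ^ s) j)
    ((finRotate n ^ s) c) ↔ InCyc i j c := by
  rcases n with - | n
  · exact i.elim0
  have h : ∀ (s : ℕ) (x : Fin (n + 1)), (finRotate (n + 1) ^ s) x = x + Fin.ofNat (n + 1) s := by
    intro s
    induction s with
    | zero => simp
    | succ s ih =>
      intro x
      rw [pow_succ, Equiv.Perm.mul_apply, ih, finRotate_apply, add_one_add_ofNat]
  rw [h, h, h, InCyc, InCyc, add_sub_add_right_eq_sub, add_sub_add_right_eq_sub]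

theorem IsCyclicEmbedding.comp_finRotate_pow {κ : Fin n → Fin (n + 1)} {a : Fin (n + 1)}
    (h : IsCyclicEmbedding κ a) (s : ℕ) : IsCyclicEmbedding (κ ∘ ⇑(finRotate n ^ s)) a where
  ne _ := h.ne _
  inCyc i j k := (h.inCyc _ _ _).trans (inCyc_finRotate_pow s i j k)

theorem inCyc_swap_add_one [NeZero n] (hn : n ≠ 1) (a : Fin n) {x y z : Fin n} (hx : x ≠ a) (hy : y ≠ a)
    (hz : z ≠ a) : InCyc (Equiv.swap a (a + 1) x) (Equiv.swap a (a + 1) y) (Equiv.swap a (a + 1) z) ↔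
      InCyc x y z := by
  have h1 : ((1 : Fin n)).val = 1 := by
    have := NeZero.ne n
    obtain ⟨m, rfl⟩ : ∃ m, n = m + 2 := ⟨n - 2, by omega⟩
    rfl
  have key : ∀ t, t ≠ a → (t - a).val ≠ 0 ∧
      (Equiv.swap a (a + 1) t - a).val = if (t - a).val = 1 then 0 else (t - a).val := by
    intro t ht
    have h0 : (t - a).val ≠ 0 := fun e => ht (sub_eq_zero.mp (Fin.val_eq_zero_iff.mp e))
    refine ⟨h0, ?_⟩
    by_cases h : t = a + 1
    · subst h
      rw [Equiv.swap_apply_right, sub_self, add_sub_cancel_left, if_pos h1]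
      rfl
    · rw [Equiv.swap_apply_of_ne_of_ne ht h, if_neg]
      rw [← h1, ← Fin.ext_iff]
      exact fun e => h (by rw [← e]; abel)
  obtain ⟨hx0, hx1⟩ := key x hx
  obtain ⟨hy0, hy1⟩ := key y hy
  obtain ⟨hz0, hz1⟩ := key z hz
  rw [← inCyc_sub a, ← inCyc_sub a x]
  apply inCyc_congr <;> simp only [Fin.le_def, Fin.lt_def, hx1, hy1, hz1] <;> split_ifs <;> omega

/-- The missed point can be exchanged with a neighbour. -/
theorem IsCyclicEmbedding.slide {κ : Fin n → Fin (n + 1)} {a e : Fin (n + 1)} (hn : n ≠ 0)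
    (h : IsCyclicEmbedding κ a) (he : e = a + 1 ∨ a = e + 1) :
    IsCyclicEmbedding (Equiv.swap a e ∘ κ) e where
  ne c := by
    rw [Function.comp_apply, Ne, Equiv.swap_apply_eq_iff, Equiv.swap_apply_right]
    exact h.ne c
  inCyc i j k := by
    rw [← h.inCyc]
    have hn' : n + 1 ≠ 1 := by omega
    rcases he with rfl | rfl
    · exact inCyc_swap_add_one hn' a (h.ne i) (h.ne j) (h.ne k)
    · have key : ∀ c, Equiv.swap e (e + 1) (κ c) ≠ e := fun c hc => by
        rw [Equiv.swap_apply_eq_iff, Equiv.swap_apply_left] at hc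
        exact h.ne c hc
      have := inCyc_swap_add_one hn' e (key i) (key j) (key k)
      simp only [Equiv.swap_apply_self] at this
      rw [Equiv.swap_comm, this]
      rfl

theorem IsCyclicEmbedding.injective {κ : Fin n → Fin (n + 1)} {a : Fin (n + 1)}
    (h : IsCyclicEmbedding κ a) : Function.Injective κ := by
  intro i j hij
  by_contra hne
  have := (h.inCyc i j i).mpr (inCyc_left hne)
  rw [hij] at this
  exact not_inCyc_self _ _ this

/-- The retraction onto a cyclic embedding sends the missed point to its predecessor. -/
theorem IsCyclicEmbedding.exists_cycMap {κ : Fin n → Fin (n + 1)} {l : Fin (n + 1)} (hn : n ≠ 0)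
    (h : IsCyclicEmbedding κ (l + 1)) : ∃ π, CycMap κ π ∧ π (l + 1) = π l := by
  have hl := ne_add_one (N := n + 1) (by omega) l
  have hs : ∀ t, ∃ c, κ c = if t = l + 1 then l else t := by
    intro t
    refine exists_eq_of_ne h.injective h.ne ?_
    split_ifs with ht
    · exact hl
    · exact ht
  choose π hπ using hs
  have hr : ∀ i, π (κ i) = i := fun i => h.injective (by rw [hπ, if_neg (h.ne i)])
  refine ⟨π, ⟨fun i j t => ?_, hr⟩, h.injective (by rw [hπ, hπ, if_pos rfl, if_neg hl])⟩
  rw [← h.inCyc, hπ]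
  split_ifs with ht
  · rw [ht, inCyc_add_one_iff (h.ne i) (h.ne j)]
  · rfl

end CyclicEmbedding

/-! ### Stabilizations as insertions of a column with adjacent markings -/

section PairStabilization

open MvPolynomial

variable {n : ℕ}

namespace GridDiagram

/-- `G'` arises from `G` by the insertion of the column `a` and the row `b`, where the new column carries a
pair of vertically adjacent markings: an `O` in the new row and an `X` in the adjacent row `b'`.
The `X`-marking of the column `c₀` of `G` lies in the row of `b'`, and is moved to the new row.
The new column can be anywhere. -/
structure IsPairStabilization (G : GridDiagram n) (G' : GridDiagram (n + 1)) (c₀ : Fin n)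
    (a b b' : Fin (n + 1)) (κ η : Fin n → Fin (n + 1)) : Prop where
  col : IsCyclicEmbedding κ a
  row : IsCyclicEmbedding η b
  X_split : η (G.X c₀) = b'
  O_new : G'.O a = b
  X_new : G'.X a = b'
  X_moved : G'.X (κ c₀) = b
  O_old : ∀ c, G'.O (κ c) = η (G.O c)
  X_old : ∀ c, c ≠ c₀ → G'.X (κ c) = η (G.X c)

/-- An isomorphism of the homology groups that misses one variable, which acts like one of the
others. -/
def IsStableIso (G : GridDiagram n) (G' : GridDiagram (n + 1)) : Prop :=
  ∃ (lam : Fin n → Fin (n + 1)) (j k : Fin (n + 1)), GridIso G G' lam ∧ Function.Injective lam ∧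
    (∀ c, lam c ≠ j) ∧ k ≠ j ∧
    ∀ h : G'.GH, (MvPolynomial.X (some j) + MvPolynomial.X (some k) : GridRing (n + 1)) • h = 0

theorem IsStableIso.trans_perm {G : GridDiagram n} {G' G'' : GridDiagram (n + 1)}
    {σ : Equiv.Perm (Fin (n + 1))} (h : IsStableIso G G') (h' : GridIso G' G'' σ) :
    IsStableIso G G'' := by
  obtain ⟨lam, j, k, h1, h2, h3, h4, h5⟩ := h
  refine ⟨σ ∘ lam, σ j, σ k, h1.trans h', σ.injective.comp h2, fun c => σ.injective.ne (h3 c),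
    σ.injective.ne h4, fun z => ?_⟩
  obtain ⟨φ, hφ, -⟩ := h'
  have := hφ (MvPolynomial.X (some j) + MvPolynomial.X (some k)) (φ.symm z)
  rw [h5, map_zero, φ.apply_symm_apply] at this
  simpa [renameHom] using this.symm

variable {G : GridDiagram n} {G' : GridDiagram (n + 1)} {c₀ : Fin n} {a b b' : Fin (n + 1)}
  {κ η : Fin n → Fin (n + 1)}

theorem two_le (G : GridDiagram n) (c : Fin n) : 2 ≤ n := by
  by_contra h
  have : n = 1 := by have := c.isLt; omega
  subst this
  exact G.disjoint c (Subsingleton.elim (α := Fin 1) _ _)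

/-- The case where the new markings form a block with the moved marking and the new column is on the
right. The horizontal circle through the middle of the block is then `b + 1` instead of `b`, whence the
transposition. -/
theorem IsPairStabilization.blockRemoval_right (S : IsPairStabilization G G' c₀ (κ c₀ + 1) b (b + 1) κ η) :
    ∃ π ρ, G.IsBlockRemoval G' (κ c₀) b (κ c₀ + 1) κ (Equiv.swap b (b + 1) ∘ η) κ π ρ := by
  have hn := G.two_le c₀
  obtain ⟨π, hπ, hπ'⟩ := S.col.exists_cycMap (by omega)
  obtain ⟨ρ, hρ, hρ'⟩ := (S.row.slide (by omega) (Or.inl rfl)).exists_cycMap (by omega)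
  have h0 : ρ b = G.X c₀ := by
    have := hρ.retr (G.X c₀)
    rwa [Function.comp_apply, S.X_split, Equiv.swap_apply_right] at this
  have hη : ∀ r, ρ (η r) = r := by
    intro r
    by_cases hr : r = G.X c₀
    · rw [hr, S.X_split, hρ', h0]
    · have := hρ.retr r
      rwa [Function.comp_apply, Equiv.swap_apply_of_ne_of_ne (S.row.ne r)
        fun e => hr (S.row.injective (e.trans S.X_split.symm))] at this
  refine ⟨π, ρ, ⟨⟨by omega, S.X_moved, S.X_new, Or.inr ⟨?_, S.O_new⟩⟩, hπ, hρ, S.col.ne,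
    (S.row.slide (by omega) (Or.inl rfl)).ne, fun t => ?_, S.col.ne, hπ.retr, fun c => ?_,
    Or.inr ⟨rfl, S.O_new⟩⟩⟩
  · rw [S.O_old, ← S.X_split]
    exact S.row.injective.ne (G.disjoint c₀)
  · by_cases ht : t = κ c₀ + 1
    · rw [ht, S.X_new, hρ', h0, hπ', hπ.retr]
    · obtain ⟨c, rfl⟩ := exists_eq_of_ne S.col.injective S.col.ne ht
      rw [hπ.retr]
      by_cases hc : c = c₀
      · rw [hc, S.X_moved, h0]
      · rw [S.X_old c hc, hη]
  · rw [S.O_old, hη]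

/-- The case where the new markings form a block with the moved marking and the new column is on the
left. -/
theorem IsPairStabilization.blockRemoval_left (S : IsPairStabilization G G' c₀ a (b' + 1) b' κ η)
    (ha : κ c₀ = a + 1) :
    ∃ π ρ, G.IsBlockRemoval G' a b' a (Equiv.swap a (a + 1) ∘ κ) η κ π ρ := by
  have hn := G.two_le c₀
  obtain ⟨π, hπ, hπ'⟩ := (S.col.slide (by omega) (Or.inl rfl)).exists_cycMap (by omega)
  obtain ⟨ρ, hρ, hρ'⟩ := S.row.exists_cycMap (by omega)
  have h0 : π a = c₀ := by
    have := hπ.retr c₀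
    rwa [Function.comp_apply, ha, Equiv.swap_apply_right] at this
  have hκ : ∀ c, π (κ c) = c := by
    intro c
    by_cases hc : c = c₀
    · rw [hc, ha, hπ', h0]
    · have := hπ.retr c
      rwa [Function.comp_apply, Equiv.swap_apply_of_ne_of_ne (S.col.ne c)
        fun e => hc (S.col.injective (e.trans ha.symm))] at this
  have hX : G'.X (a + 1) = b' + 1 := by rw [← ha, S.X_moved]
  have hb : ρ b' = G.X c₀ := by rw [← S.X_split, hρ.retr]
  refine ⟨π, ρ, ⟨⟨by omega, S.X_new, hX, Or.inl ⟨S.O_new, ?_⟩⟩, hπ, hρ,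
    (S.col.slide (by omega) (Or.inl rfl)).ne, S.row.ne, fun t => ?_, S.col.ne, hκ, fun c => ?_,
    Or.inl ⟨rfl, S.O_new⟩⟩⟩
  · rw [← ha, S.O_old, ← S.X_split]
    exact S.row.injective.ne (G.disjoint c₀)
  · by_cases ht : t = a
    · rw [ht, S.X_new, h0, hb]
    · obtain ⟨c, rfl⟩ := exists_eq_of_ne S.col.injective S.col.ne ht
      rw [hκ]
      by_cases hc : c = c₀
      · rw [hc, S.X_moved, hρ', hb]
      · rw [S.X_old c hc, hρ.retr]
  · rw [S.O_old, hρ.retr]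

/-- Interchanging the new column with the column on its right gives a stabilization of the same kind. -/
theorem IsPairStabilization.move (S : IsPairStabilization G G' c₀ a b b' κ η) :
    IsPairStabilization G (G'.exchangeColumns a) c₀ (a + 1) b b' (Equiv.swap a (a + 1) ∘ κ) η where
  col := S.col.slide (by have := G.two_le c₀; omega) (Or.inl rfl)
  row := S.row
  X_split := S.X_split
  O_new := by rw [← S.O_new, exchangeColumns, Equiv.Perm.mul_apply, Equiv.swap_apply_right]
  X_new := by rw [← S.X_new, exchangeColumns, Equiv.Perm.mul_apply, Equiv.swap_apply_right]
  X_moved := by rw [← S.X_moved, exchangeColumns, Equiv.Perm.mul_apply, Function.comp_apply,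
    Equiv.swap_apply_self]
  O_old c := by rw [← S.O_old, exchangeColumns, Equiv.Perm.mul_apply, Function.comp_apply,
    Equiv.swap_apply_self]
  X_old c hc := by rw [← S.X_old c hc, exchangeColumns, Equiv.Perm.mul_apply, Function.comp_apply,
    Equiv.swap_apply_self]

/-- The new column carries adjacent markings, so that it can be moved to the right by a commutation. -/
theorem IsPairStabilization.isStableIso_of_move (S : IsPairStabilization G G' c₀ a b b' κ η)
    (hb : b' = b + 1 ∨ b = b' + 1) (h : IsStableIso G (G'.exchangeColumns a)) : IsStableIso G G' := by
  have hn := G.two_le c₀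
  obtain ⟨g, hg⟩ : ∃ g, G'.IsPairColumn a g := by
    rcases hb with hb | hb
    · exact ⟨b, by omega, Or.inl ⟨S.O_new, by rw [S.X_new, hb]⟩⟩
    · exact ⟨b', by omega, Or.inr ⟨by rw [S.O_new, hb], S.X_new⟩⟩
  exact h.trans_perm hg.gridIso.symm

/-- The new column is moved to the right around the torus, until it forms a block with the moved
marking. -/
theorem IsPairStabilization.isStableIso (S : IsPairStabilization G G' c₀ a b b' κ η)
    (hb : b' = b + 1 ∨ b = b' + 1) : IsStableIso G G' := by
  have hn := G.two_le c₀
  have hval : ∀ {a : Fin (n + 1)} {κ : Fin n → Fin (n + 1)}, κ c₀ ≠ a → κ c₀ ≠ a + 1 →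
      ((Equiv.swap a (a + 1) ∘ κ) c₀ - (a + 1)).val + 1 = (κ c₀ - a).val := by
    intro a κ h2 h3
    rw [Function.comp_apply, Equiv.swap_apply_of_ne_of_ne h2 h3, ← sub_sub]
    have h4 : κ c₀ - a ≠ 0 := sub_ne_zero.mpr h2
    have h5 : (κ c₀ - a).val ≠ 0 := fun e => h4 (Fin.val_eq_zero_iff.mp e)
    rw [Fin.val_sub_one_of_ne_zero h4]
    omega
  rcases hb with rfl | rfl
  · -- The moved marking lies below the new one: the new column has to be on the right of it.
    have base : ∀ {G' : GridDiagram (n + 1)} {a : Fin (n + 1)} {κ : Fin n → Fin (n + 1)},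
        IsPairStabilization G G' c₀ a b (b + 1) κ η → a = κ c₀ + 1 → IsStableIso G G' := by
      rintro G' _ κ S rfl
      obtain ⟨π, ρ, R⟩ := S.blockRemoval_right
      refine ⟨κ, κ c₀ + 1, G'.O.symm (b + 1), R.gridIso.1, S.col.injective, S.col.ne, fun e => ?_,
        fun h => (R.gridIso.2 h).1⟩
      rw [Equiv.symm_apply_eq, S.O_new] at e
      exact ne_add_one (N := n + 1) (by omega) b e.symm
    have step : ∀ (d : ℕ) {G' : GridDiagram (n + 1)} {a : Fin (n + 1)} {κ : Fin n → Fin (n + 1)},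
        IsPairStabilization G G' c₀ a b (b + 1) κ η → (κ c₀ - a).val = d → IsStableIso G G' := by
      intro d
      induction d with
      | zero =>
        intro G' a κ S hd
        exact absurd (sub_eq_zero.mp (Fin.val_eq_zero_iff.mp hd)) (S.col.ne c₀)
      | succ d ih =>
        intro G' a κ S hd
        refine S.isStableIso_of_move (Or.inl rfl) ?_
        by_cases h : κ c₀ = a + 1
        · exact base S.move (by rw [Function.comp_apply, h, Equiv.swap_apply_right])
        · exact ih S.move (by have := hval (S.col.ne c₀) h; omega)
    exact step _ S rfl
  · -- The moved marking lies above the new one: the new column has to be on the left of it.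
    have step : ∀ (d : ℕ) {G' : GridDiagram (n + 1)} {a : Fin (n + 1)} {κ : Fin n → Fin (n + 1)},
        IsPairStabilization G G' c₀ a (b' + 1) b' κ η → (κ c₀ - a).val = d → IsStableIso G G' := by
      intro d
      induction d with
      | zero =>
        intro G' a κ S hd
        exact absurd (sub_eq_zero.mp (Fin.val_eq_zero_iff.mp hd)) (S.col.ne c₀)
      | succ d ih =>
        intro G' a κ S hd
        by_cases h : κ c₀ = a + 1
        · obtain ⟨π, ρ, R⟩ := S.blockRemoval_left h
          refine ⟨κ, a, G'.O.symm b', R.gridIso.1, S.col.injective, S.col.ne, fun e => ?_,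
            fun h => (R.gridIso.2 h).2⟩
          rw [Equiv.symm_apply_eq, S.O_new] at e
          exact ne_add_one (N := n + 1) (by omega) b' e
        · exact S.isStableIso_of_move (Or.inr rfl)
            (ih S.move (by have := hval (S.col.ne c₀) h; omega))
    exact step _ S rfl

/-- A stabilization of any type inserts a column with two vertically adjacent markings. -/
theorem isStableIso_of_isStabilization (c : Fin n) (h : IsStabilization G G') : IsStableIso G G' := by
  have hn := G.two_le c
  obtain ⟨s, t, ⟨c₀, a, b, -, hb, h1, h2, h3, h4, h5⟩ | ⟨c₀, a, b, -, hb, h1, h2, h3, h4, h5⟩⟩ := h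
  · refine IsPairStabilization.isStableIso (c₀ := (finRotate n ^ s)⁻¹ c₀) (a := a) (b := b)
      (κ := a.succAbove ∘ ⇑(finRotate n ^ s)) (η := b.succAbove ∘ ⇑(finRotate n ^ t))
      ⟨(isCyclicEmbedding_succAbove a).comp_finRotate_pow s,
        (isCyclicEmbedding_succAbove b).comp_finRotate_pow t, rfl, h1, h3, ?_, fun c => ?_,
        fun c hc => ?_⟩ hb
    · simpa using h4
    · simpa [translate] using h2 ((finRotate n ^ s) c)
    · have := h5 ((finRotate n ^ s) c) fun e => hc (by rw [← e]; simp)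
      simpa [translate] using this
  · -- In the stabilization at an `O`-marking the roles of the two new rows are exchanged.
    set η := b.succAbove ∘ ⇑(finRotate n ^ t) with hη
    have hrow : IsCyclicEmbedding η b := (isCyclicEmbedding_succAbove b).comp_finRotate_pow t
    set c₁ := (finRotate n ^ s)⁻¹ c₀ with hc₁
    set e := η (G.O c₁) with he
    have hX : ∀ c, G'.X ((a.succAbove ∘ ⇑(finRotate n ^ s)) c) = η (G.X c) := fun c => by
      simpa [translate, exchange, hη] using h2 ((finRotate n ^ s) c)
    have hne : ∀ r, r ≠ G.O c₁ → Equiv.swap b e (η r) = η r := fun r hr =>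
      Equiv.swap_apply_of_ne_of_ne (hrow.ne r) (hrow.injective.ne hr)
    refine IsPairStabilization.isStableIso (c₀ := G.X.symm (G.O c₁)) (a := a) (b := e) (b' := b)
      (κ := a.succAbove ∘ ⇑(finRotate n ^ s)) (η := Equiv.swap b e ∘ η)
      ⟨(isCyclicEmbedding_succAbove a).comp_finRotate_pow s,
        hrow.slide (by omega) hb, ?_, h3, h1, ?_, fun c => ?_, fun c hc => ?_⟩ hb.symm
    · rw [Function.comp_apply, Equiv.apply_symm_apply, ← he, Equiv.swap_apply_right]
    · rw [hX, Equiv.apply_symm_apply]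
    · by_cases hc : c = c₁
      · rw [hc, Function.comp_apply, Function.comp_apply, ← he, Equiv.swap_apply_right]
        simpa [hc₁, exchange] using h4
      · have := h5 ((finRotate n ^ s) c) fun e => hc (by rw [hc₁, ← e]; simp)
        rw [Function.comp_apply, Function.comp_apply, hne _ (G.O.injective.ne hc)]
        simpa [translate, exchange, hη] using this
    · rw [hX, Function.comp_apply, hne]
      exact fun e => hc (by rw [Equiv.eq_symm_apply, e])

end GridDiagram

end PairStabilization

/-! ### The action of the variables -/

section Variables

open MvPolynomial

variable {n : ℕ}

namespace GridDiagram

/-- The permutation of `Fin (n + 1)` that extends `σ` by `a ↦ b`. -/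
def insertPoint (σ : Equiv.Perm (Fin n)) (a b : Fin (n + 1)) : Equiv.Perm (Fin (n + 1)) :=
  (finSuccEquiv' a).trans ((Equiv.optionCongr σ).trans (finSuccEquiv' b).symm)

theorem insertPoint_self (σ : Equiv.Perm (Fin n)) (a b : Fin (n + 1)) : insertPoint σ a b a = b := by
  simp [insertPoint]

theorem insertPoint_succAbove (σ : Equiv.Perm (Fin n)) (a b : Fin (n + 1)) (c : Fin n) :
    insertPoint σ a b (a.succAbove c) = b.succAbove (σ c) := by
  simp [insertPoint]

/-- The `X`-marking of any column can be stabilized, with the new column on its right and the moved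
marking below the new one. -/
theorem exists_isPairStabilization (G : GridDiagram n) (c₀ : Fin n) :
    ∃ (G' : GridDiagram (n + 1)) (b : Fin (n + 1)) (κ η : Fin n → Fin (n + 1)),
      IsPairStabilization G G' c₀ (κ c₀ + 1) b (b + 1) κ η := by
  set a := c₀.succ with ha
  set b := (G.X c₀).castSucc with hb
  have ha' : a = a.succAbove c₀ + 1 := by
    rw [ha, Fin.succAbove_succ_self, Fin.coeSucc_eq_succ]
  have hb' : b.succAbove (G.X c₀) = b + 1 := by
    rw [hb, Fin.succAbove_castSucc_self, Fin.coeSucc_eq_succ]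
  have hO : ∀ c, insertPoint G.O a b (a.succAbove c) = b.succAbove (G.O c) :=
    insertPoint_succAbove _ _ _
  have hXa : (insertPoint G.X a b * Equiv.swap a (a.succAbove c₀)) a = b + 1 := by
    rw [Equiv.Perm.mul_apply, Equiv.swap_apply_left, insertPoint_succAbove, hb']
  have hX0 : (insertPoint G.X a b * Equiv.swap a (a.succAbove c₀)) (a.succAbove c₀) = b := by
    rw [Equiv.Perm.mul_apply, Equiv.swap_apply_right, insertPoint_self]
  have hX : ∀ c, c ≠ c₀ → (insertPoint G.X a b * Equiv.swap a (a.succAbove c₀)) (a.succAbove c) =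
      b.succAbove (G.X c) := fun c hc => by
    rw [Equiv.Perm.mul_apply, Equiv.swap_apply_of_ne_of_ne (Fin.succAbove_ne a c)
      (Fin.succAbove_right_injective.ne hc), insertPoint_succAbove]
  have hn := G.two_le c₀
  refine ⟨⟨insertPoint G.O a b, insertPoint G.X a b * Equiv.swap a (a.succAbove c₀), fun t => ?_⟩, b,
    a.succAbove, b.succAbove, ?_⟩
  · by_cases ht : t = a
    · rw [ht, insertPoint_self, hXa]
      exact ne_add_one (N := n + 1) (by omega) b
    · obtain ⟨c, rfl⟩ := Fin.exists_succAbove_eq ht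
      rw [hO]
      by_cases hc : c = c₀
      · rw [hc, hX0]
        exact Fin.succAbove_ne _ _
      · rw [hX c hc]
        exact Fin.succAbove_right_injective.ne (G.disjoint c)
  · rw [← ha']
    exact ⟨isCyclicEmbedding_succAbove a, isCyclicEmbedding_succAbove b, hb', insertPoint_self _ _ _,
      hXa, hX0, hO, hX⟩

theorem smul_eq_smul_of_add {m : ℕ} {M : Type*} [AddCommGroup M] [Module (GridRing m) M]
    {p q : GridRing m} {h : M} (hpq : (p + q) • h = 0) : p • h = q • h := by
  rwa [← CharTwo.sub_eq_add, sub_smul, sub_eq_zero] at hpq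

/-- The variables of the two `O`-markings next to an `X`-marking, in its column and in its row, act alike. -/
theorem smul_X_eq (G : GridDiagram n) (c : Fin n) (h : G.GH) :
    (MvPolynomial.X (some c) : GridRing n) • h = (MvPolynomial.X (some (G.O.symm (G.X c))) : GridRing n) • h := by
  obtain ⟨G', b, κ, η, S⟩ := G.exists_isPairStabilization c
  obtain ⟨π, ρ, R⟩ := S.blockRemoval_right
  obtain ⟨⟨φ, hφ, -⟩, hrel⟩ := R.gridIso
  have h1 : G'.O.symm b = κ c + 1 := by rw [Equiv.symm_apply_eq, S.O_new]
  have h2 : G'.O.symm (b + 1) = κ (G.O.symm (G.X c)) := by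
    rw [Equiv.symm_apply_eq, S.O_old, Equiv.apply_symm_apply, S.X_split]
  have h3 := smul_eq_smul_of_add (hrel (φ h)).1
  have h4 := smul_eq_smul_of_add (hrel (φ h)).2
  rw [h2] at h3
  rw [h1] at h4
  refine φ.injective ?_
  rw [hφ, hφ]
  simpa [renameHom] using h4.trans h3

/-- Going around the knot relates all variables. -/
theorem IsKnot.smul_X_eq {G : GridDiagram n} (hG : G.IsKnot) (i j : Fin n) (h : G.GH) :
    (MvPolynomial.X (some i) : GridRing n) • h = (MvPolynomial.X (some j) : GridRing n) • h := by
  have hfix : ∀ c, (G.X⁻¹ * G.O) c ≠ c := fun c e => G.disjoint c (by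
    rw [Equiv.Perm.mul_apply, Equiv.Perm.inv_eq_iff_eq] at e
    exact e)
  obtain ⟨k, rfl⟩ := hG.sameCycle (hfix j) (hfix i)
  have step : ∀ c, (MvPolynomial.X (some ((G.X⁻¹ * G.O) c)) : GridRing n) • h =
      (MvPolynomial.X (some c) : GridRing n) • h := by
    intro c
    have hc : G.O.symm (G.X ((G.X⁻¹ * G.O) c)) = c := by simp
    rw [G.smul_X_eq, hc]
  induction k using Int.induction_on with
  | zero => rfl
  | succ k ih => rw [add_comm, zpow_add, zpow_one, Equiv.Perm.mul_apply, step, ih]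
  | pred k ih =>
    rw [← ih, ← step, ← Equiv.Perm.mul_apply, ← zpow_one_add]
    simp

theorem uvHom_smul_eq {m : ℕ} {M : Type*} [AddCommGroup M] [Module (GridRing m) M] {i j : Fin m}
    (hij : ∀ h : M, (MvPolynomial.X (some i) : GridRing m) • h = (MvPolynomial.X (some j) : GridRing m) • h)
    (p : MvPolynomial (Fin 2) (ZMod 2)) (h : M) : uvHom i p • h = uvHom j p • h := by
  induction p using MvPolynomial.induction_on generalizing h with
  | C a => simp [uvHom]
  | add p q hp hq => rw [map_add, map_add, add_smul, add_smul, hp, hq]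
  | mul_X p k hp =>
    rw [map_mul, map_mul, mul_smul, mul_smul, hp]
    congr 1
    fin_cases k
    · simpa [uvHom] using hij h
    · simp [uvHom]

end GridDiagram

end Variables

theorem mainTheorem3 {n : ℕ} (G : GridDiagram n) (G' : GridDiagram (n + 1)) (hG : G.IsKnot)
    (hst : GridDiagram.IsStabilization G G') :
    G.diff ∘ₗ G.diff = 0 ∧ G'.diff ∘ₗ G'.diff = 0 ∧
    ∃ φ : G.GH ≃+ G'.GH,
      (∀ (i : Fin n) (j : Fin (n + 1)) (p : MvPolynomial (Fin 2) (ZMod 2)) (h : G.GH),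
        φ (uvHom i p • h) = uvHom j p • φ h) ∧
      ∀ (d : ℤ) (s : ℚ) (h : G.GH),
        G.HomogeneousClass d s h ↔ G'.HomogeneousClass d s (φ h) := by
  obtain ⟨c, -⟩ := id hG
  refine ⟨G.diff_comp_diff, G'.diff_comp_diff, ?_⟩
  obtain ⟨lam, j₀, k, ⟨φ, hφ, hhom⟩, hinj, hne, hk, hrel⟩ :=
    GridDiagram.isStableIso_of_isStabilization c hst
  refine ⟨φ, fun i j p h => ?_, hhom⟩
  have hlam : ∀ (i i' : Fin n) (h : G'.GH), (MvPolynomial.X (some (lam i)) : GridRing (n + 1)) • h =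
      (MvPolynomial.X (some (lam i')) : GridRing (n + 1)) • h := by
    intro i i' h
    have := congrArg φ (hG.smul_X_eq i i' (φ.symm h))
    rw [hφ, hφ, φ.apply_symm_apply] at this
    simpa [renameHom] using this
  have hall : ∀ h : G'.GH, (MvPolynomial.X (some (lam i)) : GridRing (n + 1)) • h =
      (MvPolynomial.X (some j) : GridRing (n + 1)) • h := by
    intro h
    by_cases hj : j = j₀
    · obtain ⟨i', rfl⟩ := exists_eq_of_ne hinj hne hk
      rw [hj, GridDiagram.smul_eq_smul_of_add (hrel h)]
      exact hlam i i' h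
    · obtain ⟨i', rfl⟩ := exists_eq_of_ne hinj hne hj
      exact hlam i i' h
  rw [hφ, ← GridDiagram.uvHom_smul_eq hall]
  congr 1
  induction p using MvPolynomial.induction_on with
  | C a => simp [uvHom, renameHom]
  | add p q hp hq => rw [map_add, map_add, hp, hq, map_add]
  | mul_X p k hp =>
    rw [map_mul, map_mul, hp, map_mul]
    congr 1
    fin_cases k <;> simp [uvHom, renameHom]
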